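/- Let $A$ be a von Neumann algebra, acting on a Hilbert space $H$. Let $H_A$ be the standard (right) Hilbert $A$-module, i.e. the completion of $\bigoplus_{i\in\mathbb N}A$ with inner product $\langle a,b\rangle=\sum_i a_i^*b_i$; concretely, $H_A$ consists of the sequences $(a_i)$ in $A$ for which $\sum_i a_i^*a_i$ converges in norm. Let $\mathrm{End}_A(H_A)$ be the algebra of adjointable $A$-linear operators on $H_A$, and let $K_A(H_A)$ be the norm closure of the span of the operators $x\mapsto v\langle w,x\rangle$, $v,w\in H_A$. An operator $f\in\mathrm{End}_A(H_A)$ is called $A$-Fredholm if it is invertible modulo $K_A(H_A)$. A Hilbert $A$-module is finitely generated projective if it is isomorphic to $pA^n$ for some $n$ and some projection $p=p^2=p^*\in M_n(A)$, and $K_0(A)$ is the Grothendieck group of the monoid of isomorphism classes of such modules under direct sum. For $g\in \mathrm{End}_A(H_A)$ with closed image, $\mathrm{coker}(g)$ is regarded as the Hilbert $A$-module $(\mathrm{im}\,g)^\perp$. For a self-adjoint $T\in\mathrm{End}_A(H_A)$ and a bounded Borel function $g$ on $\mathbb R$, the operator $g(T)$ of the measurable functional calculus is said to exist in $\mathrm{End}_A(H_A)$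 if there is $S\in\mathrm{End}_A(H_A)$ with $\langle\eta,\langle x,Sx\rangle\eta\rangle=\int g\,d\mu_{x,\eta}$ for all $x\in H_A$, $\eta\in H$, where $\mu_{x,\eta}$ is the finite compactly supported Borel measure on $\mathbb R$ with $\int t^n\,d\mu_{x,\eta}(t)=\langle\eta,\langle x,T^nx\rangle\eta\rangle$ for all $n\ge 0$; then $g(T):=S$. Theorem. Let $f\in\mathrm{End}_A(H_A)$ be $A$-Fredholm. 1. The operators $p_{\ker}:=\chi_{\{0\}}(f^*f)$ and $p_{\mathrm{coker}}:=\chi_{\{0\}}(ff^*)$ of the measurable functional calculus exist in $\mathrm{End}_A(H_A)$, are unique, and are projections. 2. The Mishchenko index $\mathrm{ind}_A(f)\in K_0(A)$ is well defined: there is $k\in K_A(H_A)$ such that $f+k$ has closed image, and for every such $k$ the modules $\ker(f+k)$ and $\mathrm{coker}(f+k)$ are finitely generated projective and $\mathrm{ind}_A(f)=[\ker(f+k)]-[\mathrm{coker}(f+k)]$, independently of $k$. 3. The images of $p_{\ker}$ and $p_{\mathrm{coker}}$ are finitely generated projective Hilbert $A$-modules, and $$[\mathrm{im}(p_{\ker})]-[\mathrm{im}(p_{\mathrm{coker}})]=\mathrm{ind}_A(f)\in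 K_0(A).$$ -/

import Mathlib

open MulOpposite MeasureTheory

namespace HilbertIndex

universe u v w

/-! ## Hilbert modules over a unital C⋆-algebra -/

/-- Positive elements of a C⋆-algebra, written in the form `b⋆ b`. -/
def IsPos {A : Type u} [CStarAlgebra A] (a : A) : Prop := ∃ b : A, a = star b * b

theorem isPos_add {A : Type u} [CStarAlgebra A] {a b : A} (ha : IsPos a) (hb : IsPos b) :
    IsPos (a + b) := by
  let _ := CStarAlgebra.spectralOrder A
  let _ := CStarAlgebra.spectralOrderedRing A
  have key : ∀ c : A, IsPos c ↔ 0 ≤ c := fun c =>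
    CStarAlgebra.nonneg_iff_eq_star_mul_self.symm
  rw [key] at *
  exact add_nonneg ha hb

theorem isPos_sum {A : Type u} [CStarAlgebra A] {ι : Type*} (s : Finset ι) (a : ι → A)
    (ha : ∀ i, IsPos (a i)) : IsPos (∑ i ∈ s, a i) := by
  classical
  induction s using Finset.induction_on with
  | empty => exact ⟨0, by simp⟩
  | insert i s hi ih => rw [Finset.sum_insert hi]; exact isPos_add (ha i) ih

theorem isPos_tsum {A : Type u} [CStarAlgebra A] {ι : Type*} (a : ι → A)
    (ha : ∀ i, IsPos (a i)) : IsPos (∑' i, a i) := by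
  let _ := CStarAlgebra.spectralOrder A
  let _ := CStarAlgebra.spectralOrderedRing A
  have key : ∀ c : A, IsPos c ↔ 0 ≤ c := fun c =>
    CStarAlgebra.nonneg_iff_eq_star_mul_self.symm
  simp only [key] at *
  exact tsum_nonneg ha

theorem eq_zero_of_isPos_add {A : Type u} [CStarAlgebra A] {a b : A} (ha : IsPos a)
    (hb : IsPos b) (h : a + b = 0) : a = 0 := by
  let _ := CStarAlgebra.spectralOrder A
  let _ := CStarAlgebra.spectralOrderedRing A
  have key : ∀ c : A, IsPos c ↔ 0 ≤ c := fun c =>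
    CStarAlgebra.nonneg_iff_eq_star_mul_self.symm
  rw [key] at *
  exact ((add_eq_zero_iff_of_nonneg ha hb).1 h).1

/-- A right `A`-module (that is, a module over `Aᵐᵒᵖ`, with `v · a` written `op a • v`) with an
`A`-valued inner product, linear in the second variable. It is a Hilbert `A`-module if it is
complete for the norm `‖⟨v, v⟩‖ ^ (1/2)`; this is automatic for the standard module and for the
finitely generated projective modules below. -/
class InnerModule (A : Type u) [CStarAlgebra A] (E : Type v) [AddCommGroup E]
    [Module Aᵐᵒᵖ E] where
  ip : E → E → A
  ip_smul_right : ∀ (x y : E) (a : A), ip x (op a • y) = ip x y * a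
  ip_add_left : ∀ x y z : E, ip (x + y) z = ip x z + ip y z
  star_ip : ∀ x y : E, star (ip y x) = ip x y
  ip_self_pos : ∀ x : E, IsPos (ip x x)
  ip_self_eq_zero : ∀ x : E, ip x x = 0 → x = 0

section Basic

variable (A : Type u) [CStarAlgebra A]
variable {E : Type v} [AddCommGroup E] [Module Aᵐᵒᵖ E] [InnerModule A E]
variable {F : Type w} [AddCommGroup F] [Module Aᵐᵒᵖ F] [InnerModule A F]

/-- The `A`-valued inner product. -/
def ip (x y : E) : A := InnerModule.ip x y

/-- The norm of a Hilbert module. -/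
noncomputable def hnorm (x : E) : ℝ := Real.sqrt ‖ip A x x‖

theorem ip_smul_right (x y : E) (a : A) : ip A x (op a • y) = ip A x y * a :=
  InnerModule.ip_smul_right x y a

theorem ip_add_left (x y z : E) : ip A (x + y) z = ip A x z + ip A y z :=
  InnerModule.ip_add_left x y z

theorem star_ip (x y : E) : star (ip A y x) = ip A x y := InnerModule.star_ip x y

theorem ip_self_pos (x : E) : IsPos (ip A x x) := InnerModule.ip_self_pos x

theorem ip_self_eq_zero (x : E) (h : ip A x x = 0) : x = 0 := InnerModule.ip_self_eq_zero x h

theorem ip_add_right (x y z : E) : ip A x (y + z) = ip A x y + ip A x z := by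
  rw [← star_ip A x (y + z), ip_add_left, star_add, star_ip, star_ip]

theorem ip_smul_left (x y : E) (a : A) : ip A (op a • x) y = star a * ip A x y := by
  rw [← star_ip A (op a • x) y, ip_smul_right, star_mul, star_ip]

theorem ip_zero_right (x : E) : ip A x (0 : E) = 0 := by
  have h := ip_add_right A x 0 0
  simpa using h

theorem ip_zero_left (x : E) : ip A (0 : E) x = 0 := by
  rw [← star_ip A 0 x, ip_zero_right, star_zero]

theorem ip_neg_right (x y : E) : ip A x (-y) = -ip A x y := by
  have h := ip_add_right A x y (-y)
  rw [add_neg_cancel, ip_zero_right] at h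
  exact (neg_eq_of_add_eq_zero_right h.symm).symm

theorem ip_neg_left (x y : E) : ip A (-x) y = -ip A x y := by
  rw [← star_ip A (-x) y, ip_neg_right, star_neg, star_ip]

theorem ip_sub_right (x y z : E) : ip A x (y - z) = ip A x y - ip A x z := by
  rw [sub_eq_add_neg, ip_add_right, ip_neg_right, sub_eq_add_neg]

theorem ext_ip_right {y z : E} (h : ∀ x : E, ip A x y = ip A x z) : y = z := by
  rw [← sub_eq_zero]
  apply ip_self_eq_zero A
  rw [ip_sub_right, h, sub_self]

end Basic

section Constructions

variable (A : Type u) [CStarAlgebra A]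
variable {E : Type v} [AddCommGroup E] [Module Aᵐᵒᵖ E] [InnerModule A E]
variable {F : Type w} [AddCommGroup F] [Module Aᵐᵒᵖ F] [InnerModule A F]

/-- Submodules with the restricted inner product. -/
instance instSubmodule (N : Submodule Aᵐᵒᵖ E) : InnerModule A N where
  ip x y := ip A (x : E) (y : E)
  ip_smul_right x y a := ip_smul_right A (x : E) y a
  ip_add_left x y z := ip_add_left A (x : E) y z
  star_ip x y := star_ip A (x : E) y
  ip_self_pos x := ip_self_pos A (x : E)
  ip_self_eq_zero x h := Subtype.ext (ip_self_eq_zero A (x : E) h)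

/-- The direct sum of two Hilbert modules. -/
instance instProd : InnerModule A (E × F) where
  ip x y := ip A x.1 y.1 + ip A x.2 y.2
  ip_smul_right x y a := by
    simp only [Prod.smul_fst, Prod.smul_snd, ip_smul_right, add_mul]
  ip_add_left x y z := by
    simp only [Prod.fst_add, Prod.snd_add, ip_add_left]; abel
  star_ip x y := by simp only [star_add, star_ip]
  ip_self_pos x := isPos_add (ip_self_pos A x.1) (ip_self_pos A x.2)
  ip_self_eq_zero x h := by
    have h1 := eq_zero_of_isPos_add (ip_self_pos A x.1) (ip_self_pos A x.2) h
    have h2 := eq_zero_of_isPos_add (ip_self_pos A x.2) (ip_self_pos A x.1)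
      ((add_comm _ _).trans h)
    exact Prod.ext (ip_self_eq_zero A _ h1) (ip_self_eq_zero A _ h2)

/-- The Hilbert module `Aⁿ` with `⟨a, b⟩ = ∑ aᵢ⋆ bᵢ`. -/
instance instFree (n : ℕ) : InnerModule A (Fin n → A) where
  ip x y := ∑ i, star (x i) * y i
  ip_smul_right x y a := by
    simp [Finset.sum_mul, mul_assoc]
  ip_add_left x y z := by
    simp [add_mul, Finset.sum_add_distrib]
  star_ip x y := by simp
  ip_self_pos x := isPos_sum _ _ fun i => ⟨x i, rfl⟩
  ip_self_eq_zero x h := by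
    funext i
    rw [← Finset.add_sum_erase _ _ (Finset.mem_univ i)] at h
    have := eq_zero_of_isPos_add ⟨x i, rfl⟩ (isPos_sum _ _ fun i => ⟨x i, rfl⟩) h
    simpa using this

end Constructions

/-! ## The standard module -/

section Standard

variable (A : Type u) [CStarAlgebra A]

theorem summable_of_pos_le {ι : Type*} {a b c : ι → A} (hb : Summable b)
    (ha : ∀ i, IsPos (a i)) (hc : ∀ i, IsPos (c i)) (h : ∀ i, a i + c i = b i) :
    Summable a := by
  let _ := CStarAlgebra.spectralOrder A
  let _ := CStarAlgebra.spectralOrderedRing A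
  have key : ∀ c : A, IsPos c ↔ 0 ≤ c := fun c =>
    CStarAlgebra.nonneg_iff_eq_star_mul_self.symm
  simp only [key] at *
  rw [summable_iff_vanishing_norm] at *
  intro ε hε
  obtain ⟨s, hs⟩ := hb ε hε
  refine ⟨s, fun t ht => lt_of_le_of_lt ?_ (hs t ht)⟩
  refine CStarAlgebra.norm_le_norm_of_nonneg_of_le (Finset.sum_nonneg fun i _ => ha i) ?_
  refine Finset.sum_le_sum fun i _ => ?_
  rw [← h i]
  exact le_add_of_nonneg_right (hc i)

theorem summable_add_sq {ι : Type*} {a b : ι → A} (ha : Summable fun i => star (a i) * a i)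
    (hb : Summable fun i => star (b i) * b i) :
    Summable fun i => star (a i + b i) * (a i + b i) := by
  refine summable_of_pos_le A (b := fun i => (star (a i) * a i + star (b i) * b i) +
    (star (a i) * a i + star (b i) * b i)) ((ha.add hb).add (ha.add hb))
    (c := fun i => star (a i - b i) * (a i - b i)) (fun i => ⟨_, rfl⟩) (fun i => ⟨_, rfl⟩) ?_
  intro i
  simp only [star_add, star_sub]
  noncomm_ring

theorem summable_cross {ι : Type*} {a b : ι → A} (ha : Summable fun i => star (a i) * a i)
    (hb : Summable fun i => star (b i) * b i) : Summable fun i => star (a i) * b i := by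
  have hbI : Summable fun i => star (Complex.I • b i) * (Complex.I • b i) := by
    refine hb.congr fun i => ?_
    simp [smul_smul]
  have h1 := ((summable_add_sq A ha hb).sub ha).sub hb
  have h2 := (((summable_add_sq A ha hbI).sub ha).sub hbI).const_smul (-Complex.I)
  refine ((h1.add h2).const_smul (1 / 2 : ℂ)).congr fun i => ?_
  simp only [star_add, star_smul, add_mul, mul_add, smul_mul_assoc, mul_smul_comm, smul_smul,
    smul_sub, smul_add]
  simp only [Complex.star_def, Complex.conj_I, mul_neg, neg_mul, Complex.I_mul_I, neg_neg,
    mul_one]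
  module

/-- The standard Hilbert `A`-module: sequences `(aᵢ)` in `A` for which `∑ aᵢ⋆ aᵢ` converges in
norm, i.e. the completion of the finitely supported sequences. -/
def standardSubmodule : Submodule Aᵐᵒᵖ (ℕ → A) where
  carrier := {a | Summable fun i => star (a i) * a i}
  zero_mem' := by simp
  add_mem' ha hb := summable_add_sq A ha hb
  smul_mem' c a ha := by
    have h := (Summable.mul_left (star (unop c)) ha).mul_right (unop c)
    refine h.congr fun i => ?_
    simp [mul_assoc]

/-- The standard Hilbert `A`-module `H_A`. -/
abbrev StdModule : Type u := standardSubmodule A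

/-- `⟨a, b⟩ = ∑ aᵢ⋆ bᵢ`. -/
noncomputable instance instStd : InnerModule A (StdModule A) where
  ip x y := ∑' i, star (x.1 i) * y.1 i
  ip_smul_right x y a := by
    rw [← (summable_cross A x.2 y.2).tsum_mul_right]
    simp [mul_assoc]
  ip_add_left x y z := by
    rw [← (summable_cross A x.2 z.2).tsum_add (summable_cross A y.2 z.2)]
    simp [add_mul]
  star_ip x y := by
    rw [tsum_star]; simp
  ip_self_pos x := isPos_tsum _ fun i => ⟨x.1 i, rfl⟩
  ip_self_eq_zero x h := by
    apply Subtype.ext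
    funext i
    rw [x.2.tsum_eq_add_tsum_ite i] at h
    have := eq_zero_of_isPos_add ⟨x.1 i, rfl⟩ (isPos_tsum _ fun j => ?_) h
    · simpa using this
    · by_cases hj : j = i
      · exact ⟨0, by simp [hj]⟩
      · exact ⟨x.1 j, by simp [hj]⟩

end Standard

/-! ## Adjointable operators -/

section Operators

variable (A : Type u) [CStarAlgebra A]
variable (E : Type v) [AddCommGroup E] [Module Aᵐᵒᵖ E] [InnerModule A E]

/-- `End_A(E)`: the `A`-linear maps that have an adjoint. (On a Hilbert module they are bounded,
by the closed graph theorem.) -/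
def adjointable : Subring (Module.End Aᵐᵒᵖ E) where
  carrier := {T | ∃ T' : Module.End Aᵐᵒᵖ E, ∀ x y : E, ip A (T x) y = ip A x (T' y)}
  mul_mem' := by
    rintro S T ⟨S', hS⟩ ⟨T', hT⟩
    exact ⟨T' * S', fun x y => by simp [hS, hT]⟩
  one_mem' := ⟨1, fun x y => rfl⟩
  add_mem' := by
    rintro S T ⟨S', hS⟩ ⟨T', hT⟩
    exact ⟨S' + T', fun x y => by simp [ip_add_left, ip_add_right, hS, hT]⟩
  zero_mem' := ⟨0, fun x y => by simp [ip_zero_left, ip_zero_right]⟩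
  neg_mem' := by
    rintro S ⟨S', hS⟩
    exact ⟨-S', fun x y => by simp [ip_neg_left, ip_neg_right, hS]⟩

/-- The ring `End_A(E)`. -/
abbrev EndA : Type v := adjointable A E

variable {A E}

/-- The adjoint `T⋆`. -/
noncomputable instance instStarEndA : Star (EndA A E) where
  star T := ⟨T.2.choose, T.1, fun x y => by
    rw [← star_ip A, ← T.2.choose_spec, star_ip]⟩

theorem ip_star_right (T : EndA A E) (x y : E) : ip A x ((star T).1 y) = ip A (T.1 x) y :=
  (T.2.choose_spec x y).symm

variable (A)

/-- The operator `x ↦ v ⟨w, x⟩`. -/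
def rankOne (v w : E) : EndA A E :=
  ⟨{ toFun := fun x => op (ip A w x) • v
     map_add' := fun x y => by rw [ip_add_right, op_add, add_smul]
     map_smul' := fun c x => by
      induction c using MulOpposite.rec' with
      | _ a => rw [ip_smul_right, op_mul, mul_smul, RingHom.id_apply] },
   { toFun := fun x => op (ip A v x) • w
     map_add' := fun x y => by rw [ip_add_right, op_add, add_smul]
     map_smul' := fun c x => by
      induction c using MulOpposite.rec' with
      | _ a => rw [ip_smul_right, op_mul, mul_smul, RingHom.id_apply] },
   fun x y => by
    simp only [LinearMap.coe_mk, AddHom.coe_mk, ip_smul_left, ip_smul_right, star_ip]⟩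

variable {A}

/-- `K_A(E)`: the operator norm closure of the set of finite sums of operators
`x ↦ v ⟨w, x⟩`. These sums form a complex ⋆-algebra, so that this closure is the C⋆-algebra
generated by these operators. -/
def IsCompactOp (T : EndA A E) : Prop :=
  ∀ ε : ℝ, 0 < ε →
    ∃ R ∈ AddSubgroup.closure {R : EndA A E | ∃ v w : E, R = rankOne A v w},
      ∀ x : E, hnorm A (T.1 x - R.1 x) ≤ ε * hnorm A x

/-- `A`-Fredholm operators: those invertible modulo `K_A(E)`. -/
def IsFredholm (f : EndA A E) : Prop :=
  ∃ g : EndA A E, IsCompactOp (f * g - 1) ∧ IsCompactOp (g * f - 1)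

/-- The image of `T` is closed for the norm. -/
def HasClosedRange (T : EndA A E) : Prop :=
  ∀ y : E, (∀ ε : ℝ, 0 < ε → ∃ x : E, hnorm A (y - T.1 x) < ε) → ∃ x : E, T.1 x = y

/-- The image of an operator, as a Hilbert module. -/
def im (T : EndA A E) : Submodule Aᵐᵒᵖ E := LinearMap.range T.1

/-- The kernel of an operator, as a Hilbert module. -/
def ker (T : EndA A E) : Submodule Aᵐᵒᵖ E := LinearMap.ker T.1

/-- The cokernel of an operator, as a Hilbert module: the orthogonal complement of the image
(used for operators with closed image only, for which the image is complemented by it). -/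
def coker (T : EndA A E) : Submodule Aᵐᵒᵖ E where
  carrier := {y | ∀ x : E, ip A (T.1 x) y = 0}
  zero_mem' x := ip_zero_right A _
  add_mem' ha hb x := by rw [ip_add_right, ha, hb, add_zero]
  smul_mem' c a ha x := by
    induction c using MulOpposite.rec' with
    | _ b => rw [ip_smul_right, ha, zero_mul]

end Operators

/-! ## Finitely generated projective modules and `K₀` -/

section KTheory

variable (A : Type u) [CStarAlgebra A]

/-- Isomorphism of Hilbert modules. -/
def Iso (E : Type v) [AddCommGroup E] [Module Aᵐᵒᵖ E] [InnerModule A E]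
    (F : Type w) [AddCommGroup F] [Module Aᵐᵒᵖ F] [InnerModule A F] : Prop :=
  ∃ φ : E ≃ₗ[Aᵐᵒᵖ] F, ∀ x y : E, ip A (φ x) (φ y) = ip A x y

/-- Finitely generated projective Hilbert modules: those isomorphic to the image of a projection
`p = p² = p⋆` in `End_A(Aⁿ)` for some `n`. -/
def IsFGP (E : Type v) [AddCommGroup E] [Module Aᵐᵒᵖ E] [InnerModule A E] : Prop :=
  ∃ (n : ℕ) (p : EndA A (Fin n → A)), IsStarProjection p ∧ Iso A E (im p)

variable {A}
variable {E : Type v} [AddCommGroup E] [Module Aᵐᵒᵖ E] [InnerModule A E]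
variable {F : Type w} [AddCommGroup F] [Module Aᵐᵒᵖ F] [InnerModule A F]

theorem Iso.refl : Iso A E E := ⟨LinearEquiv.refl _ _, fun _ _ => rfl⟩

theorem Iso.symm (h : Iso A E F) : Iso A F E := by
  obtain ⟨φ, hφ⟩ := h
  exact ⟨φ.symm, fun x y => by rw [← hφ]; simp⟩

theorem Iso.trans {G : Type*} [AddCommGroup G] [Module Aᵐᵒᵖ G] [InnerModule A G]
    (h : Iso A E F) (h' : Iso A F G) : Iso A E G := by
  obtain ⟨φ, hφ⟩ := h
  obtain ⟨ψ, hψ⟩ := h'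
  exact ⟨φ.trans ψ, fun x y => by simp [hφ, hψ]⟩

theorem Iso.prod {E' : Type*} [AddCommGroup E'] [Module Aᵐᵒᵖ E'] [InnerModule A E']
    {F' : Type*} [AddCommGroup F'] [Module Aᵐᵒᵖ F'] [InnerModule A F']
    (h : Iso A E E') (h' : Iso A F F') : Iso A (E × F) (E' × F') := by
  obtain ⟨φ, hφ⟩ := h
  obtain ⟨ψ, hψ⟩ := h'
  exact ⟨φ.prodCongr ψ, fun x y => congrArg₂ (· + ·) (hφ x.1 y.1) (hψ x.2 y.2)⟩

theorem Iso.prodComm : Iso A (E × F) (F × E) :=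
  ⟨LinearEquiv.prodComm _ _ _, fun _ _ => add_comm _ _⟩

theorem Iso.prodAssoc {G : Type*} [AddCommGroup G] [Module Aᵐᵒᵖ G] [InnerModule A G] :
    Iso A ((E × F) × G) (E × F × G) :=
  ⟨LinearEquiv.prodAssoc _ _ _ _, fun _ _ => (add_assoc _ _ _).symm⟩

theorem eq_star_of_adjoint (T : EndA A E) (h : ∀ x y : E, ip A (T.1 x) y = ip A x (T.1 y)) :
    star T = T := by
  apply Subtype.ext
  apply LinearMap.ext
  intro y
  exact ext_ip_right A fun x => by rw [ip_star_right, h]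

/-- `E` is finitely generated projective iff it is a retract of some `Aⁿ` by a map and its
adjoint. -/
theorem isFGP_iff : IsFGP A E ↔ ∃ (n : ℕ) (V : E →ₗ[Aᵐᵒᵖ] (Fin n → A))
    (W : (Fin n → A) →ₗ[Aᵐᵒᵖ] E), (∀ x, W (V x) = x) ∧ ∀ x y, ip A (V x) y = ip A x (W y) := by
  constructor
  · rintro ⟨n, p, hp, φ, hφ⟩
    have hpp : ∀ x, p.1 (p.1 x) = p.1 x := fun x =>
      congrArg (fun T : EndA A (Fin n → A) => T.1 x) hp.isIdempotentElem
    have hps : ∀ x y, ip A (p.1 x) y = ip A x (p.1 y) := fun x y => by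
      conv_rhs => rw [← hp.isSelfAdjoint.star_eq]
      exact (ip_star_right p x y).symm
    refine ⟨n, (im p).subtype ∘ₗ φ.toLinearMap,
      φ.symm.toLinearMap ∘ₗ LinearMap.rangeRestrict p.1, fun x => ?_, fun x y => ?_⟩
    · have hx : LinearMap.rangeRestrict p.1 ((φ x : im p) : Fin n → A) = φ x := by
        obtain ⟨z, hz⟩ := (φ x).2
        apply Subtype.ext
        change p.1 _ = _
        rw [← hz, hpp]
      change φ.symm (LinearMap.rangeRestrict p.1 ((φ x : im p) : Fin n → A)) = x
      rw [hx]
      exact φ.symm_apply_apply x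
    · change ip A ((φ x : im p) : Fin n → A) y = ip A x (φ.symm _)
      rw [← hφ, φ.apply_symm_apply]
      change _ = ip A ((φ x : im p) : Fin n → A) (p.1 y)
      obtain ⟨z, hz⟩ := (φ x).2
      rw [← hps, ← hz, hpp]
  · rintro ⟨n, V, W, hWV, hadj⟩
    have hadj' : ∀ x y, ip A (W x) y = ip A x (V y) := fun x y => by
      rw [← star_ip A, ← hadj, star_ip]
    have hp : ∀ x y, ip A ((V ∘ₗ W) x) y = ip A x ((V ∘ₗ W) y) := fun x y => by
      change ip A (V (W x)) y = ip A x (V (W y))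
      rw [hadj, hadj']
    let p : EndA A (Fin n → A) := ⟨V ∘ₗ W, V ∘ₗ W, hp⟩
    have hidem : ∀ x, (V ∘ₗ W) (V x) = V x := fun x => by
      change V (W (V x)) = V x
      rw [hWV]
    refine ⟨n, p, ⟨?_, eq_star_of_adjoint p hp⟩, ?_⟩
    · apply Subtype.ext
      apply LinearMap.ext
      intro x
      exact hidem (W x)
    · refine ⟨LinearEquiv.ofLinearMap (LinearMap.codRestrict (im p) V fun x => ⟨V x, hidem x⟩)
        (W ∘ₗ (im p).subtype) ?_ ?_, fun x y => ?_⟩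
      · apply LinearMap.ext
        rintro ⟨x, z, rfl⟩
        exact Subtype.ext (hidem (W z))
      · apply LinearMap.ext
        intro x
        exact hWV x
      · change ip A (V x) (V y) = ip A x y
        rw [hadj, hWV]

theorem IsFGP.prod (hE : IsFGP A E) (hF : IsFGP A F) : IsFGP A (E × F) := by
  rw [isFGP_iff] at *
  obtain ⟨n, V, W, hWV, hadj⟩ := hE
  obtain ⟨m, V', W', hWV', hadj'⟩ := hF
  let e : ((Fin n ⊕ Fin m) → A) ≃ₗ[Aᵐᵒᵖ] (Fin (n + m) → A) :=
    LinearEquiv.funCongrLeft Aᵐᵒᵖ A finSumFinEquiv.symm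
  let s : ((Fin n ⊕ Fin m) → A) ≃ₗ[Aᵐᵒᵖ] (Fin n → A) × (Fin m → A) :=
    LinearEquiv.sumArrowLequivProdArrow (Fin n) (Fin m) Aᵐᵒᵖ A
  let u := s.symm.trans e
  have hu : ∀ (a : (Fin n → A) × (Fin m → A)) (y : Fin (n + m) → A),
      ip A (u a) y = ip A a (u.symm y) := by
    intro a y
    change ∑ i, star (u a i) * y i =
      ∑ i, star (a.1 i) * y (finSumFinEquiv (Sum.inl i)) +
        ∑ i, star (a.2 i) * y (finSumFinEquiv (Sum.inr i))
    rw [← finSumFinEquiv.sum_comp, Fintype.sum_sum_type]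
    congr 1 <;> refine Finset.sum_congr rfl fun i _ => ?_ <;> congr 2
    · change s.symm a (finSumFinEquiv.symm (finSumFinEquiv (Sum.inl i))) = a.1 i
      rw [Equiv.symm_apply_apply]
      rfl
    · change s.symm a (finSumFinEquiv.symm (finSumFinEquiv (Sum.inr i))) = a.2 i
      rw [Equiv.symm_apply_apply]
      rfl
  refine ⟨n + m, u.toLinearMap ∘ₗ V.prodMap V', W.prodMap W' ∘ₗ u.symm.toLinearMap,
    fun x => ?_, fun x y => ?_⟩
  · change (W.prodMap W') (u.symm (u (V.prodMap V' x))) = x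
    rw [u.symm_apply_apply]
    exact Prod.ext (hWV x.1) (hWV' x.2)
  · change ip A (u (V.prodMap V' x)) y = ip A x ((W.prodMap W') (u.symm y))
    rw [hu]
    exact congrArg₂ (· + ·) (hadj x.1 _) (hadj' x.2 _)

instance instPUnit : InnerModule A PUnit.{v + 1} where
  ip _ _ := 0
  ip_smul_right _ _ _ := by simp
  ip_add_left _ _ _ := by simp
  star_ip _ _ := by simp
  ip_self_pos _ := ⟨0, by simp⟩
  ip_self_eq_zero _ _ := rfl

theorem isFGP_punit : IsFGP A PUnit.{v + 1} := by
  rw [isFGP_iff]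
  exact ⟨0, 0, 0, fun _ => rfl, fun _ y => ip_zero_left A y⟩

theorem Iso.punitProd : Iso A (PUnit.{w + 1} × E) E :=
  ⟨{ toFun := fun x => x.2
     map_add' := fun _ _ => rfl
     map_smul' := fun _ _ => rfl
     invFun := fun x => (PUnit.unit, x)
     left_inv := fun _ => rfl
     right_inv := fun _ => rfl }, fun _ _ => (zero_add _).symm⟩

variable (A)

/-- A finitely generated projective Hilbert `A`-module. -/
structure FGPModule : Type (u + 1) where
  carrier : Type u
  [addCommGroup : AddCommGroup carrier]
  [module : Module Aᵐᵒᵖ carrier]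
  [innerModule : InnerModule A carrier]
  isFGP : IsFGP A carrier

attribute [instance] FGPModule.addCommGroup FGPModule.module FGPModule.innerModule

instance instSetoidFGP : Setoid (FGPModule A) where
  r P Q := Iso A P.carrier Q.carrier
  iseqv := ⟨fun _ => Iso.refl, fun h => h.symm, fun h h' => h.trans h'⟩

/-- Isomorphism classes of finitely generated projective Hilbert `A`-modules. -/
def IsoClass : Type (u + 1) := Quotient (instSetoidFGP A)

/-- Addition of isomorphism classes is induced by the direct sum. -/
instance instAddIsoClass : Add (IsoClass A) where
  add := Quotient.map₂ (fun P Q => ⟨P.carrier × Q.carrier, P.isFGP.prod Q.isFGP⟩)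
    fun _ _ h _ _ h' => Iso.prod h h'

instance instZeroIsoClass : Zero (IsoClass A) where
  zero := Quotient.mk _ ⟨PUnit, isFGP_punit⟩

instance instMonoidIsoClass : AddCommMonoid (IsoClass A) where
  add_assoc a b c := by
    induction a using Quotient.inductionOn
    induction b using Quotient.inductionOn
    induction c using Quotient.inductionOn
    exact Quotient.sound Iso.prodAssoc
  add_comm a b := by
    induction a using Quotient.inductionOn
    induction b using Quotient.inductionOn
    exact Quotient.sound Iso.prodComm
  zero_add a := by
    induction a using Quotient.inductionOn
    exact Quotient.sound Iso.punitProd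
  add_zero a := by
    induction a using Quotient.inductionOn
    exact Quotient.sound (Iso.prodComm.trans Iso.punitProd)
  nsmul := nsmulRec

/-- `K₀(A)`: the Grothendieck group of the monoid of isomorphism classes of finitely generated
projective Hilbert `A`-modules. -/
abbrev K0 : Type (u + 1) := Algebra.GrothendieckAddGroup (IsoClass A)

variable {A}

/-- The class `[P]` in `K₀(A)`. -/
noncomputable def K0.cls {P : Type u} [AddCommGroup P] [Module Aᵐᵒᵖ P] [InnerModule A P]
    (h : IsFGP A P) : K0 A :=
  Algebra.GrothendieckAddGroup.of (Quotient.mk (instSetoidFGP A) ⟨P, h⟩)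

/-! ## The Mishchenko index -/

/-- `k` is an `A`-compact perturbation making the image of `f + k` closed (kernel and cokernel
are always closed). -/
def IsGoodPerturbation (f k : EndA A (StdModule A)) : Prop :=
  IsCompactOp k ∧ HasClosedRange (f + k)

/-- `x = [ker (f + k)] - [coker (f + k)]` for some compact `k` such that `f + k` has closed
image, with finitely generated projective kernel and cokernel. -/
def IsMindex (f : EndA A (StdModule A)) (x : K0 A) : Prop :=
  ∃ k : EndA A (StdModule A), IsGoodPerturbation f k ∧
    ∃ (h₁ : IsFGP A (ker (f + k))) (h₂ : IsFGP A (coker (f + k))), x = K0.cls h₁ - K0.cls h₂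

open Classical in
/-- The Mishchenko index (with value `0` if there is no suitable perturbation; for Fredholm
operators there always is one). -/
noncomputable def Mindex (f : EndA A (StdModule A)) : K0 A :=
  if h : ∃ x, IsMindex f x then h.choose else 0

end KTheory

/-! ## Von Neumann algebras and measurable functional calculus -/

section VonNeumann

variable {H : Type u} [NormedAddCommGroup H] [InnerProductSpace ℂ H] [CompleteSpace H]

instance instIsClosed (M : VonNeumannAlgebra H) :
    IsClosed (M.toStarSubalgebra : Set (H →L[ℂ] H)) := by
  have h : (M.toStarSubalgebra : Set (H →L[ℂ] H)) =
      Set.centralizer (Set.centralizer (M.toStarSubalgebra : Set (H →L[ℂ] H))) :=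
    M.centralizer_centralizer'.symm
  rw [h]
  exact Set.isClosed_centralizer _

/-- The von Neumann algebra `M`, as a C⋆-algebra. -/
abbrev vnAlg (M : VonNeumannAlgebra H) : Type u := M.toStarSubalgebra

variable {M : VonNeumannAlgebra H}

/-- For `x ∈ H_A` and `η ∈ H` the vector `x ⊗ η` of the Hilbert space `H_A ⊗_A H`, on which
`End_A(H_A)` acts faithfully, satisfies `⟨x ⊗ η, T (x ⊗ η)⟩ = ⟨η, ⟨x, T x⟩ η⟩`. This is that
number. -/
noncomputable def matrixCoeff (T : EndA (vnAlg M) (StdModule (vnAlg M)))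
    (x : StdModule (vnAlg M)) (η : H) : ℂ :=
  inner ℂ η ((ip (vnAlg M) x (T.1 x) : H →L[ℂ] H) η)

/-- `μ` is the spectral measure of the self-adjoint operator `T` at the vector `x ⊗ η`: the
finite, compactly supported Borel measure on `ℝ` such that `∫ q dμ = ⟨x ⊗ η, q(T) (x ⊗ η)⟩` for
all polynomials `q`. -/
structure IsSpectralMeasure (T : EndA (vnAlg M) (StdModule (vnAlg M)))
    (x : StdModule (vnAlg M)) (η : H) (μ : Measure ℝ) : Prop where
  isFinite : IsFiniteMeasure μ
  compactSupport : ∃ R : ℝ, μ (Set.Icc (-R) R)ᶜ = 0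
  moments : ∀ n : ℕ, ((∫ t, t ^ n ∂μ : ℝ) : ℂ) = matrixCoeff (T ^ n) x η

/-- `S = g(T)` in the sense of the measurable functional calculus of the self-adjoint operator
`T`: `⟨x ⊗ η, S (x ⊗ η)⟩ = ∫ g dμ` for the spectral measure `μ` of `T` at `x ⊗ η`.
(Here `g` is a bounded Borel function.) -/
def IsMeasurableCalculus (T : EndA (vnAlg M) (StdModule (vnAlg M))) (g : ℝ → ℝ)
    (S : EndA (vnAlg M) (StdModule (vnAlg M))) : Prop :=
  ∀ (x : StdModule (vnAlg M)) (η : H), ∃ μ : Measure ℝ, IsSpectralMeasure T x η μ ∧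
    matrixCoeff S x η = ((∫ t, g t ∂μ : ℝ) : ℂ)

/-- The characteristic function of `{0}`. -/
noncomputable def chiZero : ℝ → ℝ := Set.indicator {0} 1

end VonNeumann

end HilbertIndex

/-! The idea is to leave the module `H_A` for the Hilbert space `H_A ⊗_A H`, which is the space `L2
H` of square summable sequences in `H`, and to do there the linear algebra of Fredholm operators
with orthogonal projections and polar decompositions.

An element `a` of `H_A` becomes the operator `hat a : H → L2 H`, `η ↦ a ⊗ η`. The operators obtained
in this way are exactly those that intertwine the commutant of `M` and whose tails are small
uniformly on the unit ball: the first condition puts the entries into `M` by the double commutant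
theorem, the second is the norm convergence of `∑ aᵢ⋆ aᵢ`. An adjointable `T` becomes an operator
`rep T` on `L2 H` that commutes with the diagonal action of the commutant, and `rep` is a faithful
⋆-representation. Compactness of `T` makes the tails of `rep T` and of its adjoint uniformly small.

The submodules that matter correspond to closed, commutant-invariant subspaces `U` of `L2 H` with
uniformly small tails (`IsFin`). Any operator commuting with the commutant has a polar decomposition
that commutes with it too, so the orthogonal complements of the kernels of `X` and `adjoint X` give
isomorphic modules whenever both are `IsFin` (`Equivariant.iso_fixed_ker`). Applied to the
projection of `U` to sufficiently many coordinates, this embeds the module of `U` into some `Aⁿ`, so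
it is finitely generated projective (`IsFin.isFGP`).

If `G` inverts a Fredholm `F` modulo compacts, then `G F - 1` is `-1` on the kernel of `F`, so this
kernel is `IsFin`; likewise for the adjoint. Hence `[ker F] - [ker F⋆]` makes sense even if the
image of `F` is not closed. Since `F` is bounded below on sequences starting with many zeros, a
rank-nullity argument turns this difference into `[Aⁿ] - [ker (F ∘ tail n)⋆]`
(`IsFredholmOp.cls_sub_cls`). A compact perturbation is small on far tails, so it moves the last
kernel only slightly and does not change its class (`IsFredholmOp.cls_sub_cls_add`). Thus every
closed-image perturbation of `f` has the index already visible in the kernels of `rep f` and its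
adjoint.

Finally `χ_{0}(f⋆f)` is the projection to the kernel of `rep f`: powers of a contraction `1 - c B²`
compute the mass of the spectral measure at `0` on one side and, by the mean ergodic theorem, the
projection to `ker B` on the other (`integral_chiZero_eq`). The smallness of tails brings this
projection back into `End_A(H_A)`. -/

namespace HilbertIndex
universe u v

/-! ### Square summable sequences: coordinates, truncations and tails. -/

section SquareSummable

open ContinuousLinearMap

/-- The Hilbert space of square summable sequences in `H`. -/
def L2 (H : Type u) [NormedAddCommGroup H] : Type u := lp (fun _ : ℕ => H) 2

noncomputable instance {H : Type u} [NormedAddCommGroup H] : NormedAddCommGroup (L2 H) :=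
  inferInstanceAs (NormedAddCommGroup (lp (fun _ : ℕ => H) 2))

/-- The terms of a square summable sequence. -/
def L2.term {H : Type u} [NormedAddCommGroup H] (x : L2 H) (i : ℕ) : H := x.1 i

/-- A square summable sequence as an element of `L2 H`. -/
def L2.mk {H : Type u} [NormedAddCommGroup H] (f : ℕ → H) (hf : Memℓp f 2) : L2 H := ⟨f, hf⟩

theorem L2.norm_term_le {H : Type u} [NormedAddCommGroup H] (i : ℕ) (x : L2 H) : ‖x.term i‖ ≤ ‖x‖ :=
  lp.norm_apply_le_norm (by simp) (x : lp (fun _ : ℕ => H) 2) i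

theorem memℓp_of_sum_le {H : Type u} [NormedAddCommGroup H] {f : ℕ → H} {C : ℝ}
    (h : ∀ s : Finset ℕ, ∑ i ∈ s, ‖f i‖ ^ 2 ≤ C) :
    Memℓp f 2 := by
  refine memℓp_gen' (C := C) fun s => ?_
  simp only [ENNReal.toReal_ofNat, Real.rpow_ofNat]
  exact h s

variable {H : Type u} [NormedAddCommGroup H] [InnerProductSpace ℂ H]

noncomputable instance : InnerProductSpace ℂ (L2 H) :=
  inferInstanceAs (InnerProductSpace ℂ (lp (fun _ : ℕ => H) 2))

instance [CompleteSpace H] : CompleteSpace (L2 H) :=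
  inferInstanceAs (CompleteSpace (lp (fun _ : ℕ => H) 2))

/-- The coordinate maps of `L2 H`. -/
noncomputable def coord (i : ℕ) : L2 H →L[ℂ] H :=
  LinearMap.mkContinuous
    { toFun := fun x => x.term i
      map_add' := fun _ _ => rfl
      map_smul' := fun _ _ => rfl } 1 fun x => by
    rw [one_mul]; exact L2.norm_term_le i x

theorem norm_coord_le (i : ℕ) (x : L2 H) : ‖coord i x‖ ≤ ‖x‖ := L2.norm_term_le i x

theorem coord_mk (f : ℕ → H) (hf : Memℓp f 2) (i : ℕ) : coord i (L2.mk f hf) = f i := rfl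

theorem L2.ext {x y : L2 H} (h : ∀ i, coord i x = coord i y) : x = y :=
  Subtype.ext (funext h)

theorem L2.hasSum_inner (x y : L2 H) :
    HasSum (fun i => inner ℂ (coord i x) (coord i y)) (inner ℂ x y) :=
  lp.hasSum_inner (𝕜 := ℂ) (x : lp (fun _ : ℕ => H) 2) y

theorem L2.sum_norm_sq_le (x : L2 H) (s : Finset ℕ) :
    ∑ i ∈ s, ‖coord i x‖ ^ 2 ≤ ‖x‖ ^ 2 := by
  have h := lp.sum_rpow_le_norm_rpow (p := 2) (by simp) (x : lp (fun _ : ℕ => H) 2) s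
  simp only [ENNReal.toReal_ofNat, Real.rpow_ofNat] at h
  exact h

theorem L2.norm_le_of_sum_le {x : L2 H} {C : ℝ} (hC : 0 ≤ C)
    (h : ∀ s : Finset ℕ, ∑ i ∈ s, ‖coord i x‖ ^ 2 ≤ C ^ 2) : ‖x‖ ≤ C := by
  refine lp.norm_le_of_forall_sum_le (p := 2) (f := (x : lp (fun _ : ℕ => H) 2)) (by simp) hC
    fun s => ?_
  simp only [ENNReal.toReal_ofNat, Real.rpow_ofNat]
  exact h s

/-- The coordinate embeddings into `L2 H`. -/
noncomputable def incl (i : ℕ) : H →L[ℂ] L2 H :=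
  LinearMap.mkContinuous
    { toFun := fun η => (lp.single 2 i η : lp (fun _ : ℕ => H) 2)
      map_add' := fun η ζ => (lp.single_add (E := fun _ : ℕ => H) 2 i η ζ :)
      map_smul' := fun c η => (lp.single_smul (E := fun _ : ℕ => H) 2 i c η :) } 1 fun η => by
    rw [one_mul]
    exact (lp.norm_single (E := fun _ : ℕ => H) (p := 2) (by simp) i η).le

theorem norm_incl (i : ℕ) (η : H) : ‖(incl i η : L2 H)‖ = ‖η‖ :=
  lp.norm_single (E := fun _ : ℕ => H) (p := 2) (by simp) i η

theorem coord_incl (i j : ℕ) (η : H) : coord i (incl j η) = if i = j then η else 0 := by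
  change (lp.single 2 j η : lp (fun _ : ℕ => H) 2) i = _
  by_cases h : i = j
  · subst h; simp
  · rw [if_neg h, lp.single_apply_ne _ _ _ h]

theorem inner_incl_left (i : ℕ) (η : H) (x : L2 H) :
    inner ℂ (incl i η) x = inner ℂ η (coord i x) := by
  exact lp.inner_single_left (G := fun _ : ℕ => H) (𝕜 := ℂ) i η x

theorem inner_incl_right (i : ℕ) (η : H) (x : L2 H) :
    inner ℂ x (incl i η) = inner ℂ (coord i x) η := by
  exact lp.inner_single_right (G := fun _ : ℕ => H) (𝕜 := ℂ) i η x

/-- Restriction of a sequence to a finite set of indices. -/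
noncomputable def cut (s : Finset ℕ) : L2 H →L[ℂ] L2 H := ∑ i ∈ s, incl i ∘L coord i

theorem cut_apply (s : Finset ℕ) (x : L2 H) : cut s x = ∑ i ∈ s, incl i (coord i x) := by
  simp [cut, sum_apply]

theorem coord_cut (s : Finset ℕ) (x : L2 H) (i : ℕ) :
    coord i (cut s x) = if i ∈ s then coord i x else 0 := by
  rw [cut_apply, map_sum]
  simp [coord_incl]

theorem cut_cut (s t : Finset ℕ) (x : L2 H) : cut s (cut t x) = cut (s ∩ t) x := by
  apply L2.ext
  intro i
  by_cases h : i ∈ s <;> by_cases h' : i ∈ t <;> simp [coord_cut, h, h']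

theorem inner_cut (s : Finset ℕ) (x y : L2 H) : inner ℂ (cut s x) y = inner ℂ x (cut s y) := by
  rw [cut_apply, cut_apply, sum_inner, inner_sum]
  simp only [inner_incl_left, inner_incl_right]

theorem norm_cut_sq (s : Finset ℕ) (x : L2 H) : ‖cut s x‖ ^ 2 = ∑ i ∈ s, ‖coord i x‖ ^ 2 := by
  rw [← inner_self_eq_norm_sq (𝕜 := ℂ), inner_cut, cut_cut, Finset.inter_self, cut_apply,
    inner_sum, map_sum]
  refine Finset.sum_congr rfl fun i _ => ?_
  rw [inner_incl_right]
  exact inner_self_eq_norm_sq (𝕜 := ℂ) _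

theorem norm_cut_le (s : Finset ℕ) (x : L2 H) : ‖cut s x‖ ≤ ‖x‖ := by
  refine le_of_sq_le_sq ?_ (norm_nonneg _)
  rw [norm_cut_sq]
  exact x.sum_norm_sq_le s

/-- Deletion of the first `n` terms of a sequence. -/
noncomputable def tail (n : ℕ) : L2 H →L[ℂ] L2 H := .id ℂ _ - cut (Finset.range n)

theorem tail_apply (n : ℕ) (x : L2 H) : tail n x = x - cut (Finset.range n) x := rfl

theorem cut_add_tail (n : ℕ) (x : L2 H) : cut (Finset.range n) x + tail n x = x := by
  rw [tail_apply]; abel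

theorem coord_tail (n : ℕ) (x : L2 H) (i : ℕ) :
    coord i (tail n x) = if i < n then 0 else coord i x := by
  rw [tail_apply, map_sub, coord_cut]
  by_cases h : i < n <;> simp [h]

theorem tail_tail (n m : ℕ) (h : n ≤ m) (x : L2 H) : tail m (tail n x) = tail m x := by
  apply L2.ext
  intro i
  simp only [coord_tail]
  split_ifs <;> first | rfl | omega

theorem tail_tail' (n m : ℕ) (h : n ≤ m) (x : L2 H) : tail n (tail m x) = tail m x := by
  apply L2.ext
  intro i
  simp only [coord_tail]
  split_ifs <;> first | rfl | omega

theorem cut_tail (n : ℕ) (x : L2 H) : cut (Finset.range n) (tail n x) = 0 := by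
  apply L2.ext
  intro i
  simp only [coord_cut, coord_tail, Finset.mem_range, map_zero]
  split_ifs <;> rfl

theorem tail_cut (n : ℕ) (x : L2 H) : tail n (cut (Finset.range n) x) = 0 := by
  apply L2.ext
  intro i
  simp only [coord_cut, coord_tail, Finset.mem_range, map_zero]
  split_ifs <;> rfl

theorem inner_tail (n : ℕ) (x y : L2 H) : inner ℂ (tail n x) y = inner ℂ x (tail n y) := by
  rw [tail_apply, tail_apply, inner_sub_left, inner_sub_right, inner_cut]

theorem norm_tail_le (n : ℕ) (x : L2 H) : ‖tail n x‖ ≤ ‖x‖ := by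
  have h : ‖x‖ * ‖x‖ = ‖cut (Finset.range n) x‖ * ‖cut (Finset.range n) x‖ +
      ‖tail n x‖ * ‖tail n x‖ := by
    conv_lhs => rw [← cut_add_tail n x]
    apply norm_add_sq_eq_norm_sq_add_norm_sq_of_inner_eq_zero (𝕜 := ℂ)
    rw [← inner_tail, tail_cut, inner_zero_left]
  nlinarith [norm_nonneg x, norm_nonneg (tail n x), norm_nonneg (cut (Finset.range n) x)]

theorem norm_tail_mono {n m : ℕ} (h : n ≤ m) (x : L2 H) : ‖tail m x‖ ≤ ‖tail n x‖ := by
  rw [← tail_tail n m h]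
  exact norm_tail_le m _

/-! ### Operators with uniformly small tails. -/

variable {V : Type*} [NormedAddCommGroup V] [NormedSpace ℂ V]
variable {W : Type*} [NormedAddCommGroup W] [NormedSpace ℂ W]

/-- The tails of the values of `X` converge to `0`, uniformly on bounded sets. -/
def TailSmall (X : V →L[ℂ] L2 H) : Prop :=
  ∀ ε : ℝ, 0 < ε → ∃ N, ∀ x, ‖tail N (X x)‖ ≤ ε * ‖x‖

/-- Deleting terms is a contraction, so an `ε / 2` argument shows that the condition survives limits
in operator norm. -/
theorem TailSmall.of_approx {X : V →L[ℂ] L2 H}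
    (h : ∀ ε : ℝ, 0 < ε → ∃ Y : V →L[ℂ] L2 H, TailSmall Y ∧ ∀ x, ‖X x - Y x‖ ≤ ε * ‖x‖) :
    TailSmall X := by
  intro ε hε
  obtain ⟨Y, hY, hXY⟩ := h (ε / 2) (half_pos hε)
  obtain ⟨N, hN⟩ := hY (ε / 2) (half_pos hε)
  refine ⟨N, fun x => ?_⟩
  have : tail N (X x) = tail N (X x - Y x) + tail N (Y x) := by rw [map_sub]; abel
  rw [this]
  have h1 := norm_add_le (tail N (X x - Y x)) (tail N (Y x))
  have h2 := norm_tail_le N (X x - Y x)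
  linarith [hXY x, hN x]

theorem TailSmall.zero : TailSmall (0 : V →L[ℂ] L2 H) := fun ε hε => ⟨0, fun x => by
  simp only [zero_apply, map_zero, norm_zero]; positivity⟩

theorem TailSmall.add {X Y : V →L[ℂ] L2 H} (hX : TailSmall X) (hY : TailSmall Y) :
    TailSmall (X + Y) := by
  intro ε hε
  obtain ⟨N, hN⟩ := hX (ε / 2) (half_pos hε)
  obtain ⟨N', hN'⟩ := hY (ε / 2) (half_pos hε)
  refine ⟨max N N', fun x => ?_⟩
  rw [add_apply, map_add]
  have h1 := norm_add_le (tail (max N N') (X x)) (tail (max N N') (Y x))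
  have h2 := norm_tail_mono (le_max_left N N') (X x)
  have h3 := norm_tail_mono (le_max_right N N') (Y x)
  linarith [hN x, hN' x]

theorem TailSmall.neg {X : V →L[ℂ] L2 H} (hX : TailSmall X) : TailSmall (-X) := by
  intro ε hε
  obtain ⟨N, hN⟩ := hX ε hε
  exact ⟨N, fun x => by simpa using hN x⟩

theorem TailSmall.sum {ι : Type*} (s : Finset ι) (X : ι → V →L[ℂ] L2 H)
    (h : ∀ i ∈ s, TailSmall (X i)) : TailSmall (∑ i ∈ s, X i) :=
  Finset.sum_induction _ _ (fun _ _ => TailSmall.add) TailSmall.zero h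

theorem TailSmall.comp {X : V →L[ℂ] L2 H} (hX : TailSmall X) (Y : W →L[ℂ] V) :
    TailSmall (X ∘L Y) := by
  intro ε hε
  obtain ⟨N, hN⟩ := hX (ε / (‖Y‖ + 1)) (by positivity)
  refine ⟨N, fun x => (hN (Y x)).trans ?_⟩
  rw [div_mul_eq_mul_div, div_le_iff₀ (by positivity), mul_assoc]
  refine mul_le_mul_of_nonneg_left ?_ hε.le
  nlinarith [Y.le_opNorm x, norm_nonneg x]

theorem tailSmall_cut (n : ℕ) (X : V →L[ℂ] L2 H) : TailSmall (cut (Finset.range n) ∘L X) :=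
  fun ε hε => ⟨n, fun x => by
    rw [comp_apply, tail_cut, norm_zero]; positivity⟩

/-- An operator that maps every coordinate subspace to uniformly small tails preserves uniform
smallness of tails. -/
theorem TailSmall.comp_left {Y : V →L[ℂ] L2 H} (hY : TailSmall Y) (X : L2 H →L[ℂ] L2 H)
    (hX : ∀ n, TailSmall (X ∘L cut (Finset.range n))) : TailSmall (X ∘L Y) := by
  apply TailSmall.of_approx
  intro ε hε
  obtain ⟨N, hN⟩ := hY (ε / (‖X‖ + 1)) (by positivity)
  refine ⟨(X ∘L cut (Finset.range N)) ∘L Y, (hX N).comp Y, fun x => ?_⟩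
  have h1 : (X ∘L Y) x - ((X ∘L cut (Finset.range N)) ∘L Y) x = X (tail N (Y x)) := by
    rw [tail_apply, map_sub]; rfl
  rw [h1]
  refine (X.le_opNorm _).trans ?_
  have h2 := hN x
  have h3 : ‖X‖ * ‖tail N (Y x)‖ ≤ (‖X‖ + 1) * (ε / (‖X‖ + 1) * ‖x‖) :=
    mul_le_mul (by linarith) h2 (norm_nonneg _) (by positivity)
  refine h3.trans_eq ?_
  field_simp

/-! ### The diagonal action of operators on `H`. -/

theorem sum_norm_map_sq_le (m : H →L[ℂ] H) (x : L2 H) (s : Finset ℕ) :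
    ∑ i ∈ s, ‖m (coord i x)‖ ^ 2 ≤ (‖m‖ * ‖x‖) ^ 2 := by
  calc ∑ i ∈ s, ‖m (coord i x)‖ ^ 2 ≤ ∑ i ∈ s, ‖m‖ ^ 2 * ‖coord i x‖ ^ 2 := by
        refine Finset.sum_le_sum fun i _ => ?_
        rw [← mul_pow]
        gcongr
        exact m.le_opNorm _
    _ ≤ ‖m‖ ^ 2 * ‖x‖ ^ 2 := by
        rw [← Finset.mul_sum]
        gcongr
        exact x.sum_norm_sq_le s
    _ = _ := (mul_pow _ _ _).symm

/-- The diagonal operator on `L2 H` with the entry `m`. -/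
noncomputable def diag (m : H →L[ℂ] H) : L2 H →L[ℂ] L2 H :=
  LinearMap.mkContinuous
    { toFun := fun x => L2.mk (fun i => m (coord i x)) (memℓp_of_sum_le (sum_norm_map_sq_le m x))
      map_add' := fun x y => L2.ext fun i => by simp only [coord_mk, map_add]
      map_smul' := fun c x => L2.ext fun i => by simp only [coord_mk, map_smul, RingHom.id_apply] }
    ‖m‖ fun x => L2.norm_le_of_sum_le (by positivity) (sum_norm_map_sq_le m x)

theorem coord_diag (m : H →L[ℂ] H) (i : ℕ) (x : L2 H) : coord i (diag m x) = m (coord i x) := rfl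

theorem diag_incl (m : H →L[ℂ] H) (i : ℕ) (η : H) : diag m (incl i η) = incl i (m η) := by
  apply L2.ext
  intro j
  rw [coord_diag, coord_incl, coord_incl]
  split_ifs <;> simp

theorem diag_cut (m : H →L[ℂ] H) (s : Finset ℕ) (x : L2 H) :
    diag m (cut s x) = cut s (diag m x) := by
  apply L2.ext
  intro j
  rw [coord_diag, coord_cut, coord_cut, coord_diag]
  split_ifs <;> simp

theorem diag_tail (m : H →L[ℂ] H) (n : ℕ) (x : L2 H) :
    diag m (tail n x) = tail n (diag m x) := by
  rw [tail_apply, map_sub, diag_cut, tail_apply]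

variable [CompleteSpace H]

theorem inner_diag (m : H →L[ℂ] H) (x y : L2 H) :
    inner ℂ (diag m x) y = inner ℂ x (diag (star m) y) := by
  refine (L2.hasSum_inner _ _).unique ((L2.hasSum_inner _ _).congr_fun fun i => ?_)
  rw [coord_diag, coord_diag, star_eq_adjoint, adjoint_inner_right]

end SquareSummable

/-! ### Elements of the standard module as operators from `H` to `L2 H`. -/

section Hat

open ContinuousLinearMap

variable {H : Type u} [NormedAddCommGroup H] [InnerProductSpace ℂ H] [CompleteSpace H]
variable {M : VonNeumannAlgebra H}

/-- The entries of an element of the standard module, as operators on `H`. -/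
def entry (a : StdModule (vnAlg M)) (i : ℕ) : H →L[ℂ] H := (a.1 i : vnAlg M)

/-- The inner product of the standard module, as an operator on `H`. -/
noncomputable def ipOp (a b : StdModule (vnAlg M)) : H →L[ℂ] H := ip (vnAlg M) a b

theorem hasSum_ipOp (a b : StdModule (vnAlg M)) :
    HasSum (fun i => star (entry a i) * entry b i) (ipOp a b) := by
  have h := (summable_cross (vnAlg M) a.2 b.2).hasSum
  exact h.map M.toStarSubalgebra.subtype continuous_subtype_val

theorem hasSum_inner_entry (a b : StdModule (vnAlg M)) (η ζ : H) :
    HasSum (fun i => inner ℂ (entry a i η) (entry b i ζ)) (inner ℂ η (ipOp a b ζ)) := by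
  have h := ((hasSum_ipOp a b).mapL (ContinuousLinearMap.apply ℂ H ζ)).mapL (innerSL ℂ η)
  refine h.congr_fun fun i => ?_
  change _ = inner ℂ η ((star (entry a i)) (entry b i ζ))
  rw [star_eq_adjoint, adjoint_inner_right]

theorem memℓp_entry (a : StdModule (vnAlg M)) (η : H) : Memℓp (fun i => entry a i η) 2 := by
  apply memℓp_gen
  have h := (Complex.reCLM.hasSum (hasSum_inner_entry a a η η)).summable
  refine h.congr fun i => ?_
  simp only [Complex.reCLM_apply, ENNReal.toReal_ofNat, Real.rpow_ofNat]
  exact inner_self_eq_norm_sq (𝕜 := ℂ) _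

/-- The vector `a ⊗ η` of `H_A ⊗_A H`, which is identified with `L2 H`. -/
noncomputable def hatFun (a : StdModule (vnAlg M)) (η : H) : L2 H :=
  L2.mk (fun i => entry a i η) (memℓp_entry a η)

theorem inner_hatFun (a b : StdModule (vnAlg M)) (η ζ : H) :
    inner ℂ (hatFun a η) (hatFun b ζ) = inner ℂ η (ipOp a b ζ) := by
  exact (L2.hasSum_inner _ _).unique (hasSum_inner_entry a b η ζ)

/-- An element `a` of the standard module as the operator `η ↦ a ⊗ η`. -/
noncomputable def hat (a : StdModule (vnAlg M)) : H →L[ℂ] L2 H :=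
  LinearMap.mkContinuous
    { toFun := hatFun a
      map_add' := fun η ζ => L2.ext fun i => (entry a i).map_add η ζ
      map_smul' := fun c η => L2.ext fun i => (entry a i).map_smul c η }
    (Real.sqrt ‖ipOp a a‖) fun η => by
      refine le_of_sq_le_sq ?_ (by positivity)
      rw [mul_pow, Real.sq_sqrt (norm_nonneg _)]
      change ‖hatFun a η‖ ^ 2 ≤ _
      rw [← inner_self_eq_norm_sq (𝕜 := ℂ), inner_hatFun]
      calc RCLike.re (inner ℂ η (ipOp a a η)) ≤ ‖η‖ * ‖ipOp a a η‖ := re_inner_le_norm _ _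
        _ ≤ ‖η‖ * (‖ipOp a a‖ * ‖η‖) := by gcongr; exact le_opNorm _ _
        _ = _ := by ring

theorem coord_hat (a : StdModule (vnAlg M)) (i : ℕ) (η : H) :
    coord i (hat a η) = entry a i η := rfl

theorem inner_hat (a b : StdModule (vnAlg M)) (η ζ : H) :
    inner ℂ (hat a η) (hat b ζ) = inner ℂ η (ipOp a b ζ) := inner_hatFun a b η ζ

theorem adjoint_hat_comp (a b : StdModule (vnAlg M)) : adjoint (hat a) ∘L hat b = ipOp a b := by
  ext ζ
  refine ext_inner_left ℂ fun η => ?_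
  rw [comp_apply, adjoint_inner_right, inner_hat]

theorem norm_hat (a : StdModule (vnAlg M)) : ‖hat a‖ = hnorm (vnAlg M) a := by
  have h := norm_adjoint_comp_self (hat a)
  rw [adjoint_hat_comp] at h
  rw [hnorm]
  change _ = Real.sqrt ‖ipOp a a‖
  rw [h, Real.sqrt_mul_self (norm_nonneg _)]

theorem hat_injective : Function.Injective (hat : StdModule (vnAlg M) → _) := by
  intro a b h
  apply Subtype.ext
  funext i
  apply Subtype.ext
  ext η
  have := congrArg (fun Y => coord i (Y η)) h
  exact this

theorem hat_add (a b : StdModule (vnAlg M)) : hat (a + b) = hat a + hat b := rfl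

theorem hat_zero : hat (0 : StdModule (vnAlg M)) = 0 := rfl

theorem hat_sub (a b : StdModule (vnAlg M)) : hat (a - b) = hat a - hat b := rfl

theorem hat_smul (a : StdModule (vnAlg M)) (m : vnAlg M) :
    hat (op m • a) = hat a ∘L (m : H →L[ℂ] H) := rfl

theorem hat_smul_algebraMap (a : StdModule (vnAlg M)) (c : ℂ) :
    hat (op (algebraMap ℂ (vnAlg M) c) • a) = c • hat a := by
  rw [hat_smul]
  ext1 η
  change hat a ((algebraMap ℂ (H →L[ℂ] H) c) η) = _
  rw [Algebra.algebraMap_eq_smul_one]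
  simp

theorem hat_sum {ι : Type*} (s : Finset ι) (a : ι → StdModule (vnAlg M)) :
    hat (∑ i ∈ s, a i) = ∑ i ∈ s, hat (a i) :=
  map_sum (⟨⟨hat, hat_zero⟩, hat_add⟩ : StdModule (vnAlg M) →+ (H →L[ℂ] L2 H)) a s

/-! ### Commutation with the commutant, and the characterisation of the operators `hat a`. -/

variable (M) in
/-- `Y` commutes with the commutant of `M`. -/
def Intertwines (Y : H →L[ℂ] L2 H) : Prop := ∀ m ∈ M.commutant, ∀ η, Y (m η) = diag m (Y η)

variable (M) in
/-- `X` commutes with the diagonal action of the commutant of `M`. -/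
def Equivariant (X : L2 H →L[ℂ] L2 H) : Prop :=
  ∀ m ∈ M.commutant, ∀ x, X (diag m x) = diag m (X x)

theorem Equivariant.comp {X Y : L2 H →L[ℂ] L2 H} (hX : Equivariant M X) (hY : Equivariant M Y) :
    Equivariant M (X ∘L Y) := fun m hm x => by
  rw [comp_apply, hY m hm, hX m hm, comp_apply]

theorem Equivariant.intertwines {X : L2 H →L[ℂ] L2 H} {Y : H →L[ℂ] L2 H} (hX : Equivariant M X)
    (hY : Intertwines M Y) : Intertwines M (X ∘L Y) := fun m hm x => by
  rw [comp_apply, hY m hm, hX m hm, comp_apply]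

theorem Equivariant.add {X Y : L2 H →L[ℂ] L2 H} (hX : Equivariant M X) (hY : Equivariant M Y) :
    Equivariant M (X + Y) := fun m hm x => by
  rw [add_apply, hY m hm, hX m hm, add_apply, map_add]

theorem star_mem_commutant {m : H →L[ℂ] H} (hm : m ∈ M.commutant) : star m ∈ M.commutant :=
  star_mem hm

theorem Equivariant.adjointOp {X : L2 H →L[ℂ] L2 H} (hX : Equivariant M X) :
    Equivariant M (adjoint X) := fun m hm x => by
  refine ext_inner_right ℂ fun y => ?_
  rw [adjoint_inner_left, inner_diag, inner_diag, adjoint_inner_left,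
    hX _ (star_mem_commutant hm)]

theorem equivariant_cut (s : Finset ℕ) : Equivariant M (cut s : L2 H →L[ℂ] L2 H) :=
  fun m _ x => (diag_cut m s x).symm

theorem equivariant_tail (n : ℕ) : Equivariant M (tail n : L2 H →L[ℂ] L2 H) :=
  fun m _ x => (diag_tail m n x).symm

theorem intertwines_hat (a : StdModule (vnAlg M)) : Intertwines M (hat a) := by
  intro m hm η
  apply L2.ext
  intro i
  rw [coord_diag, coord_hat, coord_hat]
  have h : entry a i * m = m * entry a i :=
    (VonNeumannAlgebra.mem_commutant_iff.1 hm) _ (a.1 i).2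
  exact congrArg (fun X : H →L[ℂ] H => X η) h

/-- The entries of an intertwiner commute with the commutant, so the double commutant property puts
them into `M`. -/
theorem coord_comp_mem {Y : H →L[ℂ] L2 H} (hY : Intertwines M Y) (i : ℕ) :
    coord i ∘L Y ∈ M.toStarSubalgebra := by
  change coord i ∘L Y ∈ M
  rw [← M.commutant_commutant, VonNeumannAlgebra.mem_commutant_iff]
  intro m hm
  ext η
  change m (coord i (Y η)) = coord i (Y (m η))
  rw [hY m hm, coord_diag]

/-- The squared norm of the tail of `a ⊗ η` is the quadratic form at `η` of the remainder of `∑ aᵢ⋆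
aᵢ`, and this remainder is small in norm. -/
theorem tailSmall_hat (a : StdModule (vnAlg M)) : TailSmall (hat a) := by
  intro ε hε
  have h := (hasSum_ipOp a a).tendsto_sum_nat
  rw [Metric.tendsto_atTop] at h
  obtain ⟨N, hN⟩ := h (ε ^ 2) (by positivity)
  have hN := hN N le_rfl
  rw [dist_eq_norm, norm_sub_rev] at hN
  refine ⟨N, fun η => le_of_sq_le_sq ?_ (by positivity)⟩
  set b := ipOp a a - ∑ i ∈ Finset.range N, star (entry a i) * entry a i with hb
  have key : ‖tail N (hat a η)‖ ^ 2 = RCLike.re (inner ℂ η (b η)) := by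
    have h1 : ‖tail N (hat a η)‖ ^ 2 =
        RCLike.re (inner ℂ (hat a η) (hat a η)) -
          RCLike.re (inner ℂ (hat a η) (cut (Finset.range N) (hat a η))) := by
      rw [← inner_self_eq_norm_sq (𝕜 := ℂ), inner_tail, tail_tail _ _ le_rfl, tail_apply,
        inner_sub_right, map_sub]
    rw [h1, hb, sub_apply, inner_sub_right, map_sub, inner_hat, cut_apply, inner_sum, sum_apply,
      inner_sum]
    congr 2
    refine Finset.sum_congr rfl fun i _ => ?_
    rw [inner_incl_right, coord_hat]
    change _ = inner ℂ η ((star (entry a i)) (entry a i η))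
    rw [star_eq_adjoint, adjoint_inner_right]
  rw [key]
  calc RCLike.re (inner ℂ η (b η)) ≤ ‖η‖ * ‖b η‖ := re_inner_le_norm _ _
    _ ≤ ‖η‖ * (‖b‖ * ‖η‖) := by gcongr; exact le_opNorm _ _
    _ ≤ ‖η‖ * (ε ^ 2 * ‖η‖) := by gcongr
    _ = _ := by ring

/-- The converse of `intertwines_hat` and `tailSmall_hat`. A finite sum of `aᵢ⋆ aᵢ` over `t` equals
`(cut t Y)⋆ (cut t Y)`; when `t` avoids the first indices, `cut t` only sees the tail of `Y`, which
gives the Cauchy criterion. -/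
theorem exists_hat_eq {Y : H →L[ℂ] L2 H} (hY : Intertwines M Y) (hY' : TailSmall Y) :
    ∃ a : StdModule (vnAlg M), hat a = Y := by
  let a : ℕ → vnAlg M := fun i => ⟨coord i ∘L Y, coord_comp_mem hY i⟩
  have ha : a ∈ standardSubmodule (vnAlg M) := by
    change Summable _
    rw [summable_iff_vanishing_norm]
    intro ε hε
    obtain ⟨N, hN⟩ := hY' (Real.sqrt (ε / 2)) (by positivity)
    refine ⟨Finset.range N, fun t ht => ?_⟩
    have h1 : ((∑ i ∈ t, star (a i) * a i : vnAlg M) : H →L[ℂ] H) =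
        ContinuousLinearMap.adjoint (cut t ∘L Y) ∘L (cut t ∘L Y) := by
      rw [AddSubmonoidClass.coe_finsetSum]
      ext ζ
      refine ext_inner_left ℂ fun η => ?_
      rw [comp_apply, adjoint_inner_right, comp_apply, comp_apply, inner_cut, cut_cut,
        Finset.inter_self, cut_apply, inner_sum, sum_apply, inner_sum]
      refine Finset.sum_congr rfl fun i _ => ?_
      rw [inner_incl_right]
      change inner ℂ η ((star (coord i ∘L Y)) (coord i (Y ζ))) = inner ℂ ((coord i ∘L Y) η) _
      rw [star_eq_adjoint, adjoint_inner_right]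
    change ‖((∑ i ∈ t, star (a i) * a i : vnAlg M) : H →L[ℂ] H)‖ < ε
    rw [h1, norm_adjoint_comp_self]
    have h2 : ‖cut t ∘L Y‖ ≤ Real.sqrt (ε / 2) := by
      refine opNorm_le_bound _ (Real.sqrt_nonneg _) fun η => ?_
      have h3 : cut t (Y η) = cut t (tail N (Y η)) := by
        apply L2.ext
        intro i
        simp only [coord_cut, coord_tail]
        split_ifs with h4 h5
        · exact absurd (Finset.mem_range.2 h5) (Finset.disjoint_left.1 ht h4)
        · rfl
        · rfl
      rw [comp_apply, h3]
      exact (norm_cut_le _ _).trans (hN η)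
    calc _ ≤ Real.sqrt (ε / 2) * Real.sqrt (ε / 2) := by gcongr
      _ = ε / 2 := Real.mul_self_sqrt (by positivity)
      _ < ε := half_lt_self hε
  exact ⟨⟨a, ha⟩, by ext η; rfl⟩

-- This is the completeness of `H_A`, in the form used for the closed graph theorem and for closed
-- images. Intertwining and small tails both pass to norm limits.
variable (M) in
theorem isClosed_range_hat : IsClosed (Set.range (hat : StdModule (vnAlg M) → _)) := by
  refine isClosed_of_closure_subset fun Y hY => ?_
  refine exists_hat_eq ?_ ?_
  · intro m hm η
    have hcl : IsClosed {Z : H →L[ℂ] L2 H | Z (m η) = diag m (Z η)} :=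
      isClosed_eq (by fun_prop) (by fun_prop)
    refine (closure_minimal ?_ hcl) hY
    rintro _ ⟨a, rfl⟩
    exact intertwines_hat a m hm η
  · apply TailSmall.of_approx
    intro ε hε
    obtain ⟨_, ⟨a, rfl⟩, ha⟩ :=
      (SeminormedAddCommGroup.mem_closure_iff (E := H →L[ℂ] L2 H)).1 hY ε hε
    refine ⟨hat a, tailSmall_hat a, fun x => ?_⟩
    exact ((Y - hat a).le_opNorm x).trans (by gcongr)

end Hat

theorem star_star_endA {A : Type u} [CStarAlgebra A] {E : Type v} [AddCommGroup E]
    [Module Aᵐᵒᵖ E] [InnerModule A E] (T : EndA A E) : star (star T) = T := by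
  apply Subtype.ext
  apply LinearMap.ext
  intro y
  refine ext_ip_right A fun x => ?_
  rw [ip_star_right, ← star_ip A, ip_star_right, star_ip]

theorem ip_star_left {A : Type u} [CStarAlgebra A] {E : Type v} [AddCommGroup E]
    [Module Aᵐᵒᵖ E] [InnerModule A E] (T : EndA A E) (x y : E) :
    ip A ((star T).1 x) y = ip A x (T.1 y) := by
  rw [← ip_star_right, star_star_endA]

/-! ### The faithful representation of `End_A(H_A)` on `L2 H`. -/

section Representation

open ContinuousLinearMap

variable {H : Type u} [NormedAddCommGroup H] [InnerProductSpace ℂ H] [CompleteSpace H]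
variable {M : VonNeumannAlgebra H}

theorem ipOp_star_left (T : EndA (vnAlg M) (StdModule (vnAlg M))) (x y : StdModule (vnAlg M)) :
    ipOp ((star T).1 x) y = ipOp x (T.1 y) :=
  congrArg Subtype.val (ip_star_left T x y)

theorem ipOp_star_right (T : EndA (vnAlg M) (StdModule (vnAlg M))) (x y : StdModule (vnAlg M)) :
    ipOp x ((star T).1 y) = ipOp (T.1 x) y :=
  congrArg Subtype.val (ip_star_right T x y)

variable (M) in
theorem exists_hat_eq_incl (i : ℕ) : ∃ e : StdModule (vnAlg M), hat e = incl i := by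
  refine exists_hat_eq (fun m _ η => (diag_incl m i η).symm) ?_
  have h : (incl i : H →L[ℂ] L2 H) = cut (Finset.range (i + 1)) ∘L incl i := by
    ext1 η
    apply L2.ext
    intro j
    rw [comp_apply, coord_cut, coord_incl]
    split_ifs with h1 h2 <;> simp_all
  rw [h]
  exact tailSmall_cut _ _

variable (M) in
/-- The standard basis of the standard module. -/
noncomputable def stdBasis (i : ℕ) : StdModule (vnAlg M) := (exists_hat_eq_incl M i).choose

theorem hat_stdBasis (i : ℕ) : hat (stdBasis M i) = incl i := (exists_hat_eq_incl M i).choose_spec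

theorem ipOp_stdBasis (i : ℕ) (a : StdModule (vnAlg M)) : ipOp (stdBasis M i) a = entry a i := by
  ext ζ
  refine ext_inner_left ℂ fun η => ?_
  rw [← inner_hat, hat_stdBasis, inner_incl_left, coord_hat]

/-- The truncation of an element of the standard module. -/
noncomputable def trunc (s : Finset ℕ) (a : StdModule (vnAlg M)) : StdModule (vnAlg M) :=
  ∑ i ∈ s, op (a.1 i) • stdBasis M i

theorem hat_trunc (s : Finset ℕ) (a : StdModule (vnAlg M)) : hat (trunc s a) = cut s ∘L hat a := by
  rw [trunc, hat_sum]
  ext1 η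
  rw [sum_apply, comp_apply, cut_apply]
  refine Finset.sum_congr rfl fun i _ => ?_
  rw [hat_smul, hat_stdBasis]
  rfl

theorem norm_hat_trunc_le (s : Finset ℕ) (a : StdModule (vnAlg M)) :
    ‖hat (trunc s a)‖ ≤ ‖hat a‖ := by
  rw [hat_trunc]
  refine opNorm_le_bound _ (norm_nonneg (hat a)) fun η => ?_
  exact (norm_cut_le _ _).trans ((hat a).le_opNorm η)

/-- `T` is bounded with constant `C`. -/
def BoundedBy (T : EndA (vnAlg M) (StdModule (vnAlg M))) (C : ℝ) : Prop :=
  0 ≤ C ∧ ∀ x, ‖hat (T.1 x)‖ ≤ C * ‖hat x‖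

theorem norm_ipOp_le (a b : StdModule (vnAlg M)) : ‖ipOp a b‖ ≤ ‖hat a‖ * ‖hat b‖ := by
  rw [← adjoint_hat_comp]
  refine (opNorm_comp_le _ _).trans_eq ?_
  rw [LinearIsometryEquiv.norm_map]

theorem norm_hat_mul_self (a : StdModule (vnAlg M)) : ‖hat a‖ * ‖hat a‖ = ‖ipOp a a‖ := by
  rw [← adjoint_hat_comp, norm_adjoint_comp_self]

theorem BoundedBy.star {T : EndA (vnAlg M) (StdModule (vnAlg M))} {C : ℝ} (h : BoundedBy T C) :
    BoundedBy (star T) C := by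
  refine ⟨h.1, fun x => ?_⟩
  have h1 : ‖hat ((Star.star T).1 x)‖ * ‖hat ((Star.star T).1 x)‖ ≤
      ‖hat x‖ * (C * ‖hat ((Star.star T).1 x)‖) := by
    rw [norm_hat_mul_self, ipOp_star_left]
    exact (norm_ipOp_le _ _).trans (by gcongr; exact h.2 _)
  rcases (norm_nonneg (hat ((Star.star T).1 x))).eq_or_lt with h2 | h2
  · rw [← h2]; have := h.1; positivity
  · refine le_of_mul_le_mul_right (h1.trans_eq ?_) h2
    ring

/-- The closed space of operators `hat a`. -/
noncomputable def hatRange (M : VonNeumannAlgebra H) : Submodule ℂ (H →L[ℂ] L2 H) where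
  carrier := Set.range (hat : StdModule (vnAlg M) → _)
  add_mem' := by rintro _ _ ⟨a, rfl⟩ ⟨b, rfl⟩; exact ⟨a + b, rfl⟩
  zero_mem' := ⟨0, rfl⟩
  smul_mem' := by rintro c _ ⟨a, rfl⟩; exact ⟨_, hat_smul_algebraMap a c⟩

theorem exists_bound_of_seq_closed_graph {E : Type*} [NormedAddCommGroup E] [NormedSpace ℂ E]
    [CompleteSpace E] {N : Submodule ℂ E} (hN : IsClosed (N : Set E)) (T : N →ₗ[ℂ] N)
    (h : ∀ (u : ℕ → N) (x y : N), Filter.Tendsto u Filter.atTop (nhds x) →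
      Filter.Tendsto (T ∘ u) Filter.atTop (nhds y) → y = T x) :
    ∃ C, 0 ≤ C ∧ ∀ x, ‖T x‖ ≤ C * ‖x‖ := by
  have := hN.completeSpace_coe
  have hT := LinearMap.continuous_of_seq_closed_graph T h
  obtain ⟨C, hC, h'⟩ := (⟨T, hT⟩ : N →L[ℂ] N).bound
  exact ⟨C, hC.le, h'⟩

/-- Closed graph theorem on the Banach space of operators `hat a`: if `aₙ → a` and `T aₙ → b`, then
`⟨z, b⟩ = lim ⟨z, T aₙ⟩ = lim ⟨T⋆ z, aₙ⟩ = ⟨z, T a⟩` for all `z`. -/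
theorem exists_boundedBy (T : EndA (vnAlg M) (StdModule (vnAlg M))) : ∃ C, BoundedBy T C := by
  let inv : hatRange M → StdModule (vnAlg M) := fun y => y.2.choose
  have hinv : ∀ y : hatRange M, hat (inv y) = y := fun y => y.2.choose_spec
  have inv_eq : ∀ (y : hatRange M) a, hat a = y → inv y = a := fun y a h =>
    hat_injective ((hinv y).trans h.symm)
  let T' : hatRange M →ₗ[ℂ] hatRange M :=
    { toFun := fun y => ⟨hat (T.1 (inv y)), ⟨_, rfl⟩⟩
      map_add' := fun x y => by
        apply Subtype.ext
        change hat (T.1 (inv (x + y))) = hat (T.1 (inv x)) + hat (T.1 (inv y))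
        rw [inv_eq (x + y) (inv x + inv y) (by rw [hat_add, hinv, hinv]; rfl), map_add, hat_add]
      map_smul' := fun c x => by
        apply Subtype.ext
        change hat (T.1 (inv (c • x))) = c • hat (T.1 (inv x))
        rw [inv_eq (c • x) (op (algebraMap ℂ (vnAlg M) c) • inv x)
          (by rw [hat_smul_algebraMap, hinv]; rfl), map_smul, hat_smul_algebraMap] }
  obtain ⟨C, hC, hT⟩ := exists_bound_of_seq_closed_graph (isClosed_range_hat M) T' (by
    intro u x y hu hT
    have hu' : Filter.Tendsto (fun n => (u n : H →L[ℂ] L2 H)) Filter.atTop (nhds x) :=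
      (continuous_subtype_val.tendsto x).comp hu
    have hT' : Filter.Tendsto (fun n => hat (T.1 (inv (u n)))) Filter.atTop
        (nhds (y : H →L[ℂ] L2 H)) := (continuous_subtype_val.tendsto y).comp hT
    have key : ∀ z : StdModule (vnAlg M), adjoint (hat z) ∘L hat (T.1 (inv x)) =
        adjoint (hat z) ∘L (y : H →L[ℂ] L2 H) := by
      intro z
      have h1 : ∀ w : hatRange M, adjoint (hat z) ∘L hat (T.1 (inv w)) =
          adjoint (hat ((star T).1 z)) ∘L (w : H →L[ℂ] L2 H) := fun w => by
        rw [adjoint_hat_comp, ← ipOp_star_left, ← adjoint_hat_comp, hinv]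
      have c1 : Continuous fun Y : H →L[ℂ] L2 H => adjoint (hat ((star T).1 z)) ∘L Y := by
        fun_prop
      have c2 : Continuous fun Y : H →L[ℂ] L2 H => adjoint (hat z) ∘L Y := by fun_prop
      have t1 := (c1.tendsto x).comp hu'
      have t2 := (c2.tendsto y).comp hT'
      rw [h1]
      refine tendsto_nhds_unique t1 (t2.congr fun n => ?_)
      exact h1 (u n)
    apply Subtype.ext
    change (y : H →L[ℂ] L2 H) = hat (T.1 (inv x))
    rw [← hinv y]
    congr 1
    refine ext_ip_right (vnAlg M) fun z => ?_
    have h2 := key z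
    rw [← hinv y, adjoint_hat_comp, adjoint_hat_comp] at h2
    exact Subtype.ext h2.symm)
  refine ⟨C, hC, fun x => ?_⟩
  have h := hT ⟨hat x, ⟨x, rfl⟩⟩
  have e : inv ⟨hat x, ⟨x, rfl⟩⟩ = x := inv_eq _ _ rfl
  change ‖hat (T.1 (inv ⟨hat x, ⟨x, rfl⟩⟩))‖ ≤ C * ‖hat x‖ at h
  rwa [e] at h

/-- If the powers of a self-adjoint element grow at most like the powers of `c`, its norm is at
most `c`. -/
theorem norm_le_of_pow_le {B : Type*} [CStarAlgebra B] {b : B} (hb : IsSelfAdjoint b) {K c : ℝ}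
    (hc : 0 ≤ c) (h : ∀ k, ‖b ^ (2 ^ k)‖ ≤ K * c ^ (2 ^ k)) : ‖b‖ ≤ c := by
  by_contra! hlt
  have hpow : ∀ k : ℕ, ‖b‖ ^ (2 ^ k) ≤ K * c ^ (2 ^ k) := fun k => by
    have h1 := hb.nnnorm_pow_two_pow k
    have h2 : ‖b ^ (2 ^ k)‖ = ‖b‖ ^ (2 ^ k) := by
      have := congrArg NNReal.toReal h1
      simpa using this
    rw [← h2]; exact h k
  rcases hc.eq_or_lt with rfl | hc'
  · have := hpow 0
    simp at this
    rw [this, norm_zero] at hlt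
    exact lt_irrefl _ hlt
  · have hr : 1 < ‖b‖ / c := (one_lt_div hc').2 hlt
    have ht := (tendsto_pow_atTop_atTop_of_one_lt hr).comp
      (tendsto_pow_atTop_atTop_of_one_lt (show 1 < 2 by norm_num))
    obtain ⟨k, hk⟩ := (ht.eventually (Filter.eventually_gt_atTop K)).exists
    have h2 := hpow k
    simp only [Function.comp, div_pow] at hk
    rw [lt_div_iff₀ (by positivity)] at hk
    linarith

/-- The part of `R` on the span of finitely many basis vectors, as an operator on `L2 H`. -/
noncomputable def partialRep (R : EndA (vnAlg M) (StdModule (vnAlg M))) (s : Finset ℕ) :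
    L2 H →L[ℂ] L2 H := ∑ j ∈ s, hat (R.1 (stdBasis M j)) ∘L coord j

theorem partialRep_apply (R : EndA (vnAlg M) (StdModule (vnAlg M))) (s : Finset ℕ) (x : L2 H) :
    partialRep R s x = ∑ j ∈ s, hat (R.1 (stdBasis M j)) (coord j x) := by
  simp [partialRep, sum_apply]

theorem partialRep_hat (R : EndA (vnAlg M) (StdModule (vnAlg M))) (s : Finset ℕ)
    (a : StdModule (vnAlg M)) : partialRep R s ∘L hat a = hat (R.1 (trunc s a)) := by
  rw [trunc, map_sum, hat_sum]
  ext1 η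
  rw [comp_apply, partialRep_apply, sum_apply]
  refine Finset.sum_congr rfl fun i _ => ?_
  rw [map_smul, hat_smul]
  rfl

theorem coord_adjoint_partialRep (R : EndA (vnAlg M) (StdModule (vnAlg M))) (s : Finset ℕ)
    (x : L2 H) (i : ℕ) : coord i (adjoint (partialRep R s) x) =
      if i ∈ s then adjoint (hat (R.1 (stdBasis M i))) x else 0 := by
  refine ext_inner_left ℂ fun η => ?_
  rw [← inner_incl_left, adjoint_inner_right, partialRep_apply]
  simp only [coord_incl]
  split_ifs with h
  · rw [Finset.sum_eq_single i (fun j _ hj => by rw [if_neg hj, map_zero])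
      (fun h' => absurd h h'), if_pos rfl, adjoint_inner_right]
  · rw [Finset.sum_eq_zero fun j hj => by
      rw [if_neg (by rintro rfl; exact h hj), map_zero], inner_zero_left, inner_zero_right]

theorem adjoint_partialRep_hat (R : EndA (vnAlg M) (StdModule (vnAlg M))) (s : Finset ℕ)
    (a : StdModule (vnAlg M)) :
    adjoint (partialRep R s) ∘L hat a = hat (trunc s ((star R).1 a)) := by
  rw [hat_trunc]
  ext1 η
  apply L2.ext
  intro i
  rw [comp_apply, coord_adjoint_partialRep, comp_apply, coord_cut, coord_hat, ← ipOp_stdBasis,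
    ipOp_star_right, ← adjoint_hat_comp]
  rfl

/-- A bound on `R` in the module norm has to become a bound on `L2 H` that does not depend on `s`. A
direct estimate over the basis vectors in `s` costs a factor `s.card`; applying it to high powers of
`b` and using `‖b ^ (2 ^ k)‖ = ‖b‖ ^ (2 ^ k)` removes this factor. -/
theorem norm_partialRep_le {R : EndA (vnAlg M) (StdModule (vnAlg M))} {C : ℝ}
    (hR : BoundedBy R C) (s : Finset ℕ) : ‖partialRep R s‖ ≤ C := by
  set b : L2 H →L[ℂ] L2 H := adjoint (partialRep R s) * partialRep R s with hb
  have hC := hR.1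
  -- On operators `hat a` the action of `b` is `trunc ∘ R⋆ ∘ R ∘ trunc`, where truncation is
  -- contractive and `R`, `R⋆` are bounded by `C`.
  have step : ∀ (k : ℕ) (a : StdModule (vnAlg M)),
      ∃ a' : StdModule (vnAlg M), (b ^ k) ∘L hat a = hat a' ∧ ‖hat a'‖ ≤ (C ^ 2) ^ k * ‖hat a‖ := by
    intro k a
    induction k with
    | zero => exact ⟨a, by ext η; rfl, by simp⟩
    | succ k ih =>
      obtain ⟨a', h1, h2⟩ := ih
      refine ⟨trunc s ((star R).1 (R.1 (trunc s a'))), ?_, ?_⟩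
      · rw [pow_succ', ← adjoint_partialRep_hat, ← partialRep_hat, ← h1]
        rfl
      · refine (norm_hat_trunc_le _ _).trans ((hR.star.2 _).trans ?_)
        calc C * ‖hat (R.1 (trunc s a'))‖ ≤ C * (C * ‖hat (trunc s a')‖) := by
              gcongr; exact hR.2 _
          _ ≤ C * (C * ((C ^ 2) ^ k * ‖hat a‖)) := by
              gcongr; exact (norm_hat_trunc_le _ _).trans h2
          _ = _ := by ring
  have hcut : b ∘L cut s = b := by
    ext1 x
    change adjoint (partialRep R s) (partialRep R s (cut s x)) =
      adjoint (partialRep R s) (partialRep R s x)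
    congr 1
    rw [partialRep_apply, partialRep_apply]
    exact Finset.sum_congr rfl fun j hj => by rw [coord_cut, if_pos hj]
  -- Only positive powers absorb `cut s`, hence the exponent `k + 1`; after that the operator is a
  -- sum of `s.card` terms, one for each basis vector.
  have hpow : ∀ k : ℕ, ‖b ^ (k + 1)‖ ≤ s.card * (C ^ 2) ^ (k + 1) := by
    intro k
    have h1 : b ^ (k + 1) = ∑ j ∈ s, ((b ^ (k + 1)) ∘L incl j) ∘L coord j := by
      have h2 : b ^ (k + 1) = (b ^ (k + 1)) ∘L cut s := by
        conv_lhs => rw [pow_succ]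
        rw [pow_succ]
        change (b ^ k) ∘L b = (b ^ k) ∘L (b ∘L cut s)
        rw [hcut]
      ext1 x
      conv_lhs => rw [h2]
      rw [comp_apply, cut_apply, map_sum, sum_apply]
      rfl
    rw [h1]
    refine (norm_sum_le _ _).trans ?_
    rw [← nsmul_eq_mul]
    refine Finset.sum_le_card_nsmul _ _ _ fun j _ => ?_
    obtain ⟨a', h2, h3⟩ := step (k + 1) (stdBasis M j)
    rw [hat_stdBasis] at h2 h3
    refine opNorm_le_bound _ (by positivity) fun x => ?_
    rw [h2]
    have h4 : ‖(incl j : H →L[ℂ] L2 H)‖ ≤ 1 :=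
      opNorm_le_bound _ zero_le_one fun η => by rw [norm_incl, one_mul]
    calc ‖hat a' (coord j x)‖ ≤ ‖hat a'‖ * ‖coord j x‖ := le_opNorm _ _
      _ ≤ ((C ^ 2) ^ (k + 1) * 1) * ‖x‖ := by
          gcongr
          · exact h3.trans (by gcongr)
          · exact norm_coord_le j x
      _ = _ := by ring
  have hsa : IsSelfAdjoint b := by
    rw [hb, ← star_eq_adjoint]
    exact IsSelfAdjoint.star_mul_self _
  have h5 : ‖b‖ ≤ C ^ 2 := by
    refine norm_le_of_pow_le (K := s.card) hsa (by positivity) fun k => ?_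
    have h := hpow (2 ^ k - 1)
    rwa [Nat.sub_add_cancel Nat.one_le_two_pow] at h
  refine le_of_sq_le_sq ?_ hC
  rw [hb] at h5
  have h6 := norm_adjoint_comp_self (partialRep R s)
  rw [sq, ← h6]
  exact h5

/-- A Bessel inequality for the vectors `R eᵢ`; it makes the sequence that defines `T ⊗ 1` square
summable. -/
theorem sum_norm_adjoint_hat_sq_le {R : EndA (vnAlg M) (StdModule (vnAlg M))} {C : ℝ}
    (hR : BoundedBy R C) (s : Finset ℕ) (x : L2 H) :
    ∑ i ∈ s, ‖adjoint (hat (R.1 (stdBasis M i))) x‖ ^ 2 ≤ (C * ‖x‖) ^ 2 := by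
  have h1 : ∑ i ∈ s, ‖adjoint (hat (R.1 (stdBasis M i))) x‖ ^ 2 =
      ‖cut s (adjoint (partialRep R s) x)‖ ^ 2 := by
    rw [norm_cut_sq]
    exact Finset.sum_congr rfl fun i hi => by rw [coord_adjoint_partialRep, if_pos hi]
  rw [h1]
  gcongr
  refine (norm_cut_le _ _).trans ((le_opNorm _ _).trans ?_)
  rw [LinearIsometryEquiv.norm_map]
  gcongr
  exact norm_partialRep_le hR s

/-- The value at `x` of the operator `T ⊗ 1` on `L2 H`. -/
noncomputable def repFun (T : EndA (vnAlg M) (StdModule (vnAlg M))) (x : L2 H) : L2 H :=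
  -- The coordinates are forced: pairing `T x` with `eᵢ ⊗ η` is pairing `x` with `T⋆ eᵢ ⊗ η`.
  L2.mk (fun i => adjoint (hat ((star T).1 (stdBasis M i))) x)
    (memℓp_of_sum_le fun s =>
      sum_norm_adjoint_hat_sq_le (exists_boundedBy (star T)).choose_spec s x)

theorem coord_repFun (T : EndA (vnAlg M) (StdModule (vnAlg M))) (x : L2 H) (i : ℕ) :
    coord i (repFun T x) = adjoint (hat ((star T).1 (stdBasis M i))) x := rfl

theorem norm_repFun_le {T : EndA (vnAlg M) (StdModule (vnAlg M))} {C : ℝ} (hT : BoundedBy T C)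
    (x : L2 H) : ‖repFun T x‖ ≤ C * ‖x‖ :=
  L2.norm_le_of_sum_le (mul_nonneg hT.1 (norm_nonneg _)) fun s =>
    sum_norm_adjoint_hat_sq_le hT.star s x

/-- The operator `T ⊗ 1` on `H_A ⊗_A H`, which is identified with `L2 H`. -/
noncomputable def rep (T : EndA (vnAlg M) (StdModule (vnAlg M))) : L2 H →L[ℂ] L2 H :=
  LinearMap.mkContinuousOfExistsBound
    { toFun := repFun T
      map_add' := fun x y => L2.ext fun i => by simp only [coord_repFun, map_add]
      map_smul' := fun c x => L2.ext fun i => by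
        simp only [coord_repFun, map_smul, RingHom.id_apply] }
    ((exists_boundedBy T).imp fun _ hC => norm_repFun_le hC)

theorem norm_rep_apply_le {T : EndA (vnAlg M) (StdModule (vnAlg M))} {C : ℝ} (hT : BoundedBy T C)
    (x : L2 H) : ‖rep T x‖ ≤ C * ‖x‖ := norm_repFun_le hT x

theorem rep_hat (T : EndA (vnAlg M) (StdModule (vnAlg M))) (a : StdModule (vnAlg M)) :
    rep T ∘L hat a = hat (T.1 a) := by
  ext1 η
  apply L2.ext
  intro i
  rw [comp_apply]
  change adjoint (hat ((star T).1 (stdBasis M i))) (hat a η) = _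
  rw [coord_hat, ← ipOp_stdBasis, ← ipOp_star_left, ← adjoint_hat_comp]
  rfl

theorem rep_hat_apply (T : EndA (vnAlg M) (StdModule (vnAlg M))) (a : StdModule (vnAlg M))
    (η : H) : rep T (hat a η) = hat (T.1 a) η := by rw [← rep_hat]; rfl

theorem rep_incl (T : EndA (vnAlg M) (StdModule (vnAlg M))) (i : ℕ) (η : H) :
    rep T (incl i η) = hat (T.1 (stdBasis M i)) η := by rw [← rep_hat_apply, hat_stdBasis]

theorem L2.ext_op {X Y : L2 H →L[ℂ] L2 H} (h : ∀ i η, X (incl i η) = Y (incl i η)) : X = Y := by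
  have h1 : ∀ x, adjoint X x = adjoint Y x := fun x => L2.ext fun i => by
    refine ext_inner_left ℂ fun η => ?_
    rw [← inner_incl_left, ← inner_incl_left, adjoint_inner_right, adjoint_inner_right, h]
  exact LinearIsometryEquiv.injective _ (ContinuousLinearMap.ext h1)

theorem rep_mul (S T : EndA (vnAlg M) (StdModule (vnAlg M))) : rep (S * T) = rep S ∘L rep T :=
  L2.ext_op fun i η => by
    rw [comp_apply, rep_incl, rep_incl, rep_hat_apply]; rfl

theorem rep_one : rep (1 : EndA (vnAlg M) (StdModule (vnAlg M))) = .id ℂ _ :=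
  L2.ext_op fun i η => by
    rw [rep_incl]
    change hat (stdBasis M i) η = _
    rw [hat_stdBasis]; rfl

theorem rep_add (S T : EndA (vnAlg M) (StdModule (vnAlg M))) : rep (S + T) = rep S + rep T :=
  L2.ext_op fun i η => by
    rw [add_apply, rep_incl, rep_incl, rep_incl]; rfl

theorem rep_zero : rep (0 : EndA (vnAlg M) (StdModule (vnAlg M))) = 0 :=
  L2.ext_op fun i η => by rw [rep_incl]; rfl

theorem rep_neg (S : EndA (vnAlg M) (StdModule (vnAlg M))) : rep (-S) = -rep S :=
  L2.ext_op fun i η => by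
    rw [neg_apply, rep_incl, rep_incl]; rfl

theorem rep_sub (S T : EndA (vnAlg M) (StdModule (vnAlg M))) : rep (S - T) = rep S - rep T :=
  L2.ext_op fun i η => by
    rw [sub_apply, rep_incl, rep_incl, rep_incl]; rfl

theorem rep_star (T : EndA (vnAlg M) (StdModule (vnAlg M))) : rep (star T) = adjoint (rep T) :=
  L2.ext_op fun i η => by
    apply L2.ext
    intro j
    refine ext_inner_left ℂ fun ζ => ?_
    rw [← inner_incl_left, ← inner_incl_left, adjoint_inner_right, rep_incl, rep_incl,
      ← hat_stdBasis (M := M) j, ← hat_stdBasis (M := M) i, inner_hat, inner_hat, ipOp_star_right]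

theorem rep_injective : Function.Injective
    (rep : EndA (vnAlg M) (StdModule (vnAlg M)) → (L2 H →L[ℂ] L2 H)) := fun S T h => by
  apply Subtype.ext
  apply LinearMap.ext
  intro a
  apply hat_injective
  rw [← rep_hat, ← rep_hat, h]

theorem equivariant_rep (T : EndA (vnAlg M) (StdModule (vnAlg M))) : Equivariant M (rep T) := by
  intro m hm x
  have h : rep T ∘L diag m = diag m ∘L rep T := L2.ext_op fun i η => by
    rw [comp_apply, comp_apply, diag_incl, rep_incl, rep_incl, intertwines_hat _ m hm]
  exact congrArg (fun X : L2 H →L[ℂ] L2 H => X x) h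

/-- On finitely many coordinates `rep T` is a finite sum of operators `hat (T eᵢ)`, so this needs no
compactness. -/
theorem tailSmall_rep_cut (T : EndA (vnAlg M) (StdModule (vnAlg M))) (n : ℕ) :
    TailSmall (rep T ∘L cut (Finset.range n)) := by
  have h : rep T ∘L cut (Finset.range n) =
      ∑ i ∈ Finset.range n, hat (T.1 (stdBasis M i)) ∘L coord i := by
    ext1 x
    rw [comp_apply, cut_apply, map_sum, sum_apply]
    exact Finset.sum_congr rfl fun i _ => rep_incl T i _
  rw [h]
  exact TailSmall.sum _ _ fun i _ => (tailSmall_hat _).comp _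

theorem rep_rankOne (v w : StdModule (vnAlg M)) :
    rep (rankOne (vnAlg M) v w) = hat v ∘L adjoint (hat w) := L2.ext_op fun i η => by
  rw [rep_incl, ← hat_stdBasis (M := M), comp_apply]
  have h := congrArg (fun X : H →L[ℂ] H => X η) (adjoint_hat_comp w (stdBasis M i))
  change adjoint (hat w) (hat (stdBasis M i) η) = _ at h
  rw [h]
  rfl

/-- The operator `x ↦ v ⟨w, x⟩` becomes `hat v ∘ (hat w)⋆`, so its tails and those of its adjoint
are controlled by `v` and `w`. Sums and norm limits keep this property. -/
theorem IsCompactOp.tailSmall {T : EndA (vnAlg M) (StdModule (vnAlg M))} (hT : IsCompactOp T) :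
    TailSmall (rep T) ∧ TailSmall (adjoint (rep T)) := by
  have h : ∀ ε : ℝ, 0 < ε → ∃ R : EndA (vnAlg M) (StdModule (vnAlg M)),
      (TailSmall (rep R) ∧ TailSmall (adjoint (rep R))) ∧ BoundedBy (T - R) ε := by
    intro ε hε
    obtain ⟨R, hR, hTR⟩ := hT ε hε
    refine ⟨R, ?_, hε.le, fun x => by rw [norm_hat, norm_hat]; exact hTR x⟩
    clear hTR
    induction hR using AddSubgroup.closure_induction with
    | mem R h =>
      obtain ⟨v, w, rfl⟩ := h
      rw [rep_rankOne, adjoint_comp, adjoint_adjoint]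
      exact ⟨(tailSmall_hat v).comp _, (tailSmall_hat w).comp _⟩
    | zero => rw [rep_zero, map_zero]; exact ⟨TailSmall.zero, TailSmall.zero⟩
    | add R S _ _ h1 h2 =>
      rw [rep_add, map_add]
      exact ⟨h1.1.add h2.1, h1.2.add h2.2⟩
    | neg R _ h1 => rw [rep_neg, map_neg]; exact ⟨h1.1.neg, h1.2.neg⟩
  constructor
  · refine TailSmall.of_approx fun ε hε => ?_
    obtain ⟨R, hR, hb⟩ := h ε hε
    refine ⟨rep R, hR.1, fun x => ?_⟩
    rw [← sub_apply, ← rep_sub]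
    exact norm_rep_apply_le hb x
  · refine TailSmall.of_approx fun ε hε => ?_
    obtain ⟨R, hR, hb⟩ := h ε hε
    refine ⟨adjoint (rep R), hR.2, fun x => ?_⟩
    rw [← sub_apply, ← map_sub, ← rep_sub, ← rep_star]
    exact norm_rep_apply_le hb.star x

/-- An equivariant operator with an adjointable action on the operators `hat a` comes from an
adjointable operator on the standard module. -/
theorem exists_rep_eq {X : L2 H →L[ℂ] L2 H}
    (h : ∀ a : StdModule (vnAlg M), ∃ b : StdModule (vnAlg M), X ∘L hat a = hat b)
    (h' : ∀ a : StdModule (vnAlg M), ∃ b : StdModule (vnAlg M), adjoint X ∘L hat a = hat b) :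
    ∃ T : EndA (vnAlg M) (StdModule (vnAlg M)), rep T = X := by
  have aux : ∀ Y : L2 H →L[ℂ] L2 H,
      (∀ a : StdModule (vnAlg M), ∃ b : StdModule (vnAlg M), Y ∘L hat a = hat b) →
      ∃ T : Module.End (vnAlg M)ᵐᵒᵖ (StdModule (vnAlg M)), ∀ a, Y ∘L hat a = hat (T a) := by
    intro Y hY
    choose g hg using hY
    refine ⟨{ toFun := g, map_add' := fun a b => hat_injective ?_,
              map_smul' := fun c a => hat_injective ?_ }, hg⟩
    · rw [← hg, hat_add, hat_add, ← hg, ← hg, comp_add]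
    · induction c using MulOpposite.rec' with
      | _ m => rw [← hg, hat_smul, RingHom.id_apply, hat_smul, ← hg]; rfl
  obtain ⟨T, hT⟩ := aux X h
  obtain ⟨T', hT'⟩ := aux (adjoint X) h'
  refine ⟨⟨T, T', fun x y => Subtype.ext ?_⟩, L2.ext_op fun i η => ?_⟩
  · change ipOp (T x) y = ipOp x (T' y)
    rw [← adjoint_hat_comp, ← adjoint_hat_comp, ← hT, ← hT', adjoint_comp]
    rfl
  · rw [rep_incl]
    change hat (T (stdBasis M i)) η = _
    rw [← hT, hat_stdBasis]
    rfl

end Representation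

/-! ### Subspaces with small tails, polar decomposition, and finitely generated projective modules.
-/

section Polar

open ContinuousLinearMap

variable {H : Type u} [NormedAddCommGroup H] [InnerProductSpace ℂ H] [CompleteSpace H]
variable {M : VonNeumannAlgebra H}

variable (M) in
/-- Closed submodules of `L2 H` that are invariant under the commutant and whose elements have
uniformly small tails: these correspond to finitely generated projective submodules of the
standard module. -/
structure IsFin (U : Submodule ℂ (L2 H)) : Prop where
  isClosed : IsClosed (U : Set (L2 H))
  invariant : ∀ m ∈ M.commutant, ∀ x ∈ U, diag m x ∈ U
  small : ∀ ε : ℝ, 0 < ε → ∃ N, ∀ x ∈ U, ‖tail N x‖ ≤ ε * ‖x‖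

theorem IsFin.mono {U W : Submodule ℂ (L2 H)} (hW : IsFin M W) (h : U ≤ W)
    (hc : IsClosed (U : Set (L2 H))) (hi : ∀ m ∈ M.commutant, ∀ x ∈ U, diag m x ∈ U) :
    IsFin M U :=
  ⟨hc, hi, fun ε hε => (hW.small ε hε).imp fun _ hN x hx => hN x (h hx)⟩

theorem Equivariant.ker_invariant {X : L2 H →L[ℂ] L2 H} (hX : Equivariant M X) :
    ∀ m ∈ M.commutant, ∀ x ∈ X.ker, diag m x ∈ X.ker := fun m hm x hx => by
  change X (diag m x) = 0
  have : X x = 0 := hx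
  rw [hX m hm, this, map_zero]

theorem orthogonal_invariant {U : Submodule ℂ (L2 H)}
    (hU : ∀ m ∈ M.commutant, ∀ x ∈ U, diag m x ∈ U) :
    ∀ m ∈ M.commutant, ∀ x ∈ Uᗮ, diag m x ∈ Uᗮ := fun m hm x hx => by
  rw [Submodule.mem_orthogonal] at hx ⊢
  intro u hu
  have h := inner_diag (star m) u x
  rw [star_star] at h
  rw [← h]
  exact hx _ (hU _ (star_mem_commutant hm) u hu)

theorem equivariant_starProjection {U : Submodule ℂ (L2 H)} [U.HasOrthogonalProjection]
    (hU : ∀ m ∈ M.commutant, ∀ x ∈ U, diag m x ∈ U) : Equivariant M U.starProjection := by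
  intro m hm x
  refine Submodule.eq_starProjection_of_mem_orthogonal
    (hU m hm _ (U.starProjection_apply_mem x)) ?_ |>.symm ▸ rfl
  rw [← map_sub]
  exact orthogonal_invariant hU m hm _ (U.sub_starProjection_mem_orthogonal x)

variable (M) in
/-- The submodule of the standard module formed by the elements `a` with `a ⊗ η ∈ U` for all
`η`. -/
def fixed (U : Submodule ℂ (L2 H)) : Submodule (vnAlg M)ᵐᵒᵖ (StdModule (vnAlg M)) where
  carrier := {a | ∀ η, hat a η ∈ U}
  zero_mem' := fun η => by rw [hat_zero]; exact U.zero_mem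
  add_mem' := fun {a b} ha hb η => by
    rw [hat_add]; exact U.add_mem (ha η) (hb η)
  smul_mem' := fun c a ha η => by
    induction c using MulOpposite.rec' with
    | _ m => rw [hat_smul]; exact ha _

theorem IsFin.exists_fixed {U : Submodule ℂ (L2 H)} (hU : IsFin M U) {Y : H →L[ℂ] L2 H}
    (hY : Intertwines M Y) (hYU : ∀ η, Y η ∈ U) : ∃ a : fixed M U, hat a.1 = Y := by
  have hsmall : TailSmall Y := by
    intro ε hε
    obtain ⟨N, hN⟩ := hU.small (ε / (‖Y‖ + 1)) (by positivity)
    refine ⟨N, fun η => (hN _ (hYU η)).trans ?_⟩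
    rw [div_mul_eq_mul_div, div_le_iff₀ (by positivity), mul_assoc]
    refine mul_le_mul_of_nonneg_left ?_ hε.le
    nlinarith [Y.le_opNorm η, norm_nonneg η]
  obtain ⟨a, rfl⟩ := exists_hat_eq hY hsmall
  exact ⟨⟨a, hYU⟩, rfl⟩

/-- The operator `v` need not come from `End_A(H_A)`: small tails of the target already force `v ∘
hat a` to be of the form `hat b`. In particular the partial isometry of a polar decomposition may be
used. -/
theorem IsFin.exists_map {U W : Submodule ℂ (L2 H)} (hW : IsFin M W) {v : L2 H →L[ℂ] L2 H}
    (hv : Equivariant M v) (hUW : ∀ x ∈ U, v x ∈ W) :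
    ∃ φ : fixed M U →ₗ[(vnAlg M)ᵐᵒᵖ] fixed M W, ∀ a, hat (φ a).1 = v ∘L hat a.1 := by
  have h : ∀ a : fixed M U, ∃ b : fixed M W, hat b.1 = v ∘L hat a.1 := fun a =>
    hW.exists_fixed (hv.intertwines (intertwines_hat _)) fun η => hUW _ (a.2 η)
  choose g hg using h
  refine ⟨{ toFun := g, map_add' := fun a b => ?_, map_smul' := fun c a => ?_ }, hg⟩
  · apply Subtype.ext
    apply hat_injective
    change hat (g (a + b)).1 = hat ((g a).1 + (g b).1)
    rw [hat_add, hg, hg, hg, ← comp_add]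
    rfl
  · apply Subtype.ext
    apply hat_injective
    induction c using MulOpposite.rec' with
    | _ m =>
      change hat (g (op m • a)).1 = hat (op m • (g a).1)
      rw [hat_smul, hg, hg]
      rfl

theorem ipOp_eq_of_inner {a b c d : StdModule (vnAlg M)}
    (h : ∀ η ζ, inner ℂ (hat a η) (hat b ζ) = inner ℂ (hat c η) (hat d ζ)) :
    ip (vnAlg M) a b = ip (vnAlg M) c d := by
  apply Subtype.ext
  change ipOp a b = ipOp c d
  ext ζ
  refine ext_inner_left ℂ fun η => ?_
  rw [← inner_hat, ← inner_hat, h]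

theorem iso_fixed {U W : Submodule ℂ (L2 H)} (hU : IsFin M U) (hW : IsFin M W)
    {v : L2 H →L[ℂ] L2 H} (hv : Equivariant M v) (hUW : ∀ x ∈ U, v x ∈ W)
    (hWU : ∀ y ∈ W, adjoint v y ∈ U) (h1 : ∀ x ∈ U, adjoint v (v x) = x)
    (h2 : ∀ y ∈ W, v (adjoint v y) = y) : Iso (vnAlg M) (fixed M U) (fixed M W) := by
  obtain ⟨φ, hφ⟩ := hW.exists_map hv hUW
  obtain ⟨ψ, hψ⟩ := hU.exists_map hv.adjointOp hWU
  refine ⟨LinearEquiv.ofLinearMap φ ψ ?_ ?_, fun x y => ?_⟩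
  · apply LinearMap.ext
    intro a
    apply Subtype.ext
    apply hat_injective
    rw [LinearMap.comp_apply, hφ, hψ]
    ext1 η
    exact h2 _ (a.2 η)
  · apply LinearMap.ext
    intro a
    apply Subtype.ext
    apply hat_injective
    rw [LinearMap.comp_apply, hψ, hφ]
    ext1 η
    exact h1 _ (a.2 η)
  · change ip (vnAlg M) (φ x).1 (φ y).1 = ip (vnAlg M) x.1 y.1
    refine ipOp_eq_of_inner fun η ζ => ?_
    rw [hφ, hφ, comp_apply, comp_apply, ← adjoint_inner_left, h1 _ (x.2 η)]

theorem orthogonal_ker_adjoint (X : L2 H →L[ℂ] L2 H) :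
    (adjoint X).kerᗮ = X.range.topologicalClosure := by
  rw [← ContinuousLinearMap.orthogonal_range, Submodule.orthogonal_orthogonal_eq_closure]

theorem orthogonal_ker (X : L2 H →L[ℂ] L2 H) :
    X.kerᗮ = (adjoint X).range.topologicalClosure := by
  rw [← orthogonal_ker_adjoint, adjoint_adjoint]

theorem topologicalClosure_range_induction {G : Type*} [NormedAddCommGroup G]
    [InnerProductSpace ℂ G] {X : G →L[ℂ] G} {P : G → Prop} (hP : IsClosed {x | P x})
    (h : ∀ z, P (X z)) {x : G} (hx : x ∈ X.range.topologicalClosure) : P x :=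
  closure_minimal (s := (X.range : Set G)) (by rintro _ ⟨z, rfl⟩; exact h z) hP hx

/-- The polar decomposition of an operator that commutes with the commutant of `M`. -/
theorem Equivariant.exists_polar {X : L2 H →L[ℂ] L2 H} (hX : Equivariant M X) :
    ∃ v : L2 H →L[ℂ] L2 H, Equivariant M v ∧ (∀ x ∈ X.kerᗮ, v x ∈ (adjoint X).kerᗮ) ∧
      (∀ y ∈ (adjoint X).kerᗮ, adjoint v y ∈ X.kerᗮ) ∧ (∀ x ∈ X.kerᗮ, adjoint v (v x) = x) ∧
      ∀ y ∈ (adjoint X).kerᗮ, v (adjoint v y) = y := by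
  set S : L2 H →L[ℂ] L2 H := CFC.abs X with hS
  have hSS : ∀ x, S (S x) = adjoint X (X x) := fun x =>
    congrArg (fun Y : L2 H →L[ℂ] L2 H => Y x) (CFC.abs_mul_abs X)
  have hSa : adjoint S = S := (CFC.abs_nonneg X).isSelfAdjoint.star_eq
  have hin : ∀ x y, inner ℂ (S x) (S y) = inner ℂ (X x) (X y) := fun x y => by
    rw [← adjoint_inner_right, hSa, hSS, adjoint_inner_right]
  have hnorm : ∀ x, ‖X x‖ = ‖S x‖ := fun x => by
    rw [@norm_eq_sqrt_re_inner ℂ, @norm_eq_sqrt_re_inner ℂ, hin]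
  have hSeq : Equivariant M S := by
    intro m hm x
    have hdiag : star (diag m) = diag (star m) := by
      rw [star_eq_adjoint]
      ext1 y
      refine ext_inner_left ℂ fun z => ?_
      rw [adjoint_inner_right, inner_diag]
    -- The commutant is closed under `star`, so `diag m` commutes with `X` and `X⋆`, hence with
    -- `|X|`.
    have c : ∀ m ∈ M.commutant, Commute (diag m) X := fun m hm => by
      ext1 y; exact (hX m hm y).symm
    have c1 : Commute X (star (diag m)) := hdiag ▸ (c _ (star_mem_commutant hm)).symm
    have c2 : Commute (diag m) (CFC.abs X) := (c m hm).symm.cfcAbs_right c1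
    exact congrArg (fun Y : L2 H →L[ℂ] L2 H => Y x) c2.eq.symm
  have hkS : ∀ x, X x = 0 ↔ S x = 0 := fun x => by
    rw [← norm_eq_zero, hnorm, norm_eq_zero]
  have hker : X.ker = S.ker := by
    ext x; exact hkS x
  have hU : X.kerᗮ = S.range.topologicalClosure := by
    rw [hker, orthogonal_ker, hSa]
  set U := S.range.topologicalClosure with hUdef
  have hUc : IsClosed (U : Set (L2 H)) := Submodule.isClosed_topologicalClosure _
  have : CompleteSpace U := hUc.completeSpace_coe
  let e : L2 H →ₗ[ℂ] U := LinearMap.codRestrict U S.toLinearMap fun x =>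
    Submodule.le_topologicalClosure _ ⟨x, rfl⟩
  have hdense : DenseRange e := by
    intro y
    rw [closure_subtype]
    have h : (Subtype.val '' Set.range e) = (S.range : Set (L2 H)) := by
      ext z
      constructor
      · rintro ⟨_, ⟨w, rfl⟩, rfl⟩; exact ⟨w, rfl⟩
      · rintro ⟨w, rfl⟩; exact ⟨e w, ⟨w, rfl⟩, rfl⟩
    rw [h]
    exact y.2
  -- The isometry `|X| x ↦ X x`, extended by continuity to the closure of the range of `|X|`; `v` is
  -- its extension by `0`.
  let V : U →L[ℂ] L2 H := X.toLinearMap.extendOfNorm e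
  have hV : ∀ x, V (e x) = X x := fun x => LinearMap.extendOfNorm_eq hdense
    ⟨1, fun x => by rw [one_mul]; exact (hnorm x).le⟩ x
  let v : L2 H →L[ℂ] L2 H := V ∘L U.orthogonalProjectionOnto
  have hvS : ∀ x, v (S x) = X x := fun x => by
    rw [← hV]
    change V (U.orthogonalProjectionOnto (e x : L2 H)) = _
    rw [Submodule.orthogonalProjectionOnto_mem_subspace_eq_self]
  have hUperp : Uᗮ = X.ker := by
    rw [← hU]
    exact Submodule.orthogonal_orthogonal_eq_closure _ |>.trans
      (IsClosed.submodule_topologicalClosure_eq X.isClosed_ker)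
  have hv0 : ∀ x ∈ Uᗮ, v x = 0 := fun x hx => by
    change V (U.orthogonalProjectionOnto x) = 0
    rw [Submodule.orthogonalProjectionOnto_eq_zero_iff.2 hx, map_zero]
  have hsplit : ∀ x, ∃ y ∈ U, ∃ z ∈ Uᗮ, x = y + z := fun x =>
    ⟨_, U.starProjection_apply_mem x, _, U.sub_starProjection_mem_orthogonal x, by abel⟩
  have hvX : ∀ z, adjoint v (X z) = S z := fun z => by
    refine ext_inner_right ℂ fun y => ?_
    rw [adjoint_inner_left]
    obtain ⟨y, hy, k, hk, rfl⟩ := hsplit y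
    have h1 : inner ℂ (X z) (v y) = inner ℂ (S z) y := by
      refine topologicalClosure_range_induction (P := fun y => inner ℂ (X z) (v y) =
        inner ℂ (S z) y) (isClosed_eq (by fun_prop) (by fun_prop)) (fun w => ?_) hy
      rw [hvS, hin]
    have h2 : inner ℂ (S z) k = 0 :=
      (Submodule.mem_orthogonal _ _).1 hk _ (Submodule.le_topologicalClosure _ ⟨z, rfl⟩)
    rw [map_add, hv0 k hk, add_zero, h1, inner_add_right, h2, add_zero]
  have hvv : ∀ x ∈ U, adjoint v (v x) = x := fun x hx =>
    topologicalClosure_range_induction (P := fun x => adjoint v (v x) = x)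
      (isClosed_eq (by fun_prop) (by fun_prop)) (fun w => by rw [hvS, hvX]) hx
  refine ⟨v, ?_, ?_, ?_, ?_, ?_⟩
  · intro m hm x
    obtain ⟨y, hy, k, hk, rfl⟩ := hsplit x
    have h1 : v (diag m y) = diag m (v y) :=
      topologicalClosure_range_induction (P := fun y => v (diag m y) = diag m (v y))
        (isClosed_eq (by fun_prop) (by fun_prop))
        (fun w => by rw [← hSeq m hm, hvS, hvS, hX m hm]) hy
    have h2 : diag m k ∈ Uᗮ := by
      rw [hUperp] at hk ⊢
      exact hX.ker_invariant m hm k hk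
    rw [map_add, map_add, map_add, map_add, h1, hv0 k hk, hv0 _ h2, map_zero]
  · rw [hU]
    intro x hx
    refine topologicalClosure_range_induction (P := fun x => v x ∈ (adjoint X).kerᗮ)
      ((Submodule.isClosed_orthogonal _).preimage v.continuous) (fun z => ?_) hx
    rw [hvS, orthogonal_ker_adjoint]
    exact Submodule.le_topologicalClosure _ ⟨z, rfl⟩
  · intro y _
    rw [Submodule.mem_orthogonal]
    intro k hk
    rw [adjoint_inner_right, hv0 k (hUperp ▸ hk), inner_zero_left]
  · rw [hU]; exact hvv
  · rw [orthogonal_ker_adjoint]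
    intro y hy
    refine topologicalClosure_range_induction (P := fun y => v (adjoint v y) = y)
      (isClosed_eq (by fun_prop) (by fun_prop)) (fun z => ?_) hy
    rw [hvX, hvS]

/-- Murray–von Neumann equivalence of the initial and final supports of `X`. Apart from additivity,
all identities in `K₀` below come from choosing a suitable `X` here. -/
theorem Equivariant.iso_fixed_ker {X : L2 H →L[ℂ] L2 H} (hX : Equivariant M X)
    (h : IsFin M X.kerᗮ) (h' : IsFin M (adjoint X).kerᗮ) :
    Iso (vnAlg M) (fixed M X.kerᗮ) (fixed M (adjoint X).kerᗮ) := by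
  obtain ⟨v, hv, h1, h2, h3, h4⟩ := hX.exists_polar
  exact iso_fixed h h' hv h1 h2 h3 h4

theorem isFin_range_cut (n : ℕ) : IsFin M (tail n : L2 H →L[ℂ] L2 H).ker := by
  refine ⟨ContinuousLinearMap.isClosed_ker _, (equivariant_tail n).ker_invariant, 
    fun ε hε => ⟨n, fun x hx => ?_⟩⟩
  have : tail n x = 0 := hx
  rw [this, norm_zero]
  positivity

/-- The first `n` entries embed the module into `Aⁿ` isometrically, and the adjoint of this
embedding is the projection to `U` restricted to sequences of length `n`. -/
theorem isFGP_fixed_of_le_ker_tail {U : Submodule ℂ (L2 H)} (hU : IsFin M U) {n : ℕ}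
    (h : U ≤ (tail n : L2 H →L[ℂ] L2 H).ker) : IsFGP (vnAlg M) (fixed M U) := by
  have : CompleteSpace U := hU.isClosed.completeSpace_coe
  rw [isFGP_iff]
  let V : fixed M U →ₗ[(vnAlg M)ᵐᵒᵖ] (Fin n → vnAlg M) :=
    { toFun := fun a i => a.1.1 i
      map_add' := fun a b => rfl
      map_smul' := fun c a => rfl }
  let J : (Fin n → vnAlg M) →ₗ[(vnAlg M)ᵐᵒᵖ] StdModule (vnAlg M) :=
    { toFun := fun b => ∑ i : Fin n, op (b i) • stdBasis M i
      map_add' := fun a b => by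
        simp only [Pi.add_apply, op_add, add_smul, Finset.sum_add_distrib]
      map_smul' := fun c a => by
        induction c using MulOpposite.rec' with
        | _ m =>
          rw [RingHom.id_apply, Finset.smul_sum]
          refine Finset.sum_congr rfl fun i _ => ?_
          rw [Pi.smul_apply, op_smul_eq_mul, op_mul, mul_smul] }
  have hJV : ∀ a : fixed M U, J (V a) = a.1 := by
    intro a
    have h1 : J (V a) = trunc (Finset.range n) a.1 := by
      rw [trunc, ← Fin.sum_univ_eq_sum_range (fun i => op (a.1.1 i) • stdBasis M i)]
      rfl
    rw [h1]
    apply hat_injective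
    rw [hat_trunc]
    ext1 η
    have h2 : tail n (hat a.1 η) = 0 := h (a.2 η)
    rw [comp_apply]
    conv_rhs => rw [← cut_add_tail n (hat a.1 η), h2, add_zero]
  have htop : ∀ b : StdModule (vnAlg M), b ∈ fixed M (⊤ : Submodule ℂ (L2 H)) :=
    fun b η => Submodule.mem_top
  -- With source `⊤` this is the projection to `U` as a module map from all of `H_A`.
  obtain ⟨φ, hφ⟩ := hU.exists_map (U := ⊤) (equivariant_starProjection hU.invariant)
    fun x _ => U.starProjection_apply_mem x
  have hφa : ∀ a : fixed M U, φ ⟨a.1, htop a.1⟩ = a := fun a => by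
    apply Subtype.ext
    apply hat_injective
    rw [hφ]
    ext1 η
    exact Submodule.starProjection_eq_self_iff.2 (a.2 η)
  have hφip : ∀ (a : fixed M U) b, ip (vnAlg M) a.1 (φ b).1 = ip (vnAlg M) a.1 b.1 := fun a b => by
    refine ipOp_eq_of_inner fun η ζ => ?_
    rw [hφ, comp_apply, ← Submodule.inner_starProjection_left_eq_right,
      Submodule.starProjection_eq_self_iff.2 (a.2 η)]
  let J' : (Fin n → vnAlg M) →ₗ[(vnAlg M)ᵐᵒᵖ] fixed M (⊤ : Submodule ℂ (L2 H)) :=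
    LinearMap.codRestrict _ J fun b => htop _
  refine ⟨n, V, φ ∘ₗ J', fun x => ?_, fun x y => ?_⟩
  · have h1 : J' (V x) = ⟨x.1, htop x.1⟩ := Subtype.ext (hJV x)
    rw [LinearMap.comp_apply, h1, hφa]
  · change _ = ip (vnAlg M) x.1 (φ (J' y)).1
    rw [hφip]
    change ∑ i : Fin n, star (x.1.1 i) * y i = ip (vnAlg M) x.1 (J y)
    have h1 : ∀ (s : Finset (Fin n)), ip (vnAlg M) x.1 (∑ i ∈ s, op (y i) • stdBasis M i) =
        ∑ i ∈ s, star (x.1.1 i) * y i := by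
      intro s
      induction s using Finset.induction_on with
      | empty => rw [Finset.sum_empty, Finset.sum_empty, ip_zero_right]
      | insert i s hi ih =>
        rw [Finset.sum_insert hi, Finset.sum_insert hi, ip_add_right, ih, ip_smul_right]
        congr 2
        rw [← star_ip (vnAlg M)]
        congr 1
        exact Subtype.ext (ipOp_stdBasis i x.1)
    exact (h1 Finset.univ).symm

theorem IsFGP.of_iso {A : Type u} [CStarAlgebra A] {E F : Type*} [AddCommGroup E]
    [Module Aᵐᵒᵖ E] [InnerModule A E] [AddCommGroup F] [Module Aᵐᵒᵖ F] [InnerModule A F]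
    (h : Iso A E F) (hF : IsFGP A F) : IsFGP A E := by
  obtain ⟨n, p, hp, hi⟩ := hF
  exact ⟨n, p, hp, h.trans hi⟩

/-- An operator that vanishes on `Uᗮ` has its support inside `U`, and closed invariant subspaces of
`U` inherit small tails. -/
theorem IsFin.orthogonal_ker {X : L2 H →L[ℂ] L2 H} (hX : Equivariant M X)
    {U : Submodule ℂ (L2 H)} (hU : IsFin M U) (h : Uᗮ ≤ X.ker) : IsFin M X.kerᗮ := by
  have : CompleteSpace U := hU.isClosed.completeSpace_coe
  refine hU.mono ?_ (Submodule.isClosed_orthogonal _) (orthogonal_invariant hX.ker_invariant)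
  refine (Submodule.orthogonal_le h).trans ?_
  rw [Submodule.orthogonal_orthogonal]

/-- If tails on `U` are at most half the norm, then truncation to `n` coordinates is injective on
`U`. The polar decomposition of truncation after projection to `U` then identifies `U` with a
subspace of the sequences of length `n`. -/
theorem IsFin.isFGP {U : Submodule ℂ (L2 H)} (hU : IsFin M U) : IsFGP (vnAlg M) (fixed M U) := by
  have : CompleteSpace U := hU.isClosed.completeSpace_coe
  obtain ⟨n, hn⟩ := hU.small (1 / 2) (by norm_num)
  set X : L2 H →L[ℂ] L2 H := cut (Finset.range n) ∘L U.starProjection with hXdef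
  have hX : Equivariant M X := (equivariant_cut _).comp (equivariant_starProjection hU.invariant)
  have hker : X.ker = Uᗮ := by
    ext x
    constructor
    · intro hx
      have h1 : cut (Finset.range n) (U.starProjection x) = 0 := hx
      have h2 := cut_add_tail n (U.starProjection x)
      rw [h1, zero_add] at h2
      have h3 := hn _ (U.starProjection_apply_mem x)
      rw [h2] at h3
      have h4 : ‖U.starProjection x‖ = 0 := by
        linarith [norm_nonneg (U.starProjection x)]
      exact U.starProjection_apply_eq_zero_iff.1 (norm_eq_zero.1 h4)
    · intro hx
      change cut (Finset.range n) (U.starProjection x) = 0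
      rw [U.starProjection_apply_eq_zero_iff.2 hx, map_zero]
  have hU' : X.kerᗮ = U := by rw [hker, Submodule.orthogonal_orthogonal]
  have hW : IsFin M (adjoint X).kerᗮ := by
    refine (isFin_range_cut n).orthogonal_ker hX.adjointOp fun x hx => ?_
    change adjoint X x = 0
    refine ext_inner_right ℂ fun y => ?_
    rw [adjoint_inner_left, inner_zero_left]
    exact Submodule.inner_left_of_mem_orthogonal (tail_cut n _) hx
  have hiso := hX.iso_fixed_ker (hU'.symm ▸ hU) hW
  rw [hU'] at hiso
  refine IsFGP.of_iso hiso (isFGP_fixed_of_le_ker_tail hW (n := n) ?_)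
  have hc : CompleteSpace (tail n : L2 H →L[ℂ] L2 H).ker :=
    (isFin_range_cut (M := M) n).isClosed.completeSpace_coe
  rw [orthogonal_ker_adjoint]
  refine Submodule.topologicalClosure_minimal _ ?_ (ContinuousLinearMap.isClosed_ker _)
  rintro _ ⟨z, rfl⟩
  exact tail_cut n _

theorem IsFin.inf_orthogonal {U W : Submodule ℂ (L2 H)} (hU : IsFin M U) (hW : IsFin M W) :
    IsFin M (W ⊓ Uᗮ) :=
  hW.mono inf_le_left (hW.isClosed.inter (Submodule.isClosed_orthogonal _)) fun m hm x hx =>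
    ⟨hW.invariant m hm x hx.1, orthogonal_invariant hU.invariant m hm x hx.2⟩

/-- The orthogonal decomposition of `W`. The projections to both summands act on modules because the
summands have small tails. -/
theorem IsFin.iso_prod {U W : Submodule ℂ (L2 H)} (hU : IsFin M U) (hW : IsFin M W)
    (h : U ≤ W) :
    Iso (vnAlg M) (fixed M W) (fixed M U × fixed M (W ⊓ Uᗮ : Submodule ℂ (L2 H))) := by
  have : CompleteSpace U := hU.isClosed.completeSpace_coe
  have hp := equivariant_starProjection (M := M) hU.invariant
  have hq : Equivariant M (Uᗮ.starProjection) :=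
    equivariant_starProjection (orthogonal_invariant hU.invariant)
  have hq' : ∀ x, Uᗮ.starProjection x = x - U.starProjection x := fun x => by
    rw [eq_sub_iff_add_eq', U.starProjection_add_starProjection_orthogonal]
  obtain ⟨φ, hφ⟩ := hU.exists_map (U := W) hp fun x _ => U.starProjection_apply_mem x
  obtain ⟨ψ, hψ⟩ := (hU.inf_orthogonal hW).exists_map (U := W) hq fun x hx =>
    ⟨by rw [hq']; exact W.sub_mem hx (h (U.starProjection_apply_mem x)),
      Uᗮ.starProjection_apply_mem x⟩
  let s : (fixed M U × fixed M (W ⊓ Uᗮ : Submodule ℂ (L2 H))) →ₗ[(vnAlg M)ᵐᵒᵖ] fixed M W :=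
    { toFun := fun x => ⟨x.1.1 + x.2.1, fun η => by
        rw [hat_add]; exact W.add_mem (h (x.1.2 η)) (x.2.2 η).1⟩
      map_add' := fun x y => Subtype.ext (by
        change (x.1.1 + y.1.1) + (x.2.1 + y.2.1) = (x.1.1 + x.2.1) + (y.1.1 + y.2.1)
        abel)
      map_smul' := fun c x => Subtype.ext (smul_add c x.1.1 x.2.1).symm }
  have hs : ∀ x, hat (s x).1 = hat x.1.1 + hat x.2.1 := fun x => rfl
  refine ⟨LinearEquiv.ofLinearMap (φ.prod ψ) s ?_ ?_, fun x y => ?_⟩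
  · apply LinearMap.ext
    rintro ⟨x, y⟩
    have hy : ∀ η, hat y.1 η ∈ Uᗮ := fun η => (y.2 η).2
    refine Prod.ext (Subtype.ext (hat_injective ?_)) (Subtype.ext (hat_injective ?_))
    · change hat (φ (s (x, y))).1 = hat x.1
      rw [hφ, hs]
      ext1 η
      rw [comp_apply, add_apply, map_add, U.starProjection_apply_eq_zero_iff.2 (hy η), add_zero]
      exact Submodule.starProjection_eq_self_iff.2 (x.2 η)
    · change hat (ψ (s (x, y))).1 = hat y.1
      rw [hψ, hs]
      ext1 η
      rw [comp_apply, add_apply, hq', map_add, U.starProjection_apply_eq_zero_iff.2 (hy η),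
        add_zero, Submodule.starProjection_eq_self_iff.2 (x.2 η), add_sub_cancel_left]
  · apply LinearMap.ext
    intro x
    apply Subtype.ext
    apply hat_injective
    change hat (s (φ x, ψ x)).1 = hat x.1
    rw [hs, hφ, hψ]
    ext1 η
    rw [add_apply, comp_apply, comp_apply, hq']
    abel
  · change ip (vnAlg M) (φ x).1 (φ y).1 + ip (vnAlg M) (ψ x).1 (ψ y).1 = ip (vnAlg M) x.1 y.1
    apply Subtype.ext
    change ipOp (φ x).1 (φ y).1 + ipOp (ψ x).1 (ψ y).1 = ipOp x.1 y.1
    ext ζ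
    refine ext_inner_left ℂ fun η => ?_
    rw [add_apply, inner_add_right, ← inner_hat, ← inner_hat, ← inner_hat, hφ, hφ, hψ, hψ]
    simp only [comp_apply]
    rw [Submodule.inner_starProjection_left_eq_right, Submodule.inner_starProjection_left_eq_right,
      Submodule.starProjection_eq_self_iff.2 (U.starProjection_apply_mem _),
      Submodule.starProjection_eq_self_iff.2 (Uᗮ.starProjection_apply_mem _), ← inner_add_right,
      U.starProjection_add_starProjection_orthogonal]

end Polar

/-! ### Classes in `K₀`. -/

section KClasses

variable {A : Type u} [CStarAlgebra A]

theorem K0.cls_eq_of_iso {P Q : Type u} [AddCommGroup P] [Module Aᵐᵒᵖ P] [InnerModule A P]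
    [AddCommGroup Q] [Module Aᵐᵒᵖ Q] [InnerModule A Q] (hP : IsFGP A P) (hQ : IsFGP A Q)
    (h : Iso A P Q) : K0.cls hP = K0.cls hQ :=
  congrArg Algebra.GrothendieckAddGroup.of (Quotient.sound h)

theorem K0.cls_prod {P Q : Type u} [AddCommGroup P] [Module Aᵐᵒᵖ P] [InnerModule A P]
    [AddCommGroup Q] [Module Aᵐᵒᵖ Q] [InnerModule A Q] (hP : IsFGP A P) (hQ : IsFGP A Q) :
    K0.cls (hP.prod hQ) = K0.cls hP + K0.cls hQ :=
  (Algebra.GrothendieckAddGroup.of (M := IsoClass A)).map_add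
    (Quotient.mk (instSetoidFGP A) ⟨P, hP⟩) (Quotient.mk (instSetoidFGP A) ⟨Q, hQ⟩)

end KClasses

/-! ### The index on `L2 H` and its invariance under compact perturbations. -/

section Index

open ContinuousLinearMap

variable {H : Type u} [NormedAddCommGroup H] [InnerProductSpace ℂ H] [CompleteSpace H]
variable {M : VonNeumannAlgebra H}

/-- The class in `K₀` of the module that corresponds to `U`. -/
noncomputable def IsFin.cls {U : Submodule ℂ (L2 H)} (hU : IsFin M U) : K0 (vnAlg M) :=
  K0.cls hU.isFGP

theorem IsFin.cls_congr {U W : Submodule ℂ (L2 H)} (hU : IsFin M U) (hW : IsFin M W)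
    (h : U = W) : hU.cls = hW.cls := by
  subst h; rfl

theorem IsFin.cls_eq_add {U W : Submodule ℂ (L2 H)} (hU : IsFin M U) (hW : IsFin M W)
    (h : U ≤ W) : hW.cls = hU.cls + (hU.inf_orthogonal hW).cls := by
  rw [IsFin.cls, IsFin.cls, IsFin.cls, ← K0.cls_prod]
  exact K0.cls_eq_of_iso _ _ (hU.iso_prod hW h)

theorem Equivariant.cls_eq {X : L2 H →L[ℂ] L2 H} (hX : Equivariant M X)
    (h : IsFin M X.kerᗮ) (h' : IsFin M (adjoint X).kerᗮ) : h.cls = h'.cls :=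
  K0.cls_eq_of_iso _ _ (hX.iso_fixed_ker h h')

variable (M) in
/-- Equivariant operators that, with their adjoints, map the coordinate subspaces to uniformly
small tails. -/
structure IsTame (X : L2 H →L[ℂ] L2 H) : Prop where
  equivariant : Equivariant M X
  comp_cut : ∀ n, TailSmall (X ∘L cut (Finset.range n))
  adjoint_comp_cut : ∀ n, TailSmall (adjoint X ∘L cut (Finset.range n))

theorem isTame_rep (T : EndA (vnAlg M) (StdModule (vnAlg M))) : IsTame M (rep T) :=
  ⟨equivariant_rep T, tailSmall_rep_cut T, by rw [← rep_star]; exact tailSmall_rep_cut _⟩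

theorem IsTame.adjointOp {X : L2 H →L[ℂ] L2 H} (h : IsTame M X) : IsTame M (adjoint X) :=
  ⟨h.equivariant.adjointOp, h.adjoint_comp_cut, by rw [adjoint_adjoint]; exact h.comp_cut⟩

theorem IsTame.add {X Y : L2 H →L[ℂ] L2 H} (h : IsTame M X) (h' : IsTame M Y) :
    IsTame M (X + Y) :=
  ⟨h.equivariant.add h'.equivariant, fun n => by
    rw [add_comp]; exact (h.comp_cut n).add (h'.comp_cut n),
    fun n => by rw [map_add, add_comp]; exact (h.adjoint_comp_cut n).add (h'.adjoint_comp_cut n)⟩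

theorem adjoint_cut (s : Finset ℕ) : adjoint (cut s : L2 H →L[ℂ] L2 H) = cut s := by
  ext1 x
  refine ext_inner_right ℂ fun y => ?_
  rw [adjoint_inner_left, inner_cut]

variable (M) in
/-- A compact operator: it is tame, and its tails and those of its adjoint are uniformly small. -/
structure IsCpt (K : L2 H →L[ℂ] L2 H) : Prop where
  tame : IsTame M K
  small : TailSmall K
  adjoint_small : TailSmall (adjoint K)

variable (M) in
/-- Fredholm operators on `L2 H`. -/
structure IsFredholmOp (F : L2 H →L[ℂ] L2 H) : Prop where
  tame : IsTame M F
  exists_inverse : ∃ G, IsTame M G ∧ TailSmall (F ∘L G - .id ℂ _) ∧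
    TailSmall (adjoint (F ∘L G - .id ℂ _)) ∧ TailSmall (G ∘L F - .id ℂ _) ∧
    TailSmall (adjoint (G ∘L F - .id ℂ _))

theorem IsFredholm.isFredholmOp {f : EndA (vnAlg M) (StdModule (vnAlg M))} (hf : IsFredholm f) :
    IsFredholmOp M (rep f) := by
  obtain ⟨g, h1, h2⟩ := hf
  have h1 := h1.tailSmall
  have h2 := h2.tailSmall
  rw [rep_sub, rep_mul, rep_one] at h1 h2
  exact ⟨isTame_rep f, rep g, isTame_rep g, h1.1, h1.2, h2.1, h2.2⟩

theorem adjoint_comp_sub_id (F G : L2 H →L[ℂ] L2 H) :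
    adjoint (F ∘L G - .id ℂ _) = adjoint G ∘L adjoint F - .id ℂ _ := by
  ext1 x
  refine ext_inner_right ℂ fun y => ?_
  rw [adjoint_inner_left]
  simp only [sub_apply, comp_apply, id_apply, inner_sub_left, inner_sub_right, adjoint_inner_left]

theorem IsFredholmOp.adjointOp {F : L2 H →L[ℂ] L2 H} (hF : IsFredholmOp M F) :
    IsFredholmOp M (adjoint F) := by
  obtain ⟨hF, G, hG, h1, h2, h3, h4⟩ := hF
  refine ⟨hF.adjointOp, adjoint G, hG.adjointOp, ?_, ?_, ?_, ?_⟩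
  · rw [← adjoint_comp_sub_id]; exact h4
  · rw [← adjoint_comp_sub_id, adjoint_adjoint]; exact h3
  · rw [← adjoint_comp_sub_id]; exact h2
  · rw [← adjoint_comp_sub_id, adjoint_adjoint]; exact h1

theorem IsFredholmOp.add {F K : L2 H →L[ℂ] L2 H} (hF : IsFredholmOp M F) (hK : IsCpt M K) :
    IsFredholmOp M (F + K) := by
  obtain ⟨hF, G, hG, h1, h2, h3, h4⟩ := hF
  have e1 : (F + K) ∘L G - .id ℂ _ = (F ∘L G - .id ℂ _) + K ∘L G := by
    rw [add_comp]; abel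
  have e2 : G ∘L (F + K) - .id ℂ _ = (G ∘L F - .id ℂ _) + G ∘L K := by
    rw [comp_add]; abel
  refine ⟨hF.add hK.tame, G, hG, ?_, ?_, ?_, ?_⟩
  · rw [e1]; exact h1.add (hK.small.comp G)
  -- Here `G⋆` acts after `K⋆`, so small tails are kept only because `G⋆` is tame.
  · rw [e1, map_add, adjoint_comp K G]
    exact h2.add (hK.adjoint_small.comp_left _ hG.adjoint_comp_cut)
  · rw [e2]; exact h3.add (hK.small.comp_left _ hG.comp_cut)
  · rw [e2, map_add, adjoint_comp G K]
    exact h4.add (hK.adjoint_small.comp _)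

/-- This makes `F ∘ tail n` a compact perturbation of `F`. -/
theorem IsTame.isCpt_neg_cut {F : L2 H →L[ℂ] L2 H} (hF : IsTame M F) (n : ℕ) :
    IsCpt M (-(F ∘L cut (Finset.range n))) := by
  have h2 : adjoint (-(F ∘L cut (Finset.range n))) = -(cut (Finset.range n) ∘L adjoint F) := by
    rw [map_neg, adjoint_comp, adjoint_cut]
  refine ⟨⟨fun m hm x => ?_, fun k => ?_, fun k => ?_⟩, (hF.comp_cut n).neg, ?_⟩
  · have h := (hF.equivariant.comp (equivariant_cut (Finset.range n))) m hm x
    rw [neg_apply, neg_apply, map_neg, h]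
  · rw [neg_comp]; exact ((hF.comp_cut n).comp _).neg
  · rw [h2, neg_comp]; exact ((tailSmall_cut n _).comp _).neg
  · rw [h2]; exact (tailSmall_cut n _).neg

theorem IsFredholmOp.comp_tail {F : L2 H →L[ℂ] L2 H} (hF : IsFredholmOp M F) (n : ℕ) :
    IsFredholmOp M (F ∘L tail n) := by
  have h : F ∘L tail n = F + -(F ∘L cut (Finset.range n)) := by
    ext1 x
    rw [comp_apply, tail_apply, map_sub, sub_eq_add_neg]
    rfl
  rw [h]
  exact hF.add (hF.tame.isCpt_neg_cut n)

/-- On the kernel of `F` the operator `G F - 1` is `-1`, so the small tails of its values are the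
small tails of the kernel itself. -/
theorem IsFredholmOp.isFin_ker {F : L2 H →L[ℂ] L2 H} (hF : IsFredholmOp M F) : IsFin M F.ker := by
  obtain ⟨hF, G, hG, h1, h2, h3, h4⟩ := hF
  refine ⟨F.isClosed_ker, hF.equivariant.ker_invariant,
    fun ε hε => (h3 ε hε).imp fun N hN x hx => ?_⟩
  have hx' : F x = 0 := hx
  have h := hN x
  rwa [sub_apply, comp_apply, hx', map_zero, zero_sub, map_neg, norm_neg] at h

/-- An operator whose adjoint has uniformly small tails is small on tails. -/
theorem exists_norm_apply_tail_le {K : L2 H →L[ℂ] L2 H} (hK : TailSmall (adjoint K)) {ε : ℝ}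
    (hε : 0 < ε) : ∃ N, ∀ n, N ≤ n → ∀ x, ‖K (tail n x)‖ ≤ ε * ‖tail n x‖ := by
  obtain ⟨N, hN⟩ := hK ε hε
  refine ⟨N, fun n hn x => ?_⟩
  have h1 : ‖K (tail n x)‖ * ‖K (tail n x)‖ ≤ ‖tail n x‖ * (ε * ‖K (tail n x)‖) := by
    rw [← inner_self_eq_norm_mul_norm (𝕜 := ℂ), ← adjoint_inner_right, ← tail_tail' n n le_rfl x,
      inner_tail, tail_tail' n n le_rfl x]
    refine (re_inner_le_norm _ _).trans ?_
    gcongr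
    exact (norm_tail_mono hn _).trans (hN _)
  rcases (norm_nonneg (K (tail n x))).eq_or_lt with h2 | h2
  · rw [← h2]; positivity
  · refine le_of_mul_le_mul_right (h1.trans_eq ?_) h2
    ring

/-- `F` is bounded below by `C⁻¹` on the sequences that start with `n` zeros. -/
def BoundedBelow (F : L2 H →L[ℂ] L2 H) (C : ℝ) (n : ℕ) : Prop :=
  ∀ x, ‖tail n x‖ ≤ C * ‖F (tail n x)‖

/-- On far tails `G F - 1` has norm at most `1 / 2`, so `‖x‖ ≤ 2 ‖G‖ ‖F x‖` there, with a constant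
that does not depend on `n`. -/
theorem IsFredholmOp.exists_boundedBelow {F : L2 H →L[ℂ] L2 H} (hF : IsFredholmOp M F) :
    ∃ C N, 0 ≤ C ∧ ∀ n, N ≤ n → BoundedBelow F C n := by
  obtain ⟨hF, G, hG, h1, h2, h3, h4⟩ := hF
  obtain ⟨N, hN⟩ := exists_norm_apply_tail_le h4 (ε := 1 / 2) (by norm_num)
  refine ⟨2 * ‖G‖, N, by positivity, fun n hn x => ?_⟩
  have h := hN n hn x
  rw [sub_apply, comp_apply, id_apply] at h
  have h5 : ‖tail n x‖ ≤ ‖G (F (tail n x))‖ + ‖G (F (tail n x)) - tail n x‖ := by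
    have := norm_sub_le (G (F (tail n x))) (G (F (tail n x)) - tail n x)
    rwa [sub_sub_cancel] at this
  have h6 := G.le_opNorm (F (tail n x))
  linarith

theorem BoundedBelow.mono {H : Type u} [NormedAddCommGroup H] [InnerProductSpace ℂ H]
    {F : L2 H →L[ℂ] L2 H} {C C' : ℝ} {n : ℕ} (h : BoundedBelow F C n) (hC : C ≤ C') :
    BoundedBelow F C' n := fun x => (h x).trans (by gcongr)

theorem BoundedBelow.isClosed_range {F : L2 H →L[ℂ] L2 H} {C : ℝ} {n : ℕ} (hC : 0 ≤ C)
    (h : BoundedBelow F C n) : IsClosed ((F ∘L tail n).range : Set (L2 H)) := by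
  have hcl : IsClosed ((cut (Finset.range n) : L2 H →L[ℂ] L2 H).ker : Set (L2 H)) :=
    ContinuousLinearMap.isClosed_ker _
  have hcomp := hcl.completeSpace_coe
  have hfix : ∀ x ∈ (cut (Finset.range n) : L2 H →L[ℂ] L2 H).ker, tail n x = x := fun x hx => by
    have hx' : cut (Finset.range n) x = 0 := hx
    rw [tail_apply, hx', sub_zero]
  have hanti : AntilipschitzWith C.toNNReal
      (fun x : (cut (Finset.range n) : L2 H →L[ℂ] L2 H).ker => F x) := by
    refine AntilipschitzWith.of_le_mul_dist fun x y => ?_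
    rw [Subtype.dist_eq, dist_eq_norm, dist_eq_norm, ← map_sub, Real.coe_toNNReal _ hC]
    have h1 := h (x - y : L2 H)
    rwa [hfix _ (Submodule.sub_mem _ x.2 y.2)] at h1
  have huc : UniformContinuous (fun x : (cut (Finset.range n) : L2 H →L[ℂ] L2 H).ker => F x) :=
    F.uniformContinuous.comp uniformContinuous_subtype_val
  have h2 := hanti.isClosed_range huc
  have h3 : ((F ∘L tail n).range : Set (L2 H)) =
      Set.range (fun x : (cut (Finset.range n) : L2 H →L[ℂ] L2 H).ker => F x) := by
    ext y
    constructor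
    · rintro ⟨x, rfl⟩; exact ⟨⟨tail n x, cut_tail n x⟩, rfl⟩
    · rintro ⟨x, rfl⟩
      refine ⟨x, ?_⟩
      change F (tail n x) = F x
      rw [hfix _ x.2]
  rw [h3]
  exact h2

/-- The image of `F ∘ tail n` is closed, so it is the whole orthogonal complement of the kernel of
its adjoint. -/
theorem BoundedBelow.exists_eq {F : L2 H →L[ℂ] L2 H} {C : ℝ} {n : ℕ} (hC : 0 ≤ C)
    (h : BoundedBelow F C n) {y : L2 H} (hy : y ∈ (adjoint (F ∘L tail n)).kerᗮ) :
    ∃ x, y = F (tail n x) := by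
  rw [orthogonal_ker_adjoint, IsClosed.submodule_topologicalClosure_eq (h.isClosed_range hC)] at hy
  obtain ⟨x, rfl⟩ := hy
  exact ⟨x, rfl⟩

theorem adjoint_comp_starProjection (U : Submodule ℂ (L2 H)) [U.HasOrthogonalProjection]
    (X : L2 H →L[ℂ] L2 H) (x : L2 H) :
    adjoint (X ∘L U.starProjection) x = U.starProjection (adjoint X x) := by
  refine ext_inner_right ℂ fun y => ?_
  rw [adjoint_inner_left, comp_apply, Submodule.inner_starProjection_left_eq_right,
    adjoint_inner_left]

theorem adjoint_starProjection_comp (U : Submodule ℂ (L2 H)) [U.HasOrthogonalProjection]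
    (X : L2 H →L[ℂ] L2 H) (x : L2 H) :
    adjoint (U.starProjection ∘L X) x = adjoint X (U.starProjection x) := by
  refine ext_inner_right ℂ fun y => ?_
  rw [adjoint_inner_left, comp_apply, ← Submodule.inner_starProjection_left_eq_right,
    adjoint_inner_left]

theorem orthogonal_orthogonal_ker (X : L2 H →L[ℂ] L2 H) : X.kerᗮᗮ = X.ker := by
  rw [Submodule.orthogonal_orthogonal_eq_closure,
    IsClosed.submodule_topologicalClosure_eq X.isClosed_ker]

/-- Rank-nullity for `F` against its restriction to tails. Write `K = ker F`, `Q = ker F⋆`, `P` for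
the first `n` coordinates and `N = ker (F ∘ tail n)⋆ ⊇ Q`. Truncation identifies `K` with a subspace
`U₁` of `P`, since `F` is injective on tails; the projection of `F` to `N` identifies `P ⊖ U₁` with
`N ⊖ Q`. Hence `[P] - [K] = [N] - [Q]`. -/
theorem IsFredholmOp.cls_sub_cls {F : L2 H →L[ℂ] L2 H} (hF : IsFredholmOp M F) {C : ℝ} {n : ℕ}
    (hC : 0 ≤ C) (h : BoundedBelow F C n) :
    hF.isFin_ker.cls - hF.adjointOp.isFin_ker.cls =
      (isFin_range_cut (M := M) n).cls - (hF.comp_tail n).adjointOp.isFin_ker.cls := by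
  have hK := hF.isFin_ker
  have hQ := hF.adjointOp.isFin_ker
  have hP := isFin_range_cut (M := M) (H := H) n
  have hN := (hF.comp_tail n).adjointOp.isFin_ker
  set K := F.ker with hKdef
  set Q := (adjoint F).ker with hQdef
  set P := (tail n : L2 H →L[ℂ] L2 H).ker with hPdef
  set N := (adjoint (F ∘L tail n)).ker with hNdef
  change hK.cls - hQ.cls = hP.cls - hN.cls
  have cK : CompleteSpace K := hK.isClosed.completeSpace_coe
  have cN : CompleteSpace N := hN.isClosed.completeSpace_coe
  -- the projection of the kernel of `F` to the first `n` coordinates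
  set Y : L2 H →L[ℂ] L2 H := cut (Finset.range n) ∘L K.starProjection with hY
  have hYe : Equivariant M Y := (equivariant_cut _).comp (equivariant_starProjection hK.invariant)
  have hYker : Y.ker = Kᗮ := by
    ext x
    constructor
    · intro hx
      have h1 : cut (Finset.range n) (K.starProjection x) = 0 := hx
      have h2 := cut_add_tail n (K.starProjection x)
      rw [h1, zero_add] at h2
      have h3 := h (K.starProjection x)
      have h4 : F (K.starProjection x) = 0 := K.starProjection_apply_mem x
      rw [h2, h4, norm_zero, mul_zero] at h3
      exact K.starProjection_apply_eq_zero_iff.1 (norm_le_zero_iff.1 h3)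
    · intro hx
      change cut (Finset.range n) (K.starProjection x) = 0
      rw [K.starProjection_apply_eq_zero_iff.2 hx, map_zero]
  have hYK : Y.kerᗮ = K := by rw [hYker, Submodule.orthogonal_orthogonal]
  have hYa : ∀ x, adjoint Y x = K.starProjection (cut (Finset.range n) x) := fun x => by
    rw [hY, adjoint_comp_starProjection, adjoint_cut]
  have hU1 : IsFin M (adjoint Y).kerᗮ := by
    refine hP.orthogonal_ker hYe.adjointOp fun x hx => ?_
    change adjoint Y x = 0
    refine ext_inner_right ℂ fun y => ?_
    rw [adjoint_inner_left, inner_zero_left]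
    exact Submodule.inner_left_of_mem_orthogonal (tail_cut n _) hx
  have hU1P : (adjoint Y).kerᗮ ≤ P := by
    rw [orthogonal_ker_adjoint]
    refine Submodule.topologicalClosure_minimal _ ?_ hP.isClosed
    rintro _ ⟨z, rfl⟩
    exact tail_cut n _
  have e1 : hK.cls = hU1.cls :=
    (hK.cls_congr (hYK.symm ▸ hK) hYK.symm).trans (hYe.cls_eq (hYK.symm ▸ hK) hU1)
  have e2 := hU1.cls_eq_add hP hU1P
  -- the part of `F` that maps to the cokernel of its restriction
  set Z : L2 H →L[ℂ] L2 H := N.starProjection ∘L F with hZ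
  have hZe : Equivariant M Z := (equivariant_starProjection hN.invariant).comp hF.tame.equivariant
  have hZa : ∀ x, adjoint Z x = adjoint F (N.starProjection x) := fun x => by
    rw [hZ, adjoint_starProjection_comp]
  -- `N` is orthogonal to the image of `F ∘ tail n`, and this image is closed, so `Z y = 0` means
  -- that `F y = F (tail n z)` for some `z`. Thus `ker Z` is the sum of `K` and the tails, and `x`
  -- is orthogonal to it iff it lies in `P` and is orthogonal to `K`.
  have hU2eq : Z.kerᗮ = P ⊓ (adjoint Y).kerᗮᗮ := by
    rw [orthogonal_orthogonal_ker]
    ext x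
    constructor
    · intro hx
      rw [Submodule.mem_orthogonal] at hx
      have h1 : tail n x = 0 := by
        refine ext_inner_left ℂ fun z => ?_
        rw [← inner_tail, inner_zero_right]
        refine hx _ ?_
        change N.starProjection (F (tail n z)) = 0
        rw [N.starProjection_apply_eq_zero_iff, hNdef, orthogonal_ker_adjoint]
        exact Submodule.le_topologicalClosure _ ⟨z, rfl⟩
      have h2 : cut (Finset.range n) x = x := by
        have := cut_add_tail n x
        rwa [h1, add_zero] at this
      refine ⟨h1, ?_⟩
      change adjoint Y x = 0
      rw [hYa, h2, K.starProjection_apply_eq_zero_iff, Submodule.mem_orthogonal]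
      intro k hk
      refine hx k ?_
      change N.starProjection (F k) = 0
      have : F k = 0 := hk
      rw [this, map_zero]
    · rintro ⟨hx, hx'⟩
      have h1 : tail n x = 0 := hx
      have h2 : cut (Finset.range n) x = x := by
        have := cut_add_tail n x
        rwa [h1, add_zero] at this
      have h3 : K.starProjection x = 0 := by
        have h4 : adjoint Y x = 0 := hx'
        rwa [hYa, h2] at h4
      rw [K.starProjection_apply_eq_zero_iff, Submodule.mem_orthogonal] at h3
      rw [Submodule.mem_orthogonal]
      intro y hy
      have h5 : F y ∈ Nᗮ := N.starProjection_apply_eq_zero_iff.1 hy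
      obtain ⟨z, hz⟩ := h.exists_eq hC h5
      have h6 : y - tail n z ∈ K := by
        change F (y - tail n z) = 0
        rw [map_sub, hz, sub_self]
      have h7 := h3 _ h6
      rw [inner_sub_left, inner_tail, h1, inner_zero_right, sub_zero] at h7
      exact h7
  have hU2 : IsFin M Z.kerᗮ := hU2eq ▸ hU1.inf_orthogonal hP
  have hU3 : IsFin M (adjoint Z).kerᗮ := by
    refine hN.orthogonal_ker hZe.adjointOp fun x hx => ?_
    change adjoint Z x = 0
    rw [hZa, N.starProjection_apply_eq_zero_iff.2 hx, map_zero]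
  have hU3N : (adjoint Z).kerᗮ ≤ N := by
    rw [orthogonal_ker_adjoint]
    refine Submodule.topologicalClosure_minimal _ ?_ hN.isClosed
    rintro _ ⟨z, rfl⟩
    exact N.starProjection_apply_mem _
  -- On `N` the adjoint of `Z` is `F⋆`, and `Q ⊆ N`; so `Q` is what remains of `N` after the final
  -- support of `Z` is removed.
  have hQeq : Q = N ⊓ (adjoint Z).kerᗮᗮ := by
    rw [orthogonal_orthogonal_ker]
    ext x
    constructor
    · intro hx
      have h1 : adjoint F x = 0 := hx
      have h2 : x ∈ N := by
        change adjoint (F ∘L tail n) x = 0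
        rw [adjoint_comp, comp_apply, h1, map_zero]
      refine ⟨h2, ?_⟩
      change adjoint Z x = 0
      rw [hZa, Submodule.starProjection_eq_self_iff.2 h2, h1]
    · rintro ⟨hx, hx'⟩
      have h1 : adjoint Z x = 0 := hx'
      rwa [hZa, Submodule.starProjection_eq_self_iff.2 hx] at h1
  have e3 : (hU1.inf_orthogonal hP).cls = hU3.cls :=
    (IsFin.cls_congr _ hU2 hU2eq.symm).trans (hZe.cls_eq hU2 hU3)
  have e4 := hU3.cls_eq_add hN hU3N
  have e5 : hQ.cls = (hU3.inf_orthogonal hN).cls := IsFin.cls_congr _ _ hQeq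
  rw [e1, e2, e3, e4, e5]
  abel

/-- Such an `x` has the form `F' (tail n z)` and is orthogonal to `F (tail n z)`. So `‖x‖²` is the
inner product of `x` with the difference of the two, which is at most `ε C ‖x‖²`. -/
theorem eq_zero_of_mem_ker_adjoint {F F' : L2 H →L[ℂ] L2 H} {C ε : ℝ} {n : ℕ} (hC : 0 ≤ C)
    (h : BoundedBelow F' C n) (hε : ε * C < 1) (hε0 : 0 ≤ ε)
    (hFF : ∀ x, ‖F' (tail n x) - F (tail n x)‖ ≤ ε * ‖tail n x‖)
    {x : L2 H} (hx : x ∈ (adjoint (F ∘L tail n)).ker)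
    (hx' : x ∈ (adjoint (F' ∘L tail n)).kerᗮ) : x = 0 := by
  obtain ⟨z, hz⟩ := h.exists_eq hC hx'
  have h1 : inner ℂ x (F (tail n z)) = 0 := by
    have h2 : adjoint (F ∘L tail n) x = 0 := hx
    have h3 := adjoint_inner_left (F ∘L tail n) z x
    rw [h2, inner_zero_left] at h3
    exact h3.symm
  have h2 : ‖x‖ * ‖x‖ ≤ ‖x‖ * (ε * (C * ‖x‖)) := by
    have h3 : inner ℂ x x = inner ℂ x (F' (tail n z) - F (tail n z)) := by
      rw [inner_sub_right, h1, sub_zero, ← hz]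
    rw [← inner_self_eq_norm_mul_norm (𝕜 := ℂ), h3]
    refine (re_inner_le_norm _ _).trans ?_
    gcongr
    refine (hFF z).trans ?_
    gcongr
    have := h z
    rwa [← hz] at this
  by_contra hne
  have h3 : 0 < ‖x‖ := norm_pos_iff.2 hne
  have h4 : 0 < ‖x‖ * ‖x‖ := mul_pos h3 h3
  nlinarith

theorem starProjection_comp_ker {G : Type*} [NormedAddCommGroup G] [InnerProductSpace ℂ G]
    {U W : Submodule ℂ G} [U.HasOrthogonalProjection] [W.HasOrthogonalProjection]
    (h : ∀ x ∈ U, x ∈ Wᗮ → x = 0) : (W.starProjection ∘L U.starProjection).kerᗮ = U := by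
  have h1 : (W.starProjection ∘L U.starProjection).ker = Uᗮ := by
    ext x
    constructor
    · intro hx
      have h2 : W.starProjection (U.starProjection x) = 0 := hx
      exact U.starProjection_apply_eq_zero_iff.1 (h _ (U.starProjection_apply_mem x)
        (W.starProjection_apply_eq_zero_iff.1 h2))
    · intro hx
      change W.starProjection (U.starProjection x) = 0
      rw [U.starProjection_apply_eq_zero_iff.2 hx, map_zero]
  rw [h1, Submodule.orthogonal_orthogonal]

/-- The product of the two projections has initial support `U` and final support `W`, so its polar
decomposition is an isomorphism between them. -/
theorem IsFin.cls_eq_of_transversal {U W : Submodule ℂ (L2 H)} (hU : IsFin M U)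
    (hW : IsFin M W) (h : ∀ x ∈ U, x ∈ Wᗮ → x = 0) (h' : ∀ x ∈ W, x ∈ Uᗮ → x = 0) :
    hU.cls = hW.cls := by
  have cU : CompleteSpace U := hU.isClosed.completeSpace_coe
  have cW : CompleteSpace W := hW.isClosed.completeSpace_coe
  set X := W.starProjection ∘L U.starProjection with hX
  have hXe : Equivariant M X := (equivariant_starProjection hW.invariant).comp
    (equivariant_starProjection hU.invariant)
  have hXa : adjoint X = U.starProjection ∘L W.starProjection := by
    ext1 x
    rw [hX, adjoint_comp_starProjection, comp_apply]
    congr 1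
    refine ext_inner_right ℂ fun y => ?_
    rw [adjoint_inner_left, Submodule.inner_starProjection_left_eq_right]
  have e1 : X.kerᗮ = U := starProjection_comp_ker h
  have e2 : (adjoint X).kerᗮ = W := by rw [hXa]; exact starProjection_comp_ker h'
  exact (hU.cls_congr (e1.symm ▸ hU) e1.symm).trans
    ((hXe.cls_eq (e1.symm ▸ hU) (e2.symm ▸ hW)).trans (IsFin.cls_congr _ hW e2))

/-- The index is invariant under compact perturbations. -/
theorem IsFredholmOp.cls_sub_cls_add {F K : L2 H →L[ℂ] L2 H} (hF : IsFredholmOp M F)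
    (hK : IsCpt M K) :
    (hF.add hK).isFin_ker.cls - (hF.add hK).adjointOp.isFin_ker.cls =
      hF.isFin_ker.cls - hF.adjointOp.isFin_ker.cls := by
  obtain ⟨C₁, N₁, hC₁, h₁⟩ := hF.exists_boundedBelow
  obtain ⟨C₂, N₂, hC₂, h₂⟩ := (hF.add hK).exists_boundedBelow
  set C := max C₁ C₂ with hCdef
  have hC : 0 ≤ C := hC₁.trans (le_max_left _ _)
  -- This choice gives `ε C < 1`, as the comparison of the two cokernels requires.
  set ε := 1 / (C + 1) with hεdef
  have hε : 0 < ε := by positivity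
  have hεC : ε * C < 1 := by
    rw [hεdef, one_div_mul_eq_div, div_lt_one (by positivity)]
    linarith
  obtain ⟨N₃, h₃⟩ := exists_norm_apply_tail_le hK.adjoint_small hε
  set n := max N₁ (max N₂ N₃) with hn
  have b1 : BoundedBelow F C n := (h₁ n (le_max_left _ _)).mono (le_max_left _ _)
  have b2 : BoundedBelow (F + K) C n :=
    (h₂ n ((le_max_left _ _).trans (le_max_right _ _))).mono (le_max_right _ _)
  have b3 := h₃ n ((le_max_right _ _).trans (le_max_right _ _))
  rw [hF.cls_sub_cls hC b1, (hF.add hK).cls_sub_cls hC b2]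
  -- With a common `n` the class of the first `n` coordinates occurs on both sides; only the
  -- cokernels of the restrictions to tails remain to be compared.
  congr 1
  refine IsFin.cls_eq_of_transversal _ _ (fun x hx hx' => ?_) fun x hx hx' => ?_
  · refine eq_zero_of_mem_ker_adjoint hC b1 hεC hε.le (fun x => ?_) hx hx'
    rw [add_apply, sub_add_cancel_left, norm_neg]
    exact b3 x
  · refine eq_zero_of_mem_ker_adjoint hC b2 hεC hε.le (fun x => ?_) hx hx'
    rw [add_apply, add_sub_cancel_left]
    exact b3 x

end Index

/-! ### Spectral measures and the mass at zero. -/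

section Spectral

open ContinuousLinearMap Filter Topology

theorem integrable_of_compactSupport {μ : Measure ℝ} [IsFiniteMeasure μ] {R : ℝ}
    (hR : μ (Set.Icc (-R) R)ᶜ = 0) {g : ℝ → ℝ} (hg : Continuous g) : Integrable g μ := by
  obtain ⟨C, hC⟩ := (isCompact_Icc (a := -R) (b := R)).exists_bound_of_continuousOn hg.continuousOn
  refine Integrable.of_bound hg.aestronglyMeasurable C ?_
  filter_upwards [compl_mem_ae_iff.2 hR] with t ht
  exact hC t (by simpa using ht)

/-- Dominated convergence: on the support the base lies in `[0, 1]`, and it is `1` only at `t = 0`.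
-/
theorem tendsto_integral_chiZero {μ : Measure ℝ} [IsFiniteMeasure μ] {R : ℝ} (hR0 : 0 < R)
    (hR : μ (Set.Icc (-R) R)ᶜ = 0) :
    Tendsto (fun k : ℕ => ∫ t, (1 - (R ^ 2)⁻¹ * t ^ 2) ^ k ∂μ) atTop (𝓝 (∫ t, chiZero t ∂μ)) := by
  have hae : ∀ᵐ t ∂μ, t ∈ Set.Icc (-R) R := by
    filter_upwards [compl_mem_ae_iff.2 hR] with t ht
    simpa using ht
  have hbase : ∀ t ∈ Set.Icc (-R) R, 0 ≤ 1 - (R ^ 2)⁻¹ * t ^ 2 ∧ 1 - (R ^ 2)⁻¹ * t ^ 2 ≤ 1 := by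
    intro t ht
    have h1 : t ^ 2 ≤ R ^ 2 := sq_le_sq' ht.1 ht.2
    have h2 : (R ^ 2)⁻¹ * t ^ 2 ≤ 1 := by
      rw [inv_mul_le_iff₀ (by positivity), mul_one]; exact h1
    have h3 : 0 ≤ (R ^ 2)⁻¹ * t ^ 2 := by positivity
    constructor <;> linarith
  refine tendsto_integral_of_dominated_convergence (fun _ => (1 : ℝ)) (fun k => ?_)
    (integrable_const _) (fun k => ?_) ?_
  · exact Continuous.aestronglyMeasurable (by fun_prop)
  · filter_upwards [hae] with t ht
    rw [norm_pow, Real.norm_of_nonneg (hbase t ht).1]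
    exact pow_le_one₀ (hbase t ht).1 (hbase t ht).2
  · filter_upwards [hae] with t ht
    by_cases h0 : t = 0
    · subst h0
      simp [chiZero]
    · have h1 : chiZero t = 0 := by simp [chiZero, h0]
      rw [h1]
      refine tendsto_pow_atTop_nhds_zero_of_lt_one (hbase t ht).1 ?_
      have : 0 < (R ^ 2)⁻¹ * t ^ 2 := by positivity
      linarith

variable {G : Type*} [NormedAddCommGroup G] [InnerProductSpace ℂ G]

theorem integral_eval_eq {μ : Measure ℝ} [IsFiniteMeasure μ] {R : ℝ}
    (hR : μ (Set.Icc (-R) R)ᶜ = 0) {B : G →L[ℂ] G} {ξ : G}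
    (hm : ∀ n : ℕ, ∫ t, t ^ n ∂μ = (inner ℂ ξ ((B ^ n) ξ)).re) (q : Polynomial ℝ) :
    ∫ t, q.eval t ∂μ = (inner ℂ ξ ((Polynomial.aeval B q) ξ)).re := by
  induction q using Polynomial.induction_on' with
  | add p q hp hq =>
    simp only [Polynomial.eval_add]
    rw [integral_add (integrable_of_compactSupport hR p.continuous)
      (integrable_of_compactSupport hR q.continuous), hp, hq, map_add, add_apply, inner_add_right,
      Complex.add_re]
  | monomial n r =>
    simp only [Polynomial.eval_monomial]
    rw [integral_const_mul, hm, Polynomial.aeval_monomial, ← Algebra.smul_def]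
    have h : (r • B ^ n) ξ = (r : ℂ) • (B ^ n) ξ := rfl
    rw [h, inner_smul_right, Complex.re_ofReal_mul]

theorem inner_starProjection_self (U : Submodule ℂ (G)) [U.HasOrthogonalProjection] (ξ : G) :
    inner ℂ ξ (U.starProjection ξ) = ((‖U.starProjection ξ‖ ^ 2 : ℝ) : ℂ) := by
  have h : U.starProjection (U.starProjection ξ) = U.starProjection ξ :=
    Submodule.starProjection_eq_self_iff.2 (U.starProjection_apply_mem ξ)
  rw [← h, ← Submodule.inner_starProjection_left_eq_right, inner_self_eq_norm_sq_to_K, h]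
  push_cast
  rfl

variable [CompleteSpace G]

/-- The spectral measure of a self-adjoint operator `B` at `ξ` gives `{0}` the mass `‖p ξ‖ ^ 2`,
where `p` is the projection to the kernel of `B`. -/
theorem integral_chiZero_eq {μ : Measure ℝ} [IsFiniteMeasure μ]
    (hc : ∃ R : ℝ, μ (Set.Icc (-R) R)ᶜ = 0) {B : G →L[ℂ] G} (hB : adjoint B = B) {ξ : G}
    (hm : ∀ n : ℕ, ∫ t, t ^ n ∂μ = (inner ℂ ξ ((B ^ n) ξ)).re)
    {K : Submodule ℂ G} [K.HasOrthogonalProjection] (hK : ∀ x, x ∈ K ↔ B x = 0) :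
    ∫ t, chiZero t ∂μ = ‖K.starProjection ξ‖ ^ 2 := by
  obtain ⟨R₀, hR₀⟩ := hc
  -- `R` must bound the support of `μ` and also the norm of `B`, so that `1 - R⁻² B²` is a
  -- contraction.
  set R := max R₀ (‖B‖ + 1) with hRdef
  have hR1 : ‖B‖ + 1 ≤ R := le_max_right _ _
  have hR0 : 0 < R := lt_of_lt_of_le (by positivity) hR1
  have hR : μ (Set.Icc (-R) R)ᶜ = 0 := by
    refine measure_mono_null (Set.compl_subset_compl.2 (Set.Icc_subset_Icc ?_ ?_)) hR₀
    · exact neg_le_neg (le_max_left _ _)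
    · exact le_max_left _ _
  set c : ℝ := (R ^ 2)⁻¹ with hc
  have hc0 : 0 < c := by positivity
  set q : Polynomial ℝ := 1 - Polynomial.C c * Polynomial.X ^ 2 with hq
  set C : G →L[ℂ] G := Polynomial.aeval B q with hC
  have hCx : ∀ x, C x = x - (c : ℂ) • B (B x) := by
    intro x
    rw [hC, hq, map_sub, map_one, map_mul, Polynomial.aeval_C, map_pow, Polynomial.aeval_X,
      ← Algebra.smul_def, sq]
    rfl
  have hCn : ‖C‖ ≤ 1 := by
    refine opNorm_le_bound _ zero_le_one fun x => ?_
    rw [one_mul, hCx]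
    refine le_of_sq_le_sq ?_ (norm_nonneg _)
    have h1 : ‖x - (c : ℂ) • B (B x)‖ ^ 2 =
        ‖x‖ ^ 2 - 2 * (c * ‖B x‖ ^ 2) + (c * ‖B (B x)‖) ^ 2 := by
      rw [@norm_sub_sq ℂ, inner_smul_right, ← adjoint_inner_left, hB, inner_self_eq_norm_sq_to_K,
        norm_smul, Complex.norm_real, Real.norm_of_nonneg hc0.le]
      congr 3
      have h : (c : ℂ) * (‖B x‖ : ℂ) ^ 2 = ((c * ‖B x‖ ^ 2 : ℝ) : ℂ) := by push_cast; rfl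
      exact (congrArg Complex.re h).trans (Complex.ofReal_re _)
    have h2 : c * ‖B (B x)‖ ^ 2 ≤ ‖B x‖ ^ 2 := by
      rw [hc, inv_mul_le_iff₀ (by positivity), ← mul_pow]
      refine pow_le_pow_left₀ (norm_nonneg _) ((B.le_opNorm _).trans ?_) 2
      gcongr
      linarith
    have h3 : (c * ‖B (B x)‖) ^ 2 ≤ c * ‖B x‖ ^ 2 := by
      calc (c * ‖B (B x)‖) ^ 2 = c * (c * ‖B (B x)‖ ^ 2) := by ring
        _ ≤ c * ‖B x‖ ^ 2 := by gcongr
    have h4 : 0 ≤ c * ‖B x‖ ^ 2 := by positivity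
    rw [h1]
    linarith
  -- The fixed vectors of `C` satisfy `B (B x) = 0`, that is `B x = 0` since `B` is self-adjoint.
  have hloc : LinearMap.eqLocus (C : G →ₗ[ℂ] G) ((1 : G →L[ℂ] G) : G →ₗ[ℂ] G) = K := by
    ext x
    rw [LinearMap.mem_eqLocus, hK]
    change C x = x ↔ _
    rw [hCx, sub_eq_self, smul_eq_zero]
    constructor
    · rintro (h | h)
      · exact absurd (Complex.ofReal_eq_zero.1 h) hc0.ne'
      · rw [← @inner_self_eq_zero ℂ, ← adjoint_inner_right, hB, h, inner_zero_right]
    · intro h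
      right
      rw [h, map_zero]
  have hint : ∀ k : ℕ, ∫ t, (1 - c * t ^ 2) ^ k ∂μ = (inner ℂ ξ ((C ^ k) ξ)).re := by
    intro k
    have h := integral_eval_eq hR hm (q ^ k)
    rw [map_pow, ← hC] at h
    rw [← h]
    refine integral_congr_ae (Eventually.of_forall fun t => ?_)
    simp [hq]
  -- The mean ergodic theorem gives the limit of the averages of `Cᵏ ξ`, so the integrals are
  -- averaged as well; the two limits must agree.
  have t1 := (tendsto_integral_chiZero hR0 hR).cesaro
  have t2 := ContinuousLinearMap.tendsto_birkhoffAverage_orthogonalProjection C hCn ξ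
  have hKl : ((LinearMap.eqLocus (C : G →ₗ[ℂ] G)
      ((1 : G →L[ℂ] G) : G →ₗ[ℂ] G)).orthogonalProjectionOnto ξ : G) =
      K.starProjection ξ := by
    symm
    apply Submodule.eq_starProjection_of_mem_orthogonal
    · rw [← hloc]; exact Subtype.prop _
    · have := (LinearMap.eqLocus (C : G →ₗ[ℂ] G)
        ((1 : G →L[ℂ] G) : G →ₗ[ℂ] G)).sub_starProjection_mem_orthogonal ξ
      rw [Submodule.starProjection_apply] at this
      rw [← hloc]
      exact this
  rw [hKl] at t2
  have t3 := ((continuous_const.inner continuous_id : Continuous fun y : G =>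
    inner ℂ ξ y).tendsto _).comp t2
  have t4 := (Complex.continuous_re.tendsto _).comp t3
  have h5 : (inner ℂ ξ (K.starProjection ξ)).re = ‖K.starProjection ξ‖ ^ 2 := by
    rw [inner_starProjection_self, Complex.ofReal_re]
  have t5 : Tendsto (fun n : ℕ => (n : ℝ)⁻¹ * ∑ i ∈ Finset.range n, ∫ t, (1 - c * t ^ 2) ^ i ∂μ)
      atTop (𝓝 ((inner ℂ ξ (K.starProjection ξ)).re)) := by
    refine t4.congr fun n => ?_
    simp only [Function.comp, birkhoffAverage, birkhoffSum, id]
    rw [inner_smul_right, inner_sum]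
    have h7 : ((n : ℂ)⁻¹ : ℂ) = (((n : ℝ)⁻¹ : ℝ) : ℂ) := by push_cast; rfl
    rw [h7, Complex.re_ofReal_mul, Complex.re_sum]
    congr 1
    refine Finset.sum_congr rfl fun i _ => ?_
    rw [hint, ← hom_coe_pow (fun X : G →L[ℂ] G => (X : G → G)) rfl (fun _ _ => rfl)]
  rw [← h5]
  exact tendsto_nhds_unique t1 t5

/-- The spectral measure of a self-adjoint operator at a vector. -/
theorem exists_spectral_measure {B : G →L[ℂ] G} (hB : IsSelfAdjoint B) (ξ : G) :
    ∃ μ : Measure ℝ, IsFiniteMeasure μ ∧ (∃ R : ℝ, μ (Set.Icc (-R) R)ᶜ = 0) ∧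
      ∀ n : ℕ, ∫ t, t ^ n ∂μ = (inner ℂ ξ ((B ^ n) ξ)).re := by
  let X := spectrum ℝ B
  have hX : IsCompact X := spectrum.isCompact B
  have : CompactSpace X := isCompact_iff_compactSpace.1 hX
  -- The positive functional `g ↦ ⟨ξ, g(B) ξ⟩` of the continuous functional calculus. The spectrum
  -- is compact, so the Riesz–Markov theorem for compactly supported functions applies to all
  -- continuous functions on it.
  let Λ : CompactlySupportedContinuousMap X ℝ →ₚ[ℝ] ℝ := PositiveLinearMap.mk₀
    { toFun := fun g => (inner ℂ ξ ((cfcHom hB (g : C(X, ℝ))) ξ)).re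
      map_add' := fun g h => by
        change (inner ℂ ξ ((cfcHom hB ((g : C(X, ℝ)) + (h : C(X, ℝ)))) ξ)).re = _
        rw [map_add, add_apply, inner_add_right, Complex.add_re]
      map_smul' := fun r g => by
        change (inner ℂ ξ ((cfcHom hB (r • (g : C(X, ℝ)))) ξ)).re = _
        rw [map_smul]
        change (inner ℂ ξ ((r : ℂ) • (cfcHom hB (g : C(X, ℝ))) ξ)).re = _
        rw [inner_smul_right, Complex.re_ofReal_mul]
        rfl }
    (fun g hg => by
      have h1 : 0 ≤ cfcHom hB (g : C(X, ℝ)) := (cfcHom_nonneg_iff hB).2 hg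
      have h2 := (ContinuousLinearMap.nonneg_iff_isPositive _).1 h1
      exact h2.re_inner_nonneg_right ξ)
  refine ⟨(RealRMK.rieszMeasure Λ).map Subtype.val, inferInstance, ?_, fun n => ?_⟩
  · obtain ⟨R, hR⟩ := hX.isBounded.subset_closedBall 0
    refine ⟨R, ?_⟩
    rw [Measure.map_apply measurable_subtype_coe measurableSet_Icc.compl]
    have : (Subtype.val ⁻¹' (Set.Icc (-R) R)ᶜ : Set X) = ∅ := by
      ext t
      simp only [Set.mem_preimage, Set.mem_compl_iff, Set.mem_empty_iff_false, iff_false, not_not]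
      have h := hR t.2
      rw [Real.closedBall_eq_Icc] at h
      simpa using h
    rw [this, measure_empty]
  · rw [integral_map measurable_subtype_coe.aemeasurable
      (Continuous.aestronglyMeasurable (by fun_prop))]
    let g : C(X, ℝ) := (ContinuousMap.restrict X (.id ℝ)) ^ n
    have h := RealRMK.integral_rieszMeasure Λ (CompactlySupportedContinuousMap.continuousMapEquiv g)
    have h2 : Λ (CompactlySupportedContinuousMap.continuousMapEquiv g) =
        (inner ℂ ξ ((cfcHom hB g) ξ)).re := rfl
    have h3 : cfcHom hB g = B ^ n := by
      change cfcHom hB ((ContinuousMap.restrict X (.id ℝ)) ^ n) = _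
      rw [map_pow]
      congr 1
      exact cfcHom_id hB
    rw [h2, h3] at h
    exact h

end Spectral

/-! ### Return to the standard module: functional calculus, kernels and the Mishchenko index. -/

section Main

open ContinuousLinearMap

/-- Polarization inside `S`, which `X` need not preserve: only sums of vectors of `S` are inserted
into the form. -/
theorem inner_eq_zero_of_forall_mem {G : Type*} [NormedAddCommGroup G] [InnerProductSpace ℂ G]
    {X : G →L[ℂ] G} {S : Submodule ℂ G} (h : ∀ v ∈ S, inner ℂ v (X v) = 0) {v w : G}
    (hv : v ∈ S) (hw : w ∈ S) : inner ℂ v (X w) = 0 := by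
  have h1 := h _ (S.add_mem hv hw)
  have h2 := h _ (S.add_mem hv (S.smul_mem Complex.I hw))
  simp only [map_add, map_smul, inner_add_left, inner_add_right, inner_smul_left, inner_smul_right,
    h v hv, h w hw, Complex.conj_I] at h1 h2
  have h3 : Complex.I * (inner ℂ v (X w) - inner ℂ w (X v)) = 0 := by linear_combination h2
  have h4 := (mul_eq_zero.1 h3).resolve_left Complex.I_ne_zero
  linear_combination (h1 + h4) / 2

variable {H : Type u} [NormedAddCommGroup H] [InnerProductSpace ℂ H] [CompleteSpace H]
variable {M : VonNeumannAlgebra H}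

theorem matrixCoeff_eq (T : EndA (vnAlg M) (StdModule (vnAlg M))) (x : StdModule (vnAlg M))
    (η : H) : matrixCoeff T x η = inner ℂ (hat x η) (rep T (hat x η)) := by
  rw [rep_hat_apply, inner_hat]
  rfl

/-- For fixed `η` the vectors `x ⊗ η` form a complex subspace. Polarization on it allows pairing `(S
a - T a) ⊗ η` with the image of `a ⊗ η`, which is the same vector. -/
theorem eq_of_matrixCoeff_eq {S T : EndA (vnAlg M) (StdModule (vnAlg M))}
    (h : ∀ x η, matrixCoeff S x η = matrixCoeff T x η) : S = T := by
  apply Subtype.ext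
  apply LinearMap.ext
  intro a
  apply hat_injective
  ext1 η
  let N : Submodule ℂ (L2 H) :=
    { carrier := {v | ∃ x : StdModule (vnAlg M), hat x η = v}
      add_mem' := by rintro _ _ ⟨x, rfl⟩ ⟨y, rfl⟩; exact ⟨x + y, rfl⟩
      zero_mem' := ⟨0, rfl⟩
      smul_mem' := by
        rintro c _ ⟨x, rfl⟩
        exact ⟨_, congrArg (fun Y : H →L[ℂ] L2 H => Y η) (hat_smul_algebraMap x c)⟩ }
  have h1 : ∀ v ∈ N, inner ℂ v ((rep S - rep T) v) = 0 := by
    rintro _ ⟨x, rfl⟩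
    rw [sub_apply, inner_sub_right, ← matrixCoeff_eq, ← matrixCoeff_eq, h, sub_self]
  have h2 : hat (S.1 a - T.1 a) η ∈ N := ⟨_, rfl⟩
  have h3 := inner_eq_zero_of_forall_mem h1 h2 (w := hat a η) ⟨a, rfl⟩
  rw [sub_apply, rep_hat_apply, rep_hat_apply, hat_sub, sub_apply, inner_self_eq_zero] at h3
  exact sub_eq_zero.1 h3

theorem rep_pow (T : EndA (vnAlg M) (StdModule (vnAlg M))) (n : ℕ) : rep (T ^ n) = rep T ^ n := by
  induction n with
  | zero => rw [pow_zero, pow_zero, rep_one]; rfl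
  | succ n ih => rw [pow_succ, pow_succ, rep_mul, ih]; rfl

theorem mem_ker_iff_adjoint_comp {X : L2 H →L[ℂ] L2 H} (x : L2 H) :
    x ∈ X.ker ↔ (adjoint X ∘L X) x = 0 := by
  change X x = 0 ↔ adjoint X (X x) = 0
  refine ⟨fun h => by rw [h, map_zero], fun h => ?_⟩
  rw [← @inner_self_eq_zero ℂ, ← adjoint_inner_right, h, inner_zero_right]

theorem rep_star_mul_self (h : EndA (vnAlg M) (StdModule (vnAlg M))) :
    rep (star h * h) = adjoint (rep h) ∘L rep h := by rw [rep_mul, rep_star]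

theorem isSelfAdjoint_adjoint_comp (X : L2 H →L[ℂ] L2 H) : IsSelfAdjoint (adjoint X ∘L X) :=
  IsSelfAdjoint.star_mul_self X

/-- The quadratic form of `χ_{0}(h⋆h)`. -/
theorem IsMeasurableCalculus.matrixCoeff_eq_norm_sq {h S : EndA (vnAlg M) (StdModule (vnAlg M))}
    (hS : IsMeasurableCalculus (star h * h) chiZero S) [(rep h).ker.HasOrthogonalProjection]
    (x : StdModule (vnAlg M)) (η : H) :
    matrixCoeff S x η = ((‖(rep h).ker.starProjection (hat x η)‖ ^ 2 : ℝ) : ℂ) := by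
  obtain ⟨μ, ⟨hfin, hc, hm⟩, hμ⟩ := hS x η
  rw [hμ, integral_chiZero_eq hc (isSelfAdjoint_adjoint_comp (rep h)) (fun n => ?_)
    mem_ker_iff_adjoint_comp]
  have h1 := congrArg Complex.re (hm n)
  rwa [Complex.ofReal_re, matrixCoeff_eq, rep_pow, rep_star_mul_self] at h1

theorem isMeasurableCalculus_chiZero {h p : EndA (vnAlg M) (StdModule (vnAlg M))}
    [(rep h).ker.HasOrthogonalProjection] (hp : rep p = (rep h).ker.starProjection) :
    IsMeasurableCalculus (star h * h) chiZero p := by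
  intro x η
  have hB := isSelfAdjoint_adjoint_comp (rep h)
  obtain ⟨μ, hfin, hc, hm⟩ := exists_spectral_measure hB (hat x η)
  refine ⟨μ, ⟨hfin, hc, fun n => ?_⟩, ?_⟩
  · rw [hm, matrixCoeff_eq, rep_pow, rep_star_mul_self]
    exact (isSelfAdjoint_iff_isSymmetric.1 (hB.pow n)).coe_re_inner_self_apply (hat x η)
  · rw [integral_chiZero_eq hc hB hm mem_ker_iff_adjoint_comp, matrixCoeff_eq, hp,
      inner_starProjection_self]

/-- Small tails make the projection send each `hat a` to some `hat b`. This is how the Fredholm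
property places the spectral projection in `End_A(H_A)`. -/
theorem IsFin.exists_rep_eq_starProjection {U : Submodule ℂ (L2 H)} (hU : IsFin M U)
    [U.HasOrthogonalProjection] :
    ∃ p : EndA (vnAlg M) (StdModule (vnAlg M)), rep p = U.starProjection := by
  have h : ∀ a : StdModule (vnAlg M), ∃ b : StdModule (vnAlg M),
      U.starProjection ∘L hat a = hat b := fun a => by
    obtain ⟨b, hb⟩ := hU.exists_fixed
      ((equivariant_starProjection hU.invariant).intertwines (intertwines_hat a))
      fun η => U.starProjection_apply_mem _
    exact ⟨b.1, hb.symm⟩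
  have h' : adjoint U.starProjection = U.starProjection := isSelfAdjoint_starProjection U
  exact exists_rep_eq h (by rw [h']; exact h)

theorem isStarProjection_of_rep {p : EndA (vnAlg M) (StdModule (vnAlg M))}
    {U : Submodule ℂ (L2 H)} [U.HasOrthogonalProjection] (hp : rep p = U.starProjection) :
    IsStarProjection p := by
  refine ⟨rep_injective ?_, rep_injective ?_⟩
  · rw [rep_mul, hp]
    exact U.isIdempotentElem_starProjection
  · rw [rep_star, hp]
    exact isSelfAdjoint_starProjection U

theorem im_eq_fixed {p : EndA (vnAlg M) (StdModule (vnAlg M))}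
    {U : Submodule ℂ (L2 H)} [U.HasOrthogonalProjection] (hp : rep p = U.starProjection) :
    im p = fixed M U := by
  ext a
  constructor
  · rintro ⟨b, rfl⟩ η
    rw [← rep_hat_apply, hp]
    exact U.starProjection_apply_mem _
  · intro ha
    refine ⟨a, hat_injective ?_⟩
    ext1 η
    rw [← rep_hat_apply, hp]
    exact Submodule.starProjection_eq_self_iff.2 (ha η)

theorem IsFin.exists_chiZero {h : EndA (vnAlg M) (StdModule (vnAlg M))}
    (hU : IsFin M (rep h).ker) :
    ∃ p, IsMeasurableCalculus (star h * h) chiZero p ∧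
      (∀ S, IsMeasurableCalculus (star h * h) chiZero S → S = p) ∧
      IsStarProjection p ∧ im p = fixed M (rep h).ker := by
  have := hU.isClosed.completeSpace_coe
  obtain ⟨p, hp⟩ := hU.exists_rep_eq_starProjection
  have hc := isMeasurableCalculus_chiZero hp
  refine ⟨p, hc, fun S hS => eq_of_matrixCoeff_eq fun x η => ?_, isStarProjection_of_rep hp,
    im_eq_fixed hp⟩
  rw [hS.matrixCoeff_eq_norm_sq, hc.matrixCoeff_eq_norm_sq]

theorem ker_eq_fixed (f : EndA (vnAlg M) (StdModule (vnAlg M))) :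
    ker f = fixed M (rep f).ker := by
  ext a
  constructor
  · intro ha η
    change rep f (hat a η) = 0
    have ha' : f.1 a = 0 := ha
    rw [rep_hat_apply, ha']
    rfl
  · intro ha
    refine hat_injective ?_
    ext1 η
    rw [← rep_hat_apply]
    exact ha η

theorem coker_eq_fixed (f : EndA (vnAlg M) (StdModule (vnAlg M))) :
    coker f = fixed M (adjoint (rep f)).ker := by
  rw [← rep_star, ← ker_eq_fixed]
  ext y
  constructor
  · intro hy
    refine ext_ip_right (vnAlg M) fun x => ?_
    rw [ip_star_right, ip_zero_right]
    exact hy x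
  · intro hy x
    have hy' : (star f).1 y = 0 := hy
    rw [← ip_star_right, hy', ip_zero_right]

theorem IsFin.cls_eq_of_eq_fixed {U : Submodule ℂ (L2 H)} (hU : IsFin M U)
    {N : Submodule (vnAlg M)ᵐᵒᵖ (StdModule (vnAlg M))} (h : N = fixed M U) :
    ∃ hN : IsFGP (vnAlg M) N, K0.cls hN = hU.cls := by
  subst h
  exact ⟨hU.isFGP, rfl⟩

theorem IsCompactOp.isCpt {k : EndA (vnAlg M) (StdModule (vnAlg M))} (hk : IsCompactOp k) :
    IsCpt M (rep k) := ⟨isTame_rep k, hk.tailSmall.1, hk.tailSmall.2⟩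

/-- Kernel and orthogonal complement of the image of `f + k` are read off from the kernels of `rep
(f + k)` and its adjoint, where invariance under compact perturbations is known. -/
theorem IsFredholm.exists_isFGP_ker_coker_add {f k : EndA (vnAlg M) (StdModule (vnAlg M))}
    (hf : IsFredholm f) (hk : IsCompactOp k) :
    ∃ (h₁ : IsFGP (vnAlg M) (ker (f + k))) (h₂ : IsFGP (vnAlg M) (coker (f + k))),
      K0.cls h₁ - K0.cls h₂ =
        hf.isFredholmOp.isFin_ker.cls - hf.isFredholmOp.adjointOp.isFin_ker.cls := by
  obtain ⟨h₁, e₁⟩ := (hf.isFredholmOp.add hk.isCpt).isFin_ker.cls_eq_of_eq_fixed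
    (N := ker (f + k)) (by rw [ker_eq_fixed, rep_add])
  obtain ⟨h₂, e₂⟩ := (hf.isFredholmOp.add hk.isCpt).adjointOp.isFin_ker.cls_eq_of_eq_fixed
    (N := coker (f + k)) (by rw [coker_eq_fixed, rep_add])
  exact ⟨h₁, h₂, by rw [e₁, e₂, hf.isFredholmOp.cls_sub_cls_add hk.isCpt]⟩

theorem rep_sum {ι : Type*} (s : Finset ι) (T : ι → EndA (vnAlg M) (StdModule (vnAlg M))) :
    rep (∑ i ∈ s, T i) = ∑ i ∈ s, rep (T i) := by
  classical
  induction s using Finset.induction_on with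
  | empty => exact rep_zero
  | insert i s hi ih => rw [Finset.sum_insert hi, Finset.sum_insert hi, rep_add, ih]

/-- The restriction of `f` to the first `n` coordinates. -/
noncomputable def head (f : EndA (vnAlg M) (StdModule (vnAlg M))) (n : ℕ) :
    EndA (vnAlg M) (StdModule (vnAlg M)) :=
  ∑ i ∈ Finset.range n, rankOne (vnAlg M) (f.1 (stdBasis M i)) (stdBasis M i)

theorem rep_head (f : EndA (vnAlg M) (StdModule (vnAlg M))) (n : ℕ) :
    rep (head f n) = rep f ∘L cut (Finset.range n) := by
  rw [head, rep_sum]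
  ext1 x
  rw [comp_apply, cut_apply, sum_apply, map_sum]
  refine Finset.sum_congr rfl fun i _ => ?_
  rw [rep_rankOne, hat_stdBasis, rep_incl, comp_apply]
  congr 1
  refine ext_inner_left ℂ fun η => ?_
  rw [adjoint_inner_right, inner_incl_left]

theorem isCompactOp_neg_head (f : EndA (vnAlg M) (StdModule (vnAlg M))) (n : ℕ) :
    IsCompactOp (-head f n) := fun ε hε => by
  refine ⟨-head f n, neg_mem (sum_mem fun i _ => AddSubgroup.subset_closure ⟨_, _, rfl⟩),
    fun x => ?_⟩
  rw [sub_self, ← norm_hat, ← norm_hat, hat_zero, norm_zero]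
  positivity

/-- Closedness is needed in the norm of `H_A`, not in `L2 H`. The operators `hat a` whose first `n`
coordinates vanish form a complete space, on which composition with `rep f` is bounded below in
operator norm. -/
theorem BoundedBelow.hasClosedRange {f : EndA (vnAlg M) (StdModule (vnAlg M))} {C : ℝ} {n : ℕ}
    (hC : 0 ≤ C) (h : BoundedBelow (rep f) C n) : HasClosedRange (f + -head f n) := by
  set g := f + -head f n with hg
  have hrep : rep g = rep f ∘L tail n := by
    rw [hg, rep_add, rep_neg, rep_head]
    ext1 x
    rw [comp_apply, tail_apply, map_sub, sub_eq_add_neg]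
    rfl
  let D : Set (H →L[ℂ] L2 H) :=
    Set.range (hat : StdModule (vnAlg M) → _) ∩ {Y | cut (Finset.range n) ∘L Y = 0}
  have hD : IsClosed D :=
    (isClosed_range_hat M).inter (isClosed_eq (by fun_prop) continuous_const)
  have hcomp := hD.completeSpace_coe
  have htail : ∀ Y ∈ D, ∀ η, tail n (Y η) = Y η := fun Y hY η => by
    have hY' : cut (Finset.range n) (Y η) = 0 := congrArg (fun Z : H →L[ℂ] L2 H => Z η) hY.2
    rw [tail_apply, hY', sub_zero]
  have hanti : AntilipschitzWith C.toNNReal (fun Y : D => rep f ∘L (Y : H →L[ℂ] L2 H)) := by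
    refine AntilipschitzWith.of_le_mul_dist fun Y Z => ?_
    rw [Subtype.dist_eq, dist_eq_norm, dist_eq_norm, ← comp_sub, Real.coe_toNNReal _ hC]
    refine opNorm_le_bound _ (by positivity) fun η => ?_
    have h1 := h ((Y : H →L[ℂ] L2 H) η - (Z : H →L[ℂ] L2 H) η)
    rw [map_sub, htail _ Y.2, htail _ Z.2] at h1
    refine h1.trans ?_
    rw [mul_assoc]
    exact mul_le_mul_of_nonneg_left
      ((rep f ∘L ((Y : H →L[ℂ] L2 H) - (Z : H →L[ℂ] L2 H))).le_opNorm η) hC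
  have hlip : UniformContinuous (fun Y : D => rep f ∘L (Y : H →L[ℂ] L2 H)) :=
    ((compL ℂ H (L2 H) (L2 H)) (rep f)).uniformContinuous.comp uniformContinuous_subtype_val
  have hcl := hanti.isClosed_range hlip
  intro y hy
  have hmem : hat y ∈ Set.range (fun Y : D => rep f ∘L (Y : H →L[ℂ] L2 H)) := by
    rw [← hcl.closure_eq, Metric.mem_closure_iff]
    intro ε hε
    obtain ⟨x, hx⟩ := hy ε hε
    -- Removing the first `n` entries of `x` does not change `g x`, since `g` is `f` after deletion
    -- of these entries.
    refine ⟨hat (g.1 x), ⟨⟨hat (x - trunc (Finset.range n) x), ⟨_, rfl⟩, ?_⟩, ?_⟩, ?_⟩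
    · change cut (Finset.range n) ∘L hat (x - trunc (Finset.range n) x) = 0
      ext1 η
      rw [hat_sub, hat_trunc]
      exact cut_tail n (hat x η)
    · change rep f ∘L hat (x - trunc (Finset.range n) x) = _
      rw [hat_sub, hat_trunc, ← rep_hat, hrep]
      rfl
    · rwa [dist_eq_norm, ← hat_sub, norm_hat]
  obtain ⟨⟨_, ⟨z, rfl⟩, hz⟩, hzy⟩ := hmem
  refine ⟨z, hat_injective ?_⟩
  rw [← hzy, ← rep_hat, hrep]
  ext1 η
  change rep f (tail n (hat z η)) = rep f (hat z η)
  rw [htail _ ⟨⟨z, rfl⟩, hz⟩]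

theorem IsFredholm.exists_isGoodPerturbation {f : EndA (vnAlg M) (StdModule (vnAlg M))}
    (hf : IsFredholm f) : ∃ k, IsGoodPerturbation f k := by
  obtain ⟨C, N, hC, h⟩ := hf.isFredholmOp.exists_boundedBelow
  exact ⟨-head f N, isCompactOp_neg_head f N, (h N le_rfl).hasClosedRange hC⟩

theorem IsFredholm.mindex_eq {f : EndA (vnAlg M) (StdModule (vnAlg M))} (hf : IsFredholm f) :
    Mindex f = hf.isFredholmOp.isFin_ker.cls - hf.isFredholmOp.adjointOp.isFin_ker.cls := by
  have hx : ∃ x, IsMindex f x := by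
    obtain ⟨k, hk⟩ := hf.exists_isGoodPerturbation
    obtain ⟨h₁, h₂, -⟩ := hf.exists_isFGP_ker_coker_add hk.1
    exact ⟨_, k, hk, h₁, h₂, rfl⟩
  -- The default value `0` is excluded by the existence of a good perturbation, and the chosen value
  -- is the one that all perturbations share.
  rw [Mindex, dif_pos hx]
  obtain ⟨k, hk, h₁, h₂, e⟩ := hx.choose_spec
  obtain ⟨h₁', h₂', e'⟩ := hf.exists_isFGP_ker_coker_add hk.1
  rw [e, ← e']

end Main

end HilbertIndex

/-! ### The theorem. -/

theorem mainTheorem7 {H : Type*} [NormedAddCommGroup H] [InnerProductSpace ℂ H] [CompleteSpace H]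
    (M : VonNeumannAlgebra H)
    (f : HilbertIndex.EndA (HilbertIndex.vnAlg M)
      (HilbertIndex.StdModule (HilbertIndex.vnAlg M)))
    (hf : HilbertIndex.IsFredholm f) :
    -- the operators `χ_{0}(f⋆f)` and `χ_{0}(ff⋆)` of `End_A(H_A)` are defined
    (∃! p, HilbertIndex.IsMeasurableCalculus (star f * f) HilbertIndex.chiZero p) ∧
    (∃! q, HilbertIndex.IsMeasurableCalculus (f * star f) HilbertIndex.chiZero q) ∧
    -- they are projections, their images are finitely generated projective, and the difference
    -- of the classes of these is the index
    (∀ p q, HilbertIndex.IsMeasurableCalculus (star f * f) HilbertIndex.chiZero p →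
      HilbertIndex.IsMeasurableCalculus (f * star f) HilbertIndex.chiZero q →
      IsStarProjection p ∧ IsStarProjection q ∧
      ∃ (hp : HilbertIndex.IsFGP (HilbertIndex.vnAlg M) (HilbertIndex.im p))
        (hq : HilbertIndex.IsFGP (HilbertIndex.vnAlg M) (HilbertIndex.im q)),
        HilbertIndex.K0.cls hp - HilbertIndex.K0.cls hq = HilbertIndex.Mindex f) ∧
    -- the index is defined by means of compact perturbations with closed image: there are such
    -- perturbations, and each of them gives the index
    (∃ k, HilbertIndex.IsGoodPerturbation f k) ∧
    ∀ k, HilbertIndex.IsGoodPerturbation f k →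
      ∃ (h₁ : HilbertIndex.IsFGP (HilbertIndex.vnAlg M) (HilbertIndex.ker (f + k)))
        (h₂ : HilbertIndex.IsFGP (HilbertIndex.vnAlg M) (HilbertIndex.coker (f + k))),
        HilbertIndex.Mindex f = HilbertIndex.K0.cls h₁ - HilbertIndex.K0.cls h₂ := by
  have hF := hf.isFredholmOp
  have hU := hF.adjointOp.isFin_ker
  obtain ⟨p, hp, hpu, hpp, hpi⟩ := hF.isFin_ker.exists_chiZero
  -- The operator `χ_{0}(f f⋆)` is obtained from the same statement for `star f`, since `f = star
  -- (star f)`.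
  rw [← HilbertIndex.rep_star] at hU
  obtain ⟨q, hq, hqu, hqp, hqi⟩ := hU.exists_chiZero
  rw [HilbertIndex.star_star_endA] at hq hqu
  rw [HilbertIndex.rep_star] at hqi
  refine ⟨⟨p, hp, hpu⟩, ⟨q, hq, hqu⟩, fun p' q' hp' hq' => ?_, hf.exists_isGoodPerturbation,
    fun k hk => ?_⟩
  · obtain rfl := hpu p' hp'
    obtain rfl := hqu q' hq'
    obtain ⟨h₁, e₁⟩ := hF.isFin_ker.cls_eq_of_eq_fixed hpi
    obtain ⟨h₂, e₂⟩ := hF.adjointOp.isFin_ker.cls_eq_of_eq_fixed hqi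
    exact ⟨hpp, hqp, h₁, h₂, by rw [e₁, e₂, hf.mindex_eq]⟩
  · obtain ⟨h₁, h₂, e⟩ := hf.exists_isFGP_ker_coker_add hk.1
    exact ⟨h₁, h₂, hf.mindex_eq.trans e.symm⟩
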